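/- Let $\mathbf k$ be a field of characteristic zero, $E$ a finite-dimensional $\mathbf k$-vector space (in degree $0$), and let $\underline{\mathcal P}=\underline\Gamma(E)/(R)$ be the quadratic non-$\Sigma$ operad generated by $E$ in arity $2$ with relations $R\subset\underline\Gamma(E)(3)=(E\otimes E)\oplus(E\otimes E)$, where the two summands are spanned by the elements $a\circ_1b$ and $a\circ_2b$ ($\underline{\mathcal P}$ may, but need not, be Koszul). Let $\underline{\mathcal P}^!=\underline\Gamma(E^\#)/(R^\perp)$ be its quadratic dual, where $E^\#$ is the linear dual and $R^\perp$ is the annihilator of $R$ for the pairing $\langle(\varphi,\psi),(x,y)\rangle=\varphi(x)-\psi(y)$. Let $\mathcal P$ and $\mathcal P^!$ be the symmetrizations of $\underline{\mathcal P}$ and $\underline{\mathcal P}^!$, so that $\mathcal P(n)=\underline{\mathcal P}(n)\otimes\mathbf k[\Sigma_n]$. Let $\underline\chi\in(\underline{\mathcal P}\otimes\underline{\mathcal P}^!)(2)\cong E\otimes E^\#$ be the element corresponding to the identity of $E$. For an operad $\mathcal T$ let $\Lambda\mathcal T(n)=\uparrow^{n-1}\mathcal T(n)\otimes\mathrm{sgn}_n$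 be its operadic suspension, in which $f\circ_i g$, for $g$ of arity $b$, is $(-1)^{(b-1)(i-1)}$ times the composition in $\mathcal T$. Let $\chi=\underline\chi+\underline\chi\tau\in\Lambda(\mathcal P\otimes\mathcal P^!)(2)^{\Sigma_2}$, with $\tau$ the transposition acting as in the suspension. For a $\mathcal P$-algebra $A$ (a vector space in degree $0$ with a morphism of operads $\alpha:\mathcal P\to\mathcal End_A$) put $C^{n-1}_{\mathcal P}(A;A)=\Lambda(\mathcal End_A\otimes\mathcal P^!)(n)^{\Sigma_n}$, with the differential $d f=\mathrm{Aver}\big(\sum_i\chi_A\circ_i f-(-1)^{|f|}\sum_i f\circ_i\chi_A\big)$, where $\chi_A=(\alpha\otimes\mathrm{id})(\chi)$, $|f|=n-1$ for $f\in C^{n-1}_{\mathcal P}(A;A)$, the $\circ_i$ are those of the suspension, and $\mathrm{Aver}$ is the average over the symmetric group. An element $t\in\Lambda(\mathcal P\otimes\mathcal P^!)(n)$ acts on cochains by $t(f_1,\dots,f_n)=\mathrm{Aver}\big(\gamma((\alpha\otimes\mathrm{id})(t);f_1,\dots,f_n)\big)$, where $\gamma(s;f_1,\dots,f_n)=(\cdots((s\circ_1f_1)\circ_{a_1+1}f_2)\cdots)\circ_{a_1+\cdots+a_{n-1}+1}f_n$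 is the composition in the suspension, $a_j$ being the arity of $f_j$. Let $\mathcal Z_{\mathcal P}(n)\subset\Lambda(\mathcal P\otimes\mathcal P^!)(n)$ consist of those $t$ that act as cocycles, i.e. for which, for all $\mathcal P$-algebras $A$ and all homogeneous cochains $f_1,\dots,f_n$, $$d\,t(f_1,\dots,f_n)-(-1)^{n-1}\sum_{i=1}^n(-1)^{|f_1|+\cdots+|f_{i-1}|}\,t(f_1,\dots,d f_i,\dots,f_n)=0 .$$ **Theorem.** Let $n\ge 0$ and let $\underline t\in(\underline{\mathcal P}\otimes\underline{\mathcal P}^!)(n)$, regarded (after the degree shift) as an element of $\Lambda(\mathcal P\otimes\mathcal P^!)(n)$. Then $\underline t\in\mathcal Z_{\mathcal P}(n)$ if and only if $$\underline\chi\circ_2\underline t=\underline t\circ_1\underline\chi=\underline t\circ_2\underline\chi=\cdots=\underline t\circ_n\underline\chi=\underline\chi\circ_1\underline t ,$$ where these compositions are taken in the non-$\Sigma$ operad $\underline{\mathcal P}\otimes\underline{\mathcal P}^!$. -/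

import Mathlib

open scoped TensorProduct

/-! ### Collections with partial compositions

All operads and algebras below are concentrated in degree `0`; the degree `n - 1` that the operadic
suspension gives to the arity `n` component is encoded in explicit signs. Partial compositions are
numbered from `0`: `circ h i` is the operation usually written `∘_{i+1}`. To avoid casts, the arity
`l = m + n - 1` of a composite is a parameter that comes with a proof of `l + 1 = m + n`. -/

universe u

/-- Underlying data of a non-symmetric operad: a packaging device for the operads built below. -/
structure NSData (k : Type u) [Field k] where
  obj : ℕ → Type u
  [addCommGroup : ∀ n, AddCommGroup (obj n)]
  [module : ∀ n, Module k (obj n)]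
  one : obj 1
  circ : ∀ {m n l : ℕ}, l + 1 = m + n → Fin m → obj m →ₗ[k] obj n →ₗ[k] obj l

attribute [instance] NSData.addCommGroup NSData.module

/-- Underlying data of a symmetric operad: right `Σ_n`-modules, a unit and partial compositions.
A packaging device for the operads built below. -/
structure SymData (k : Type u) [Field k] extends NSData k where
  act : ∀ {n : ℕ}, Equiv.Perm (Fin n) → obj n →ₗ[k] obj n
  act_one : ∀ {n : ℕ} (x : obj n), act 1 x = x
  act_mul : ∀ {n : ℕ} (σ τ : Equiv.Perm (Fin n)) (x : obj n), act (σ * τ) x = act τ (act σ x)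

/-! ### Planar binary trees and quadratic non-symmetric operads -/

/-- Planar binary trees with vertices decorated by elements of `E`. -/
inductive BinTree (E : Type u) : Type u
  | leaf : BinTree E
  | node (e : E) (l r : BinTree E) : BinTree E

namespace BinTree

variable {E : Type u}

/-- Number of leaves (inputs). -/
def leaves : BinTree E → ℕ
  | leaf => 1
  | node _ l r => l.leaves + r.leaves

/-- Grafting of the root of `s` into the leaf number `i` (counted from `0`, left to right) of a
tree. -/
def graft : BinTree E → ℕ → BinTree E → BinTree E
  | leaf, _, s => s
  | node e l r, i, s =>
      if i < l.leaves then node e (l.graft i s) r else node e l (r.graft (i - l.leaves) s)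

theorem leaves_graft (t s : BinTree E) (i : ℕ) (hi : i < t.leaves) :
    (t.graft i s).leaves + 1 = t.leaves + s.leaves := by
  induction t generalizing i with
  | leaf => simp [graft, leaves]; omega
  | node e l r ihl ihr =>
    simp only [leaves] at hi
    by_cases h : i < l.leaves
    · have := ihl i h
      simp only [graft, h, if_true, leaves]; omega
    · have := ihr (i - l.leaves) (by omega)
      simp only [graft, h, if_false, leaves]; omega

end BinTree

/-- Planar binary trees with `n` leaves. -/
abbrev TreeN (E : Type u) (n : ℕ) : Type u := {t : BinTree E // t.leaves = n}

namespace TreeN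

variable {E : Type u}

/-- Grafting of trees with `m` and `n` leaves. -/
def graft {m n l : ℕ} (h : l + 1 = m + n) (i : Fin m) (t : TreeN E m) (s : TreeN E n) :
    TreeN E l :=
  ⟨t.1.graft i s.1, by
    have := t.1.leaves_graft s.1 i (by rw [t.2]; exact i.2)
    have h1 := t.2
    have h2 := s.2
    omega⟩

/-- The tree with one vertex, decorated by `e`. -/
def corolla (e : E) : TreeN E 2 := ⟨.node e .leaf .leaf, rfl⟩

end TreeN

noncomputable section

variable {k : Type u} [Field k]

/-- Arity `n` component of the linearization of the free non-symmetric operad on the *set* `E` of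
binary operations. -/
abbrev FreeNS (k : Type u) [Field k] (E : Type u) (n : ℕ) : Type u := TreeN E n →₀ k

/-- Bilinear extension of grafting. -/
def FreeNS.circ {E : Type u} {m n l : ℕ} (h : l + 1 = m + n) (i : Fin m) :
    FreeNS k E m →ₗ[k] FreeNS k E n →ₗ[k] FreeNS k E l :=
  Finsupp.lsum k fun t =>
    LinearMap.toSpanSingleton k _ (Finsupp.lmapDomain k k (TreeN.graft h i t))

/-- `Γ(E)(3)` for the free non-symmetric operad `Γ(E)` on the vector space `E` in arity `2`:
`(a ⊗ b, 0)` stands for `a ∘_1 b` and `(0, a ⊗ b)` for `a ∘_2 b`. -/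
abbrev GammaThree (k : Type u) [Field k] (E : Type u) [AddCommGroup E] [Module k E] : Type u :=
  (E ⊗[k] E) × (E ⊗[k] E)

section quadratic

variable {E : Type u} [AddCommGroup E] [Module k E]

/-- The decoration of the root (`0` for the tree without vertices). -/
def BinTree.rootLabel : BinTree E → E
  | .leaf => 0
  | .node e _ _ => e

/-- The element of `Γ(E)(3)` represented by a tree with three leaves. -/
def BinTree.toGammaThree (k : Type u) [Field k] {E : Type u} [AddCommGroup E] [Module k E] :
    BinTree E → GammaThree k E
  | .node a (.node b _ _) _ => (a ⊗ₜ[k] b, 0)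
  | .node a .leaf (.node b _ _) => (0, a ⊗ₜ[k] b)
  | _ => 0

/-- The projection of `FreeNS k E 2` onto `Γ(E)(2) = E`. -/
def evalTwo (k : Type u) [Field k] (E : Type u) [AddCommGroup E] [Module k E] :
    FreeNS k E 2 →ₗ[k] E :=
  Finsupp.linearCombination k fun t => t.1.rootLabel

/-- The projection of `FreeNS k E 3` onto `Γ(E)(3)`. -/
def evalThree (k : Type u) [Field k] (E : Type u) [AddCommGroup E] [Module k E] :
    FreeNS k E 3 →ₗ[k] GammaThree k E :=
  Finsupp.linearCombination k fun t => t.1.toGammaThree k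

/-- Membership in the operadic ideal of the free operad on the set `E` which is generated by the
linear relations between the decorations in arity `2` and by the preimage of `R ⊆ Γ(E)(3)`. The
quotient by it is `Γ(E)/(R)`. -/
inductive InIdeal (R : Submodule k (GammaThree k E)) : ∀ n : ℕ, FreeNS k E n → Prop
  | linear (x : FreeNS k E 2) (hx : evalTwo k E x = 0) : InIdeal R 2 x
  | relation (x : FreeNS k E 3) (hx : evalThree k E x ∈ R) : InIdeal R 3 x
  | zero (n : ℕ) : InIdeal R n 0
  | add {n : ℕ} (x y : FreeNS k E n) (hx : InIdeal R n x) (hy : InIdeal R n y) :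
      InIdeal R n (x + y)
  | smul {n : ℕ} (c : k) (x : FreeNS k E n) (hx : InIdeal R n x) : InIdeal R n (c • x)
  | circ_left {m n l : ℕ} (h : l + 1 = m + n) (i : Fin m) (x : FreeNS k E m) (y : FreeNS k E n)
      (hx : InIdeal R m x) : InIdeal R l (FreeNS.circ h i x y)
  | circ_right {m n l : ℕ} (h : l + 1 = m + n) (i : Fin m) (x : FreeNS k E m) (y : FreeNS k E n)
      (hy : InIdeal R n y) : InIdeal R l (FreeNS.circ h i x y)

/-- Arity `n` component of the operadic ideal. -/
def quadIdeal (R : Submodule k (GammaThree k E)) (n : ℕ) : Submodule k (FreeNS k E n) where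
  carrier := {x | InIdeal R n x}
  zero_mem' := .zero n
  add_mem' hx hy := .add _ _ hx hy
  smul_mem' c x hx := .smul c x hx

/-- Composition in `Γ(E)/(R)`. -/
def quadCirc (R : Submodule k (GammaThree k E)) {m n l : ℕ} (h : l + 1 = m + n) (i : Fin m) :
    (FreeNS k E m ⧸ quadIdeal R m) →ₗ[k]
      (FreeNS k E n ⧸ quadIdeal R n) →ₗ[k] (FreeNS k E l ⧸ quadIdeal R l) :=
  Submodule.liftQ _
    (LinearMap.flip <| Submodule.liftQ _
      (((FreeNS.circ h i).compr₂ (Submodule.mkQ (quadIdeal R l))).flip)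
      (fun y hy => LinearMap.mem_ker.2 <| LinearMap.ext fun x =>
        (Submodule.Quotient.mk_eq_zero (quadIdeal R l)).2 (InIdeal.circ_right h i x y hy)))
    (fun x hx => LinearMap.mem_ker.2 <| LinearMap.ext fun y => by
      obtain ⟨y, rfl⟩ := Submodule.Quotient.mk_surjective _ y
      exact (Submodule.Quotient.mk_eq_zero (quadIdeal R l)).2 (InIdeal.circ_left h i x y hx))

/-- The quadratic non-symmetric operad `Γ(E)/(R)` with generators `E` in arity `2` and relations
`R ⊆ Γ(E)(3)`. -/
def quadOperad (R : Submodule k (GammaThree k E)) : NSData k where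
  obj n := FreeNS k E n ⧸ quadIdeal R n
  one := Submodule.Quotient.mk (Finsupp.single ⟨.leaf, rfl⟩ 1)
  circ h i := quadCirc R h i

/-- The identification of `E` with the arity two component of `Γ(E)/(R)`. -/
def quadGen (R : Submodule k (GammaThree k E)) : E →ₗ[k] (quadOperad R).obj 2 where
  toFun e := Submodule.Quotient.mk (Finsupp.single (TreeN.corolla e) 1)
  map_add' a b := by
    refine (Submodule.Quotient.eq _).2 (InIdeal.linear _ ?_)
    simp [evalTwo, TreeN.corolla, BinTree.rootLabel]
  map_smul' c a := by
    refine (Submodule.Quotient.eq _).2 (InIdeal.linear _ ?_)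
    simp [evalTwo, TreeN.corolla, BinTree.rootLabel]

/-- The annihilator of `R` with respect to the pairing
`⟨(φ, ψ), (x, y)⟩ = φ(x) - ψ(y)` of `Γ(E^#)(3)` with `Γ(E)(3)`. -/
def quadPerp (R : Submodule k (GammaThree k E)) : Submodule k (GammaThree k (Module.Dual k E)) where
  carrier := {f | ∀ x ∈ R,
    TensorProduct.dualDistrib k E E f.1 x.1 - TensorProduct.dualDistrib k E E f.2 x.2 = 0}
  zero_mem' := by intro x _; simp
  add_mem' := by
    intro a b ha hb x hx
    have h1 := ha x hx
    have h2 := hb x hx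
    simp only [Prod.fst_add, Prod.snd_add, map_add, LinearMap.add_apply]
    linear_combination h1 + h2
  smul_mem' := by
    intro c a ha x hx
    have h1 := ha x hx
    simp only [Prod.smul_fst, Prod.smul_snd, map_smul, LinearMap.smul_apply, smul_eq_mul]
    linear_combination c * h1

/-- The quadratic dual `Γ(E^#)/(R^⊥)` of `Γ(E)/(R)`. -/
def quadDual (R : Submodule k (GammaThree k E)) : NSData k := quadOperad (quadPerp R)

end quadratic

/-! ### Tensor products, symmetrization, suspension -/

/-- The (arity-wise) tensor product of non-symmetric operads. -/
def NSData.tensor (P Q : NSData k) : NSData k where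
  obj n := P.obj n ⊗[k] Q.obj n
  one := P.one ⊗ₜ Q.one
  circ h i := TensorProduct.map₂ (P.circ h i) (Q.circ h i)

/-- The (arity-wise) tensor product of symmetric operads, with diagonal actions. -/
def SymData.tensor (P Q : SymData k) : SymData k where
  toNSData := P.toNSData.tensor Q.toNSData
  act σ := TensorProduct.map (P.act σ) (Q.act σ)
  act_one {n} x := by
    have h1 : P.act (1 : Equiv.Perm (Fin n)) = LinearMap.id := LinearMap.ext P.act_one
    have h2 : Q.act (1 : Equiv.Perm (Fin n)) = LinearMap.id := LinearMap.ext Q.act_one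
    rw [h1, h2, TensorProduct.map_id]; rfl
  act_mul σ τ x := by
    have h1 : P.act (σ * τ) = P.act τ ∘ₗ P.act σ := LinearMap.ext (P.act_mul σ τ)
    have h2 : Q.act (σ * τ) = Q.act τ ∘ₗ Q.act σ := LinearMap.ext (Q.act_mul σ τ)
    rw [h1, h2, TensorProduct.map_comp]; rfl

/-- The inputs of a partial composite `f ∘ g` with `g` (of arity `n`) plugged into the input `i` of
`f` (of arity `m`): they are the inputs `j ≠ i` of `f` and the inputs of `g`, the latter occupying
the positions `i, …, i + n - 1`. -/
def inputEquiv {m n l : ℕ} (h : l + 1 = m + n) (i : Fin m) :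
    {j : Fin m // j ≠ i} ⊕ Fin n ≃ Fin l where
  toFun
    | .inl j => ⟨if j.1.1 < i.1 then j.1.1 else j.1.1 - 1 + n, by
        have h1 := j.1.2
        have h2 : j.1.1 ≠ i.1 := fun h => j.2 (Fin.ext h)
        have h3 := i.2
        split_ifs <;> omega⟩
    | .inr c => ⟨i.1 + c.1, by have h1 := c.2; have h2 := i.2; omega⟩
  invFun a :=
    if h1 : a.1 < i.1 then
      .inl ⟨⟨a.1, by have h2 := i.2; omega⟩, fun h2 => by
        have h3 := congrArg Fin.val h2; simp only at h3; omega⟩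
    else if h2 : a.1 < i.1 + n then .inr ⟨a.1 - i.1, by omega⟩
    else .inl ⟨⟨a.1 + 1 - n, by have h3 := a.2; omega⟩, fun h3 => by
      have h4 := congrArg Fin.val h3; simp only at h4; omega⟩
  left_inv := by
    rintro (⟨⟨j, hj⟩, hji⟩ | ⟨c, hc⟩)
    · have h2 : j ≠ i.1 := fun h => hji (Fin.ext h)
      by_cases h1 : j < i.1
      · simp [h1]
      · have h3 : ¬ (j - 1 + n < i.1) := by omega
        have h4 : ¬ (j - 1 + n < i.1 + n) := by omega
        have h5 : j - 1 + n + 1 - n = j := by omega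
        simp [h1, h3, h4, h5]
    · simp [hc]
  right_inv := by
    rintro ⟨a, ha⟩
    by_cases h1 : a < i.1
    · simp [h1]
    · by_cases h2 : a < i.1 + n
      · simp [h1, h2]; omega
      · have h3 : ¬ (a + 1 - n < i.1) := by omega
        simp [h1, h2, h3]; omega

/-- Partial composition `σ ∘_i τ` of permutations. In the convention used here, the input `a` of
`p σ` is the input `σ a` of `p`; then `(p σ) ∘_i (q τ) = (p ∘_{σ i} q) (σ ∘_i τ)`. -/
def permCirc {m n l : ℕ} (h : l + 1 = m + n) (i : Fin m) (σ : Equiv.Perm (Fin m))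
    (τ : Equiv.Perm (Fin n)) : Equiv.Perm (Fin l) :=
  (inputEquiv h i).symm.trans
    ((Equiv.sumCongr (σ.subtypeEquiv (q := fun j => j ≠ σ i) fun _ => σ.injective.ne_iff.symm)
      τ).trans
      (inputEquiv h (σ i)))

/-- The symmetrization of a non-symmetric operad `P`: its arity `n` component is `P(n) ⊗ k[Σ_n]`,
and `Finsupp.single σ p` stands for `p ⊗ σ = p σ`. -/
def NSData.symmetrization (P : NSData k) : SymData k where
  obj n := Equiv.Perm (Fin n) →₀ P.obj n
  one := Finsupp.single 1 P.one
  circ {m n l} h i :=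
    Finsupp.lsum k fun σ : Equiv.Perm (Fin m) =>
      LinearMap.flip <| Finsupp.lsum k fun τ : Equiv.Perm (Fin n) =>
        ((P.circ h (σ i)).compr₂ (Finsupp.lsingle (permCirc h i σ τ))).flip
  act τ := Finsupp.lmapDomain _ k fun σ => σ * τ
  act_one x := by
    simp only [Finsupp.lmapDomain_apply, mul_one]
    exact Finsupp.mapDomain_id
  act_mul σ τ x := by
    simp only [Finsupp.lmapDomain_apply]
    rw [← Finsupp.mapDomain_comp]
    congr 1

/-- The inclusion of `P(n)` into the symmetrization. -/
def NSData.toSym (P : NSData k) (n : ℕ) : P.obj n →ₗ[k] P.symmetrization.obj n :=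
  Finsupp.lsingle (1 : Equiv.Perm (Fin n))

/-- The operadic suspension: `↑^{n-1} T(n) ⊗ sgn_n` in arity `n`, written on the same underlying
space. The action is twisted by the sign; for `g` of arity `n`, the composition `f ∘_i g`
(`i = 1, 2, …`) is twisted by `(-1)^{(n-1)(i-1)}`. -/
def SymData.susp (T : SymData k) : SymData k where
  obj := T.obj
  one := T.one
  circ {_ n _} h i := ((-1 : k) ^ ((n + 1) * i.1)) • T.circ h i
  act σ := (((Equiv.Perm.sign σ : ℤ) : k)) • T.act σ
  act_one x := by simp [T.act_one]
  act_mul σ τ x := by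
    simp only [LinearMap.smul_apply, map_smul, T.act_mul, smul_smul, Equiv.Perm.sign_mul,
      Units.val_mul, Int.cast_mul]

namespace SymData

variable (T : SymData k)

/-- The space of invariants of the symmetric group in arity `n`. -/
def inv (n : ℕ) : Submodule k (T.obj n) where
  carrier := {x | ∀ σ : Equiv.Perm (Fin n), T.act σ x = x}
  zero_mem' _ := map_zero _
  add_mem' ha hb σ := by rw [map_add, ha σ, hb σ]
  smul_mem' c a ha σ := by rw [map_smul, ha σ]

/-- The averaging map `x ↦ (1 / n!) ∑_σ x σ`. -/
def aver (n : ℕ) : T.obj n →ₗ[k] T.inv n :=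
  LinearMap.codRestrict _ (((n.factorial : k)⁻¹) • ∑ σ : Equiv.Perm (Fin n), T.act σ) (by
    intro x τ
    simp only [LinearMap.smul_apply, LinearMap.sum_apply, map_smul, map_sum, ← T.act_mul]
    congr 1
    exact Fintype.sum_equiv (Equiv.mulRight τ) _ _ (fun _ => rfl))

/-- Auxiliary recursion for `gamma`: plug `f 0, f 1, …` successively into the inputs of `t` that
come after its first `p` inputs. -/
def gammaFrom : ∀ (r : ℕ) {m l : ℕ} (p : ℕ) (f : Fin r → Σ a, T.obj a),
    l + r = m + ∑ j, (f j).1 → p + r ≤ m → T.obj m → T.obj l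
  | 0, m, l, _, _, h, _, t => (show m = l by simpa using h.symm) ▸ t
  | r + 1, m, _, p, f, h, hp, t =>
      gammaFrom r (m := m - 1 + (f 0).1) (p + (f 0).1) (fun j => f j.succ)
        (by rw [Fin.sum_univ_succ] at h; omega) (by omega)
        (T.circ (by omega) ⟨p, by omega⟩ t (f 0).2)

/-- The full composition `γ(t; f_1, …, f_n) = (⋯((t ∘_1 f_1) ∘_{a_1+1} f_2) ⋯) ∘_{a_1+⋯+a_{n-1}+1} f_n`,
where `f_j` has arity `a_j`. -/
def gamma {n l : ℕ} (t : T.obj n) (f : Fin n → Σ a, T.obj a) (h : l = ∑ j, (f j).1) : T.obj l :=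
  T.gammaFrom n 0 f (by omega) (by omega) t

/-- `∑_i f ∘_i g`. -/
def preLie {m n l : ℕ} (h : l + 1 = m + n) : T.obj m →ₗ[k] T.obj n →ₗ[k] T.obj l :=
  ∑ i : Fin m, T.circ h i

end SymData

/-! ### The endomorphism operad and algebras -/

/-- The arguments of `f` other than the one at `i` in a composite `f ∘_i g` (and `0` at `i`). -/
def outerArgs {B : Type u} [Zero B] {m n : ℕ} (i : Fin m)
    (x : {j : Fin m // j ≠ i} ⊕ Fin n → B) : Fin m → B :=
  fun j => if hj : j = i then 0 else x (.inl ⟨j, hj⟩)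

theorem args_eq_update {B : Type u} [Zero B] {m n : ℕ} (i : Fin m)
    (x : {j : Fin m // j ≠ i} ⊕ Fin n → B) (b : B) :
    (fun j => if hj : j = i then b else x (.inl ⟨j, hj⟩)) =
      Function.update (outerArgs i x) i b := by
  funext j
  by_cases hj : j = i
  · subst hj; simp
  · simp [outerArgs, hj]

theorem outerArgs_update_inl {B : Type u} [Zero B] {m n : ℕ} (i : Fin m)
    [DecidableEq ({j : Fin m // j ≠ i} ⊕ Fin n)]
    (x : {j : Fin m // j ≠ i} ⊕ Fin n → B) (j : {j : Fin m // j ≠ i}) (v : B) :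
    outerArgs i (Function.update x (.inl j) v) = Function.update (outerArgs i x) j.1 v := by
  funext j'
  by_cases hj : j' = i
  · subst hj
    simp [outerArgs, Function.update_of_ne j.2.symm]
  · by_cases h : j' = j.1
    · subst h; simp [outerArgs, hj]
    · have : (⟨j', hj⟩ : {j : Fin m // j ≠ i}) ≠ j := fun h' => h (congrArg Subtype.val h')
      simp [outerArgs, hj, h, this]

theorem outerArgs_update_inr {B : Type u} [Zero B] {m n : ℕ} (i : Fin m)
    [DecidableEq ({j : Fin m // j ≠ i} ⊕ Fin n)]
    (x : {j : Fin m // j ≠ i} ⊕ Fin n → B) (c : Fin n) (v : B) :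
    outerArgs i (Function.update x (.inr c) v) = outerArgs i x := by
  funext j'
  by_cases hj : j' = i <;> simp [outerArgs, hj]

theorem innerArgs_update_inl {B : Type u} {m n : ℕ} (i : Fin m)
    [DecidableEq ({j : Fin m // j ≠ i} ⊕ Fin n)]
    (x : {j : Fin m // j ≠ i} ⊕ Fin n → B) (j : {j : Fin m // j ≠ i}) (v : B) :
    (fun c => Function.update x (.inl j) v (.inr c)) = fun c => x (.inr c) := by
  funext c; simp

theorem innerArgs_update_inr {B : Type u} {m n : ℕ} (i : Fin m)
    [DecidableEq ({j : Fin m // j ≠ i} ⊕ Fin n)]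
    (x : {j : Fin m // j ≠ i} ⊕ Fin n → B) (c : Fin n) (v : B) :
    (fun c' => Function.update x (.inr c) v (.inr c')) =
      Function.update (fun c' => x (.inr c')) c v := by
  funext c'
  by_cases h : c' = c
  · subst h; simp
  · simp [h]

section endomorphism

variable (A : Type u) [AddCommGroup A] [Module k A]

/-- Insertion of a multilinear map `g` into the input `i` of `f`. -/
def endCirc {m n l : ℕ} (h : l + 1 = m + n) (i : Fin m)
    (f : MultilinearMap k (fun _ : Fin m => A) A) (g : MultilinearMap k (fun _ : Fin n => A) A) :
    MultilinearMap k (fun _ : Fin l => A) A :=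
  MultilinearMap.domDomCongr (inputEquiv h i)
    { toFun := fun x => f fun j => if hj : j = i then g fun c => x (.inr c) else x (.inl ⟨j, hj⟩)
      map_update_add' := by
        intro _ x p v w
        simp only [args_eq_update]
        rcases p with j | c
        · simp only [outerArgs_update_inl, innerArgs_update_inl, Function.update_comm j.2,
            f.map_update_add]
        · simp only [outerArgs_update_inr, innerArgs_update_inr, g.map_update_add,
            f.map_update_add]
      map_update_smul' := by
        intro _ x p c v
        simp only [args_eq_update]
        rcases p with j | c
        · simp only [outerArgs_update_inl, innerArgs_update_inl, Function.update_comm j.2,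
            f.map_update_smul]
        · simp only [outerArgs_update_inr, innerArgs_update_inr, g.map_update_smul,
            f.map_update_smul] }

/-- The endomorphism operad of `A`. In `f σ` the argument `a_i` is put into the input `σ i`
of `f`. -/
def endOperad : SymData k where
  obj n := MultilinearMap k (fun _ : Fin n => A) A
  one := MultilinearMap.ofSubsingleton k A A (0 : Fin 1) LinearMap.id
  circ h i := LinearMap.mk₂ k (endCirc A h i)
    (fun _ _ _ => by ext x; simp [endCirc])
    (fun _ _ _ => by ext x; simp [endCirc])
    (fun f g₁ g₂ => by
      ext x
      simp only [endCirc, MultilinearMap.domDomCongr_apply, MultilinearMap.coe_mk,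
        add_apply, args_eq_update, f.map_update_add])
    (fun c f g => by
      ext x
      simp only [endCirc, MultilinearMap.domDomCongr_apply, MultilinearMap.coe_mk,
        smul_apply, args_eq_update, f.map_update_smul])
  act σ := (MultilinearMap.domDomCongrLinearEquiv k k A A σ.symm).toLinearMap
  act_one x := by ext; rfl
  act_mul σ τ x := by ext; rfl

/-- An algebra over (the operad with underlying data) `P` on the vector space `A`: a morphism of
operads from `P` to the endomorphism operad of `A`. -/
structure OpAlgebra (P : SymData k) where
  toFun : ∀ n : ℕ, P.obj n →ₗ[k] (endOperad (k := k) A).obj n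
  map_one : toFun 1 P.one = (endOperad A).one
  map_circ : ∀ {m n l : ℕ} (h : l + 1 = m + n) (i : Fin m) (p : P.obj m) (q : P.obj n),
    toFun l (P.circ h i p q) = (endOperad A).circ h i (toFun m p) (toFun n q)
  map_act : ∀ {n : ℕ} (σ : Equiv.Perm (Fin n)) (p : P.obj n),
    toFun n (P.act σ p) = (endOperad A).act σ (toFun n p)

end endomorphism

/-! ### The operadic cochain complex and natural operations

For a quadratic operad `P` (the symmetrization of `Γ(E)/(R)`) and a `P`-algebra `A`, the space
`C^{n-1}_P(A;A)` is the space of invariants of the arity `n` component of the operadic suspension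
of `End_A ⊗ P^!`. A cochain of arity `n` has degree `n - 1`. -/

namespace SymData

variable (T : SymData k)

/-- `[f, g] = ∑_i f ∘_i g - (-1)^{(m-1)(n-1)} ∑_i g ∘_i f` for `f`, `g` of arities `m`, `n`, when
`T` is an operadic suspension. -/
def bracket {m n l : ℕ} (h : l + 1 = m + n) (f : T.obj m) (g : T.obj n) : T.obj l :=
  T.preLie h f g - ((-1 : k) ^ ((m + 1) * (n + 1))) • T.preLie (by omega) g f

/-- The differential `[φ, -]` on invariants, where the bracket of invariants is the one of
coinvariants, transferred by the isomorphism between invariants and coinvariants. -/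
def diff (φ : T.obj 2) {n : ℕ} (x : T.inv n) : T.inv (n + 1) :=
  T.aver (n + 1) (T.bracket (by omega) φ (x : T.obj n))

/-- `n`-ary (not necessarily natural) operations on cochains: `U f l` is the arity `l` component
of `U(f_1, …, f_n)`, for homogeneous cochains `f_j`. -/
abbrev Operation (n : ℕ) : Type u := (Fin n → Σ a, T.inv a) → ∀ l : ℕ, T.inv l

/-- The arity `l` component of the differential of a cochain. -/
def diffAt (φ : T.obj 2) (x : ∀ l : ℕ, T.inv l) : ∀ l : ℕ, T.inv l
  | 0 => 0
  | l + 1 => T.diff φ (x l)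

/-- The differential induced on operations of degree `d` (the sign depends on the parity of `d`
only):
`(δ U)(f_1, …, f_n) = d U(f_1, …, f_n)
  - (-1)^d ∑_i (-1)^{|f_1| + ⋯ + |f_{i-1}|} U(f_1, …, d f_i, …, f_n)`,
where `|f_j|` is the arity of `f_j` minus one. -/
def delta (φ : T.obj 2) (d : ℕ) {n : ℕ} (U : T.Operation n) : T.Operation n := fun f l =>
  T.diffAt φ (U f) l - ((-1 : k) ^ d) • ∑ i : Fin n,
    ((-1 : k) ^ (∑ j ∈ Finset.univ.filter (· < i), ((f j).1 + 1))) •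
      U (Function.update f i ⟨(f i).1 + 1, T.diff φ (f i).2⟩) l

/-- The operation `(f_1, …, f_n) ↦ Aver (γ(t; f_1, …, f_n))`. -/
def averGamma {n : ℕ} (t : T.obj n) : T.Operation n := fun f l =>
  if h : l = ∑ j, (f j).1 then
    T.aver l (T.gamma t (fun j => ⟨(f j).1, ((f j).2 : T.obj (f j).1)⟩) h)
  else 0

end SymData

section cocycles

variable {E : Type u} [AddCommGroup E] [Module k E] (R : Submodule k (GammaThree k E))

/-- The symmetrization `P` of the non-symmetric operad `Γ(E)/(R)`. -/
abbrev quadSym : SymData k := (quadOperad R).symmetrization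

/-- The quadratic dual `P^!` of `quadSym R`, i.e. the symmetrization of the non-symmetric
quadratic dual. -/
abbrev quadDualSym : SymData k := (quadDual R).symmetrization

/-- The non-symmetric operad `Γ(E)/(R) ⊗ (Γ(E)/(R))^!`. -/
abbrev nsTensor : NSData k := (quadOperad R).tensor (quadDual R)

/-- The operadic suspension of `P ⊗ P^!`. -/
abbrev suspTensor : SymData k := ((quadSym R).tensor (quadDualSym R)).susp

/-- The inclusion of `(Γ(E)/(R) ⊗ (Γ(E)/(R))^!)(n)` into the arity `n` component of the suspension
of `P ⊗ P^!` (the degree shift being implicit). -/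
def nsIncl (n : ℕ) : (nsTensor R).obj n →ₗ[k] (suspTensor R).obj n :=
  TensorProduct.map ((quadOperad R).toSym n) ((quadDual R).toSym n)

/-- The non-symmetric canonical element: the image of `∑ e_i ⊗ e^i ∈ E ⊗ E^#`, which corresponds
to the identity of `E`. -/
def nsCanonical [FiniteDimensional k E] : (nsTensor R).obj 2 :=
  TensorProduct.map (quadGen R) (quadGen (quadPerp R)) (coevaluation k E 1)

/-- The canonical element of the suspension of `P ⊗ P^!`. As `P(2) = E ⊗ k[Σ_2]` and
`P^!(2) = P(2)^# ⊗ sgn_2`, the element which corresponds to the identity of `P(2)` is the sum of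
the two translates of the non-symmetric canonical element. -/
def canonical [FiniteDimensional k E] : (suspTensor R).obj 2 :=
  ∑ σ : Equiv.Perm (Fin 2), (suspTensor R).act σ (nsIncl R 2 (nsCanonical R))

/-- The suspension of `End_A ⊗ P^!`; `C^{n-1}_P(A;A)` is `(cochainOperad R A).inv n`. -/
abbrev cochainOperad (A : Type u) [AddCommGroup A] [Module k A] : SymData k :=
  ((endOperad A).tensor (quadDualSym R)).susp

/-- The map of suspensions induced by the structure map `P → End_A`. -/
def evalAlg {A : Type u} [AddCommGroup A] [Module k A] (α : OpAlgebra A (quadSym R)) (n : ℕ) :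
    (suspTensor R).obj n →ₗ[k] (cochainOperad R A).obj n :=
  TensorProduct.map (α.toFun n) LinearMap.id

/-- The action of an element of the suspension of `P ⊗ P^!` on the cochains of the `P`-algebra
`A`. -/
def cup {A : Type u} [AddCommGroup A] [Module k A] (α : OpAlgebra A (quadSym R)) {n : ℕ}
    (t : (suspTensor R).obj n) : (cochainOperad R A).Operation n :=
  (cochainOperad R A).averGamma (evalAlg R α n t)

/-- `Z_P(n)`: the elements `t` of the arity `n` component of the suspension of `P ⊗ P^!` (which have
degree `n - 1`) such that the natural operation given by `t` is a cocycle, that is,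
commutes with the differentials of the cochain complexes of all `P`-algebras. -/
def cocycles [FiniteDimensional k E] (n : ℕ) : Set ((suspTensor R).obj n) :=
  {t | ∀ (A : Type u) [AddCommGroup A] [Module k A] (α : OpAlgebra A (quadSym R)),
    (cochainOperad R A).delta (evalAlg R α 2 (canonical R)) (n + 1) (cup R α t) = 0}

end cocycles

end

/-!
An operation of the form `t(f_1, …, f_n) = Aver γ(t; f_1, …, f_n)` fails to commute with the
differentials only through the terms in which the canonical binary element `c` touches `t` itself.
Indeed, in `d t(f_1, …, f_n)` the terms with `c` plugged into an input of some `f_i` cancel against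
the corresponding terms of `t(…, d f_i, …)`. In every remaining term one input of `c` is left
free, and such a term is the full composition of `t ∘_i c` or of `c ∘_i t` with
`f_1, …, f_n` and one additional unit. This is `SymData.IsSuspOperad.delta_averGamma`. It is an
identity in any graded operad with the signs of an operadic suspension, so that the axioms of an
operad have to be checked for the operads at hand (`SymData.IsOperad.susp` and its companions).

For a non-symmetric `t` let `u_0, …, u_{n+1}` be the sequence
`χ ∘_2 t, t ∘_1 χ, …, t ∘_n χ, χ ∘_1 t`. The unit can be put into `n + 1` positions, and each
position occurs in exactly two terms, which belong to consecutive members of the sequence and have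
opposite signs. So the differential of the operation is the average of
`2 ∑_j ± γ(u_{j+1} - u_j; f_1, …, f_j, 1, f_{j+1}, …, f_n)` (`delta_cup_nsIncl`), which vanishes
if all the `u_j` are equal.

For the converse, take the square of the free algebra on one generator `x` (`freeSqAlgebra`), and
for every `f_i` the linear map `g(a, b) = (b, 0)`, considered as a cochain of arity one. The
arguments `(x, 0)` at position `j₀` and `(0, x)` elsewhere, together with the coefficient at the
trivial permutation, kill every summand with `j ≠ j₀`, as `g(x, 0) = 0`. In the remaining summand
all arguments become `(x, 0)`, and an operation of `Γ(E)/(R)` is determined by its value on the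
generator (`freeSqAlgebra_toSym_injective`). Hence `u_{j₀+1} = u_{j₀}`
(`canonicalComposites_eq_of_cocycle`).
-/

/-! ### Inputs of composites and partial composition of permutations -/

section permutations

/-- The position, among the inputs of `f ∘_i g`, of the input `j ≠ i` of `f`, where `g` has
arity `n`. -/
def outerIdx (i n j : ℕ) : ℕ := if j < i then j else j - 1 + n

theorem outerIdx_of_lt {i n j : ℕ} (h : j < i) : outerIdx i n j = j := if_pos h

theorem outerIdx_of_le {i n j : ℕ} (h : i ≤ j) : outerIdx i n j = j - 1 + n := if_neg (by omega)

theorem outerIdx_inj {i n j j' : ℕ} (hj : j ≠ i) (hj' : j' ≠ i)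
    (h : outerIdx i n j = outerIdx i n j') : j = j' := by
  unfold outerIdx at h
  split_ifs at h <;> omega

theorem outerIdx_lt {m n l i j : ℕ} (h : l + 1 = m + n) (hi : i < m) (hj : j < m) (hij : j ≠ i) :
    outerIdx i n j < l := by
  unfold outerIdx
  split_ifs <;> omega

theorem outerIdx_seq {i j n r nr d : ℕ} (h : nr + 1 = n + r) (hj : j < n) (hd : d ≠ i) :
    outerIdx (i + j) r (outerIdx i n d) = outerIdx i nr d := by
  rcases lt_or_gt_of_ne hd with hd | hd
  · rw [outerIdx_of_lt hd, outerIdx_of_lt hd, outerIdx_of_lt (by omega)]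
  · rw [outerIdx_of_le hd.le, outerIdx_of_le hd.le, outerIdx_of_le (by omega)]
    omega

theorem outerIdx_seq_inner (i : ℕ) {j r c : ℕ} (hc : c ≠ j) :
    outerIdx (i + j) r (i + c) = i + outerIdx j r c := by
  rcases lt_or_gt_of_ne hc with hc | hc
  · rw [outerIdx_of_lt hc, outerIdx_of_lt (by omega)]
  · rw [outerIdx_of_le hc.le, outerIdx_of_le (by omega)]
    omega

theorem outerIdx_par {i j n r d : ℕ} (hij : i ≠ j) (hdi : d ≠ i) (hdj : d ≠ j) :
    outerIdx (outerIdx i n j) r (outerIdx i n d) =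
      outerIdx (outerIdx j r i) n (outerIdx j r d) := by
  rcases lt_or_gt_of_ne hij with hij | hij <;> rcases lt_or_gt_of_ne hdi with hdi | hdi <;>
    rcases lt_or_gt_of_ne hdj with hdj | hdj <;>
    simp only [outerIdx] <;> split_ifs <;> omega

theorem outerIdx_par_inner {i j n c : ℕ} (r : ℕ) (hij : i ≠ j) (hc : c < n) :
    outerIdx (outerIdx i n j) r (i + c) = outerIdx j r i + c := by
  rcases lt_or_gt_of_ne hij with hij | hij
  · rw [outerIdx_of_le hij.le, outerIdx_of_lt hij, outerIdx_of_lt (by omega)]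
  · rw [outerIdx_of_lt hij, outerIdx_of_le hij.le, outerIdx_of_le (by omega)]
    omega

theorem permCirc_outer {m n l : ℕ} (h : l + 1 = m + n) (i : Fin m)
    (σ : Equiv.Perm (Fin m)) (τ : Equiv.Perm (Fin n)) (j : Fin m) (hj : j ≠ i) (a : Fin l)
    (ha : a.1 = outerIdx i n j) :
    (permCirc h i σ τ a).1 = outerIdx (σ i) n (σ j) := by
  have : a = inputEquiv h i (.inl ⟨j, hj⟩) := Fin.ext ha
  subst this
  simp only [permCirc, Equiv.trans_apply, Equiv.symm_apply_apply]
  rfl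

theorem permCirc_inner {m n l : ℕ} (h : l + 1 = m + n) (i : Fin m)
    (σ : Equiv.Perm (Fin m)) (τ : Equiv.Perm (Fin n)) (c : Fin n) (a : Fin l)
    (ha : a.1 = i.1 + c.1) :
    (permCirc h i σ τ a).1 = (σ i).1 + (τ c).1 := by
  have : a = inputEquiv h i (.inr c) := Fin.ext ha
  subst this
  simp only [permCirc, Equiv.trans_apply, Equiv.symm_apply_apply]
  rfl

/-- Every input of a composite is an input of the outer or of the inner operation. -/
theorem inputEquiv_cases {m n l : ℕ} (h : l + 1 = m + n) (i : Fin m) (a : Fin l) :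
    (∃ j : Fin m, j ≠ i ∧ a.1 = outerIdx i n j) ∨ ∃ c : Fin n, a.1 = i.1 + c.1 := by
  obtain ⟨s, rfl⟩ := (inputEquiv h i).surjective a
  rcases s with ⟨j, hj⟩ | c
  · exact Or.inl ⟨j, hj, rfl⟩
  · exact Or.inr ⟨c, rfl⟩

theorem Fin.val_ne {n : ℕ} {i j : Fin n} (h : i ≠ j) : i.1 ≠ j.1 := fun h' => h (Fin.ext h')

theorem permCirc_seq {m n r mn nr l : ℕ} (h1 : mn + 1 = m + n) (h2 : l + 1 = mn + r)
    (h3 : nr + 1 = n + r) (h4 : l + 1 = m + nr) (i : Fin m) (j : Fin n) (q : Fin mn)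
    (hq : q.1 = i.1 + j.1) (σ : Equiv.Perm (Fin m)) (τ : Equiv.Perm (Fin n))
    (ρ : Equiv.Perm (Fin r)) :
    permCirc h2 q (permCirc h1 i σ τ) ρ = permCirc h4 i σ (permCirc h3 j τ ρ) := by
  have hσq := permCirc_inner h1 i σ τ j q hq
  ext a
  rcases inputEquiv_cases h2 q a with ⟨b, hb, hab⟩ | ⟨c, hac⟩
  · rw [permCirc_outer h2 q _ ρ b hb a hab, hσq]
    rcases inputEquiv_cases h1 i b with ⟨d, hd, hbd⟩ | ⟨c, hbc⟩
    · rw [permCirc_outer h1 i σ τ d hd b hbd, permCirc_outer h4 i σ _ d hd a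
          (by rw [hab, hq, hbd, outerIdx_seq h3 j.2 (Fin.val_ne hd)]),
        outerIdx_seq h3 (τ j).2 (Fin.val_ne (σ.injective.ne hd))]
    · have hcj : c ≠ j := fun h => hb (Fin.ext (by rw [hbc, hq, h]))
      have hlt := outerIdx_lt h3 j.2 c.2 (Fin.val_ne hcj)
      rw [permCirc_inner h1 i σ τ c b hbc,
        permCirc_inner h4 i σ _ ⟨_, hlt⟩ a
          (by rw [hab, hq, hbc, outerIdx_seq_inner _ (Fin.val_ne hcj)]),
        permCirc_outer h3 j τ ρ c hcj ⟨_, hlt⟩ rfl,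
        outerIdx_seq_inner _ (Fin.val_ne (τ.injective.ne hcj))]
  · have hlt : j.1 + c.1 < nr := by have := c.2; have := j.2; omega
    rw [permCirc_inner h2 q _ ρ c a hac, hσq,
      permCirc_inner h4 i σ _ ⟨_, hlt⟩ a (by simp only; omega),
      permCirc_inner h3 j τ ρ c ⟨_, hlt⟩ rfl]
    omega

theorem permCirc_par {m n r mn mr l : ℕ} (h1 : mn + 1 = m + n) (h2 : l + 1 = mn + r)
    (h3 : mr + 1 = m + r) (h4 : l + 1 = mr + n) (i j : Fin m) (hij : i ≠ j) (q : Fin mn)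
    (q' : Fin mr) (hq : q.1 = outerIdx i n j) (hq' : q'.1 = outerIdx j r i)
    (σ : Equiv.Perm (Fin m)) (τ : Equiv.Perm (Fin n)) (ρ : Equiv.Perm (Fin r)) :
    permCirc h2 q (permCirc h1 i σ τ) ρ = permCirc h4 q' (permCirc h3 j σ ρ) τ := by
  have hσq := permCirc_outer h1 i σ τ j hij.symm q hq
  have hσq' := permCirc_outer h3 j σ ρ i hij q' hq'
  have hij' := Fin.val_ne hij
  have hσij := Fin.val_ne (σ.injective.ne hij)
  ext a
  rcases inputEquiv_cases h2 q a with ⟨b, hb, hab⟩ | ⟨c, hac⟩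
  · rw [permCirc_outer h2 q _ ρ b hb a hab, hσq]
    rcases inputEquiv_cases h1 i b with ⟨d, hd, hbd⟩ | ⟨c, hbc⟩
    · have hdj : d ≠ j := by
        rintro rfl
        exact hb (Fin.ext (by rw [hbd, hq]))
      have hlt := outerIdx_lt h3 j.2 d.2 (Fin.val_ne hdj)
      have hne : (⟨_, hlt⟩ : Fin mr) ≠ q' := fun h => hd (Fin.ext
        (outerIdx_inj (Fin.val_ne hdj) hij' (by rw [← hq', ← h])))
      rw [permCirc_outer h1 i σ τ d hd b hbd, permCirc_outer h4 q' _ τ ⟨_, hlt⟩ hne a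
          (by rw [hab, hq, hbd, hq', outerIdx_par hij' (Fin.val_ne hd) (Fin.val_ne hdj)]),
        permCirc_outer h3 j σ ρ d hdj ⟨_, hlt⟩ rfl, hσq',
        outerIdx_par hσij (Fin.val_ne (σ.injective.ne hd)) (Fin.val_ne (σ.injective.ne hdj))]
    · rw [permCirc_inner h1 i σ τ c b hbc, permCirc_inner h4 q' _ τ c a
          (by rw [hab, hq, hbc, hq', outerIdx_par_inner r hij' c.2]), hσq',
        outerIdx_par_inner r hσij (τ c).2]
  · have hlt : j.1 + c.1 < mr := by have := c.2; have := j.2; omega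
    have hne : (⟨_, hlt⟩ : Fin mr) ≠ q' := fun h => by
      have h' := congrArg Fin.val h
      have := c.2
      simp only [hq', outerIdx] at h'
      split_ifs at h' <;> omega
    rw [permCirc_inner h2 q _ ρ c a hac, hσq, permCirc_outer h4 q' _ τ ⟨_, hlt⟩ hne a
        (by rw [hac, hq, hq', outerIdx_par_inner n hij'.symm c.2]),
      permCirc_inner h3 j σ ρ c ⟨_, hlt⟩ rfl, hσq', outerIdx_par_inner n hσij.symm (ρ c).2]

theorem permCirc_one_one {m n l : ℕ} (h : l + 1 = m + n) (i : Fin m) :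
    permCirc h i 1 1 = 1 := by
  ext a
  rcases inputEquiv_cases h i a with ⟨j, hj, ha⟩ | ⟨c, ha⟩
  · rw [permCirc_outer h i 1 1 j hj a ha]; simp [ha]
  · rw [permCirc_inner h i 1 1 c a ha]; simp [ha]

theorem permCirc_one_right {m : ℕ} (h : m + 1 = m + 1) (i : Fin m)
    (σ : Equiv.Perm (Fin m)) : permCirc h i σ (1 : Equiv.Perm (Fin 1)) = σ := by
  ext a
  rcases inputEquiv_cases h i a with ⟨j, hj, ha⟩ | ⟨c, ha⟩
  · rw [permCirc_outer h i σ 1 j hj a ha]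
    have h1 := Fin.val_ne hj
    have h2 := Fin.val_ne (σ.injective.ne hj)
    have h3 : a = j := Fin.ext (by unfold outerIdx at ha; split_ifs at ha <;> omega)
    subst h3
    unfold outerIdx
    split_ifs <;> omega
  · rw [permCirc_inner h i σ 1 c a ha]
    have h3 : a = i := Fin.ext (by omega)
    subst h3
    simp

theorem permCirc_mul {m n l : ℕ} (h : l + 1 = m + n) (i : Fin m)
    (σ σ' : Equiv.Perm (Fin m)) (τ τ' : Equiv.Perm (Fin n)) :
    permCirc h i (σ * σ') (τ * τ') = permCirc h (σ' i) σ τ * permCirc h i σ' τ' := by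
  ext a
  rw [Equiv.Perm.mul_apply]
  rcases inputEquiv_cases h i a with ⟨j, hj, ha⟩ | ⟨c, ha⟩
  · rw [permCirc_outer h i _ _ j hj a ha,
      permCirc_outer h (σ' i) _ _ (σ' j) (fun h => hj (σ'.injective h)) _
        (permCirc_outer h i _ _ j hj a ha)]
    rfl
  · rw [permCirc_inner h i _ _ c a ha,
      permCirc_inner h (σ' i) _ _ (τ' c) _ (permCirc_inner h i _ _ c a ha)]
    rfl

theorem sign_permCirc_of_fixed {m n l : ℕ} (h : l + 1 = m + n) (i : Fin m)
    (σ : Equiv.Perm (Fin m)) (τ : Equiv.Perm (Fin n)) (hi : σ i = i) :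
    (permCirc h i σ τ).sign = σ.sign * τ.sign := by
  have hσ : ∀ x, σ x ≠ i ↔ x ≠ i := fun x => by
    conv_lhs => rw [← hi]
    exact σ.injective.ne_iff
  have key : permCirc h i σ τ = ((inputEquiv h i).symm.trans
      (Equiv.sumCongr (σ.subtypePerm (p := fun j => j ≠ i) hσ) τ)).trans (inputEquiv h i) := by
    ext a
    rcases inputEquiv_cases h i a with ⟨j, hj, ha⟩ | ⟨c, ha⟩
    · rw [permCirc_outer h i σ τ j hj a ha]
      have : a = inputEquiv h i (.inl ⟨j, hj⟩) := Fin.ext ha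
      subst this
      simp only [Equiv.trans_apply, Equiv.symm_apply_apply]
      exact congrArg (fun z : Fin m => outerIdx z n (σ j)) hi
    · rw [permCirc_inner h i σ τ c a ha]
      have : a = inputEquiv h i (.inr c) := Fin.ext ha
      subst this
      simp only [Equiv.trans_apply, Equiv.symm_apply_apply]
      exact congrArg (fun z : Fin m => z.1 + (τ c).1) hi
  rw [key, Equiv.Perm.sign_symm_trans_trans]
  refine (Equiv.Perm.sign_sumCongr _ _).trans ?_
  rw [Equiv.Perm.sign_subtypePerm]
  intro x hx
  rintro rfl
  exact hx hi

/-- Interchanging a block of `n` inputs with the input on its right is a cycle of length `n + 1`,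
written here as a quotient of two cycles which fix the inputs on the right. -/
theorem sign_permCirc_swap {m n l : ℕ} (h : l + 1 = m + n) (i j : Fin m) (hij : j.1 = i.1 + 1) :
    (permCirc h i (Equiv.swap i j) (1 : Equiv.Perm (Fin n))).sign = (-1) ^ n := by
  have hj := j.2
  obtain ⟨l, rfl⟩ : ∃ l', l = l' + 1 := ⟨l - 1, by omega⟩
  have key : permCirc h i (Equiv.swap i j) (1 : Equiv.Perm (Fin n)) =
      (Fin.cycleRange (⟨i.1, by omega⟩ : Fin (l + 1)))⁻¹ *
        Fin.cycleRange (⟨i.1 + n, by omega⟩ : Fin (l + 1)) := by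
    rw [eq_inv_mul_iff_mul_eq]
    ext a
    rw [Equiv.Perm.mul_apply]
    have hcyc : ∀ x y : Fin (l + 1), (Fin.cycleRange x y).1 =
        if y.1 < x.1 then y.1 + 1 else if y.1 = x.1 then 0 else y.1 := fun x y => by
      rcases lt_trichotomy y x with hxy | hxy | hxy
      · rw [Fin.coe_cycleRange_of_lt hxy, if_pos (Fin.lt_def.1 hxy)]
      · rw [hxy, Fin.cycleRange_self]; simp
      · rw [Fin.cycleRange_of_gt hxy, if_neg (not_lt.2 (Fin.le_def.1 hxy.le)),
          if_neg (Fin.val_ne hxy.ne')]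
    rw [hcyc, hcyc]
    simp only
    rcases inputEquiv_cases h i a with ⟨b, hb, ha⟩ | ⟨c, ha⟩
    · rw [permCirc_outer h i _ _ b hb a ha, Equiv.swap_apply_left]
      have hb' := Fin.val_ne hb
      by_cases hbj : b = j
      · subst hbj
        rw [Equiv.swap_apply_right, outerIdx_of_lt (by omega)]
        rw [outerIdx_of_le (by omega)] at ha
        split_ifs <;> omega
      · have hbj' := Fin.val_ne hbj
        rw [Equiv.swap_apply_of_ne_of_ne hb hbj]
        unfold outerIdx at ha ⊢
        split_ifs at ha ⊢ <;> omega
    · rw [permCirc_inner h i _ _ c a ha, Equiv.swap_apply_left]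
      have := c.2
      rw [Equiv.Perm.one_apply, ha, if_pos (by omega : i.1 + c.1 < i.1 + n)]
      split_ifs <;> omega
  rw [key, Equiv.Perm.sign_mul, Equiv.Perm.sign_inv, Fin.sign_cycleRange, Fin.sign_cycleRange,
    ← pow_add]
  rw [show i.1 + (i.1 + n) = 2 * i.1 + n by ring, pow_add, pow_mul]
  simp

theorem sign_permCirc_of_le {m n l : ℕ} (h : l + 1 = m + n) (i : Fin m) (d : ℕ) :
    ∀ (σ : Equiv.Perm (Fin m)) (τ : Equiv.Perm (Fin n)), (σ i).1 = i.1 + d →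
      (permCirc h i σ τ).sign = σ.sign * τ.sign * (-1) ^ ((n + 1) * d) := by
  induction d with
  | zero => intro σ τ hd; rw [sign_permCirc_of_fixed h i σ τ (Fin.ext hd)]; simp
  | succ d ih =>
    intro σ τ hd
    have hlt := (σ i).2
    let p : Fin m := ⟨i.1 + d, by omega⟩
    have hp : p ≠ σ i := fun h => by
      have := congrArg Fin.val h
      simp only [p] at this
      omega
    have h1 : (Equiv.swap p (σ i) * σ) i = p := by simp
    have h2 := permCirc_mul h i (Equiv.swap p (σ i)) (Equiv.swap p (σ i) * σ) 1 τ
    rw [← mul_assoc, Equiv.swap_mul_self, one_mul, one_mul, h1] at h2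
    rw [h2, Equiv.Perm.sign_mul, ih _ τ (by rw [h1]),
      sign_permCirc_swap h p (σ i) (by simp only [p]; omega), Equiv.Perm.sign_mul,
      Equiv.Perm.sign_swap hp]
    rw [show (n + 1) * (d + 1) = (n + 1) * d + n + 1 by ring, pow_add, pow_add, pow_one]
    simp only [neg_mul, mul_neg, one_mul, mul_one]
    congr 1
    ac_rfl

/-- The sign of a partial composite of permutations. Replacing the input `i` by a block of size `n`
repeats `n` times each inversion which involves `i`, and the number of these inversions has the
parity of `i + σ i`. -/
theorem sign_permCirc {m n l : ℕ} (h : l + 1 = m + n) (i : Fin m) (σ : Equiv.Perm (Fin m))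
    (τ : Equiv.Perm (Fin n)) :
    (permCirc h i σ τ).sign = σ.sign * τ.sign * (-1) ^ ((n + 1) * (i.1 + (σ i).1)) := by
  rcases le_total i.1 (σ i).1 with hle | hle
  · obtain ⟨d, hd⟩ := Nat.exists_eq_add_of_le hle
    rw [sign_permCirc_of_le h i d σ τ hd, hd,
      show (n + 1) * (i.1 + (i.1 + d)) = 2 * ((n + 1) * i.1) + (n + 1) * d by ring, pow_add,
      pow_mul]
    simp
  · obtain ⟨d, hd⟩ := Nat.exists_eq_add_of_le hle
    have h1 := permCirc_mul h i σ⁻¹ σ τ⁻¹ τ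
    rw [inv_mul_cancel, inv_mul_cancel, permCirc_one_one] at h1
    have h2 := eq_inv_of_mul_eq_one_right h1.symm
    rw [h2, Equiv.Perm.sign_inv, sign_permCirc_of_le h (σ i) d σ⁻¹ τ⁻¹ (by simpa using hd), hd,
      show (n + 1) * ((σ i).1 + d + (σ i).1) = 2 * ((n + 1) * (σ i).1) + (n + 1) * d by ring,
      pow_add, pow_mul]
    simp

end permutations

/-! ### Operad axioms -/

section axioms

variable {k : Type u} [Field k]

/-- The axioms of a non-symmetric operad which involve a right unit, sequential and parallel
composition. The index of the second composition is a parameter characterized by its value. -/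
structure NSData.IsOperad (P : NSData k) : Prop where
  circ_one {m : ℕ} (i : Fin m) (x : P.obj m) : P.circ (l := m) rfl i x P.one = x
  circ_seq {m n r mn nr l : ℕ} (h1 : mn + 1 = m + n) (h2 : l + 1 = mn + r)
    (h3 : nr + 1 = n + r) (h4 : l + 1 = m + nr) (i : Fin m) (j : Fin n) (q : Fin mn)
    (hq : q.1 = i.1 + j.1) (x : P.obj m) (y : P.obj n) (z : P.obj r) :
    P.circ h2 q (P.circ h1 i x y) z = P.circ h4 i x (P.circ h3 j y z)
  circ_par {m n r mn mr l : ℕ} (h1 : mn + 1 = m + n) (h2 : l + 1 = mn + r)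
    (h3 : mr + 1 = m + r) (h4 : l + 1 = mr + n) (i j : Fin m) (hij : i ≠ j) (q : Fin mn)
    (q' : Fin mr) (hq : q.1 = outerIdx i n j) (hq' : q'.1 = outerIdx j r i)
    (x : P.obj m) (y : P.obj n) (z : P.obj r) :
    P.circ h2 q (P.circ h1 i x y) z = P.circ h4 q' (P.circ h3 j x z) y

/-- The axioms of a symmetric operad, except for the left unit. -/
structure SymData.IsOperad (T : SymData k) : Prop extends T.toNSData.IsOperad where
  circ_act {m n l : ℕ} (h : l + 1 = m + n) (i : Fin m) (σ : Equiv.Perm (Fin m))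
    (τ : Equiv.Perm (Fin n)) (x : T.obj m) (y : T.obj n) :
    T.circ h i (T.act σ x) (T.act τ y) = T.act (permCirc h i σ τ) (T.circ h (σ i) x y)

/-- The axioms of a graded symmetric operad whose component of arity `n` is concentrated in a degree
of the parity of `n + 1`, as is the case for operadic suspensions. -/
structure SymData.IsSuspOperad (T : SymData k) : Prop where
  circ_one {m : ℕ} (i : Fin m) (x : T.obj m) : T.circ (l := m) rfl i x T.one = x
  circ_seq {m n r mn nr l : ℕ} (h1 : mn + 1 = m + n) (h2 : l + 1 = mn + r)
    (h3 : nr + 1 = n + r) (h4 : l + 1 = m + nr) (i : Fin m) (j : Fin n) (q : Fin mn)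
    (hq : q.1 = i.1 + j.1) (x : T.obj m) (y : T.obj n) (z : T.obj r) :
    T.circ h2 q (T.circ h1 i x y) z = T.circ h4 i x (T.circ h3 j y z)
  circ_par {m n r mn mr l : ℕ} (h1 : mn + 1 = m + n) (h2 : l + 1 = mn + r)
    (h3 : mr + 1 = m + r) (h4 : l + 1 = mr + n) (i j : Fin m) (hij : i ≠ j) (q : Fin mn)
    (q' : Fin mr) (hq : q.1 = outerIdx i n j) (hq' : q'.1 = outerIdx j r i)
    (x : T.obj m) (y : T.obj n) (z : T.obj r) :
    T.circ h2 q (T.circ h1 i x y) z =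
      ((-1 : k) ^ ((n + 1) * (r + 1))) • T.circ h4 q' (T.circ h3 j x z) y
  circ_act {m n l : ℕ} (h : l + 1 = m + n) (i : Fin m) (σ : Equiv.Perm (Fin m))
    (τ : Equiv.Perm (Fin n)) (x : T.obj m) (y : T.obj n) :
    T.circ h i (T.act σ x) (T.act τ y) = T.act (permCirc h i σ τ) (T.circ h (σ i) x y)

theorem neg_one_pow_eq_of_zmod {a b : ℕ} (h : (a : ZMod 2) = b) : (-1 : k) ^ a = (-1) ^ b := by
  rw [neg_one_pow_eq_pow_mod_two, (ZMod.natCast_eq_natCast_iff' a b 2).1 h,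
    ← neg_one_pow_eq_pow_mod_two]

theorem zmod_two_cast {a b : ℕ} (h : a + 1 = b) : (a : ZMod 2) = b + 1 := by
  have : ((a + 1 : ℕ) : ZMod 2) = b := congrArg _ h
  push_cast at this
  rw [← this, add_assoc, CharTwo.add_self_eq_zero, add_zero]

theorem zmod_two_outerIdx {i n j : ℕ} (h : j ≠ i) :
    (outerIdx i n j : ZMod 2) = (j : ZMod 2) + if j < i then 0 else 1 + (n : ZMod 2) := by
  unfold outerIdx
  split_ifs with hji
  · simp
  · rw [Nat.cast_add, zmod_two_cast (show j - 1 + 1 = j by omega), add_assoc]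

theorem SymData.susp_circ (T : SymData k) {m n l : ℕ} (h : l + 1 = m + n) (i : Fin m)
    (x : T.obj m) (y : T.obj n) :
    T.susp.circ h i x y = ((-1 : k) ^ ((n + 1) * i.1)) • T.circ h i x y := rfl

theorem SymData.susp_act (T : SymData k) {n : ℕ} (σ : Equiv.Perm (Fin n)) (x : T.obj n) :
    T.susp.act σ x = ((σ.sign : ℤ) : k) • T.act σ x := rfl

theorem SymData.IsOperad.susp_circ_one {T : SymData k} (hT : T.IsOperad) {m : ℕ} (i : Fin m)
    (x : T.obj m) :
    ((-1 : k) ^ ((1 + 1) * i.1)) • T.circ (l := m) rfl i x T.one = x := by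
  rw [hT.circ_one]
  simp [pow_mul]

theorem SymData.IsOperad.susp_circ_seq {T : SymData k} (hT : T.IsOperad)
    {m n r mn nr l : ℕ} (h1 : mn + 1 = m + n) (h2 : l + 1 = mn + r)
    (h3 : nr + 1 = n + r) (h4 : l + 1 = m + nr) (i : Fin m) (j : Fin n) (q : Fin mn)
    (hq : q.1 = i.1 + j.1) (x : T.obj m) (y : T.obj n) (z : T.obj r) :
    ((-1 : k) ^ ((r + 1) * q.1)) • T.circ h2 q (((-1 : k) ^ ((n + 1) * i.1)) • T.circ h1 i x y) z =
      ((-1 : k) ^ ((nr + 1) * i.1)) •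
        T.circ h4 i x (((-1 : k) ^ ((r + 1) * j.1)) • T.circ h3 j y z) := by
  simp only [map_smul, LinearMap.smul_apply, smul_smul, ← pow_add]
  rw [hT.circ_seq h1 h2 h3 h4 i j q hq]
  congr 1
  refine neg_one_pow_eq_of_zmod ?_
  push_cast
  rw [hq, zmod_two_cast h3]
  push_cast
  ring

theorem SymData.IsOperad.susp_circ_par {T : SymData k} (hT : T.IsOperad)
    {m n r mn mr l : ℕ} (h1 : mn + 1 = m + n) (h2 : l + 1 = mn + r)
    (h3 : mr + 1 = m + r) (h4 : l + 1 = mr + n) (i j : Fin m) (hij : i ≠ j) (q : Fin mn)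
    (q' : Fin mr) (hq : q.1 = outerIdx i n j) (hq' : q'.1 = outerIdx j r i)
    (x : T.obj m) (y : T.obj n) (z : T.obj r) :
    ((-1 : k) ^ ((r + 1) * q.1)) • T.circ h2 q (((-1 : k) ^ ((n + 1) * i.1)) • T.circ h1 i x y) z =
      ((-1 : k) ^ ((n + 1) * (r + 1))) • ((-1 : k) ^ ((n + 1) * q'.1)) •
        T.circ h4 q' (((-1 : k) ^ ((r + 1) * j.1)) • T.circ h3 j x z) y := by
  simp only [map_smul, LinearMap.smul_apply, smul_smul, ← pow_add]
  rw [hT.circ_par h1 h2 h3 h4 i j hij q q' hq hq']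
  congr 1
  refine neg_one_pow_eq_of_zmod ?_
  push_cast
  rw [hq, hq', zmod_two_outerIdx (Fin.val_ne hij), zmod_two_outerIdx (Fin.val_ne hij.symm)]
  have h2 := CharTwo.two_eq_zero (R := ZMod 2)
  rcases lt_or_gt_of_ne (Fin.val_ne hij) with h | h
  · rw [if_pos h, if_neg h.not_gt]
    ring
  · rw [if_pos h, if_neg h.not_gt]
    linear_combination (-((n + 1) * (r + 1)) : ZMod 2) * h2

theorem SymData.IsOperad.susp_circ_act {T : SymData k} (hT : T.IsOperad)
    {m n l : ℕ} (h : l + 1 = m + n) (i : Fin m) (σ : Equiv.Perm (Fin m))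
    (τ : Equiv.Perm (Fin n)) (x : T.obj m) (y : T.obj n) :
    ((-1 : k) ^ ((n + 1) * i.1)) •
        T.circ h i (((σ.sign : ℤ) : k) • T.act σ x) (((τ.sign : ℤ) : k) • T.act τ y) =
      (((permCirc h i σ τ).sign : ℤ) : k) • T.act (permCirc h i σ τ)
        (((-1 : k) ^ ((n + 1) * (σ i).1)) • T.circ h (σ i) x y) := by
  simp only [map_smul, LinearMap.smul_apply, smul_smul]
  rw [hT.circ_act, sign_permCirc]
  congr 1
  push_cast
  have hsign : (-1 : k) ^ ((n + 1) * i.1) =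
      (-1 : k) ^ ((n + 1) * (i.1 + (σ i).1)) * (-1) ^ ((n + 1) * (σ i).1) := by
    rw [← pow_add]
    refine neg_one_pow_eq_of_zmod ?_
    push_cast
    have h2 := CharTwo.two_eq_zero (R := ZMod 2)
    linear_combination (-((n + 1) * (σ i).1) : ZMod 2) * h2
  rw [hsign]
  ring

theorem SymData.IsOperad.susp {T : SymData k} (hT : T.IsOperad) : T.susp.IsSuspOperad where
  circ_one := hT.susp_circ_one
  circ_seq := hT.susp_circ_seq
  circ_par := hT.susp_circ_par
  circ_act := hT.susp_circ_act

section span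

variable {M N S MN NS MS L : Type*} [AddCommGroup M] [Module k M] [AddCommGroup N] [Module k N]
  [AddCommGroup S] [Module k S] [AddCommGroup MN] [Module k MN] [AddCommGroup NS] [Module k NS]
  [AddCommGroup MS] [Module k MS] [AddCommGroup L] [Module k L]

theorem bilinear_seq_of_span {b₁ : M →ₗ[k] N →ₗ[k] MN} {b₂ : MN →ₗ[k] S →ₗ[k] L}
    {b₃ : N →ₗ[k] S →ₗ[k] NS} {b₄ : M →ₗ[k] NS →ₗ[k] L} {s : Set M} {t : Set N} {v : Set S}
    (hs : Submodule.span k s = ⊤) (ht : Submodule.span k t = ⊤) (hv : Submodule.span k v = ⊤)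
    (h : ∀ x ∈ s, ∀ y ∈ t, ∀ z ∈ v, b₂ (b₁ x y) z = b₄ x (b₃ y z)) (x : M) (y : N) (z : S) :
    b₂ (b₁ x y) z = b₄ x (b₃ y z) := by
  have hx : x ∈ Submodule.span k s := hs ▸ trivial
  have hy : y ∈ Submodule.span k t := ht ▸ trivial
  have hz : z ∈ Submodule.span k v := hv ▸ trivial
  induction hx using Submodule.span_induction with
  | zero => simp
  | add a b _ _ ha hb => simp only [map_add, LinearMap.add_apply, ha, hb]
  | smul c a _ ha => simp only [map_smul, LinearMap.smul_apply, ha]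
  | mem x hx =>
    induction hy using Submodule.span_induction with
    | zero => simp
    | add a b _ _ ha hb => simp only [map_add, LinearMap.add_apply, ha, hb]
    | smul c a _ ha => simp only [map_smul, LinearMap.smul_apply, ha]
    | mem y hy =>
      induction hz using Submodule.span_induction with
      | zero => simp
      | add a b _ _ ha hb => simp only [map_add, ha, hb]
      | smul c a _ ha => simp only [map_smul, ha]
      | mem z hz => exact h x hx y hy z hz

theorem bilinear_par_of_span {b₁ : M →ₗ[k] N →ₗ[k] MN} {b₂ : MN →ₗ[k] S →ₗ[k] L}
    {b₃ : M →ₗ[k] S →ₗ[k] MS} {b₄ : MS →ₗ[k] N →ₗ[k] L} {s : Set M} {t : Set N} {v : Set S}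
    (hs : Submodule.span k s = ⊤) (ht : Submodule.span k t = ⊤) (hv : Submodule.span k v = ⊤)
    (h : ∀ x ∈ s, ∀ y ∈ t, ∀ z ∈ v, b₂ (b₁ x y) z = b₄ (b₃ x z) y) (x : M) (y : N) (z : S) :
    b₂ (b₁ x y) z = b₄ (b₃ x z) y := by
  have hx : x ∈ Submodule.span k s := hs ▸ trivial
  have hy : y ∈ Submodule.span k t := ht ▸ trivial
  have hz : z ∈ Submodule.span k v := hv ▸ trivial
  induction hx using Submodule.span_induction with
  | zero => simp
  | add a b _ _ ha hb => simp only [map_add, LinearMap.add_apply, ha, hb]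
  | smul c a _ ha => simp only [map_smul, LinearMap.smul_apply, ha]
  | mem x hx =>
    induction hy using Submodule.span_induction with
    | zero => simp
    | add a b _ _ ha hb => simp only [map_add, LinearMap.add_apply, ha, hb]
    | smul c a _ ha => simp only [map_smul, LinearMap.smul_apply, ha]
    | mem y hy =>
      induction hz using Submodule.span_induction with
      | zero => simp
      | add a b _ _ ha hb => simp only [map_add, LinearMap.add_apply, ha, hb]
      | smul c a _ ha => simp only [map_smul, LinearMap.smul_apply, ha]
      | mem z hz => exact h x hx y hy z hz

theorem bilinear_map_of_span {M' N' L' : Type*} [AddCommGroup M'] [Module k M'] [AddCommGroup N']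
    [Module k N'] [AddCommGroup L'] [Module k L'] {b₁ : M →ₗ[k] N →ₗ[k] L}
    {b₂ : M' →ₗ[k] N' →ₗ[k] L'} {f : M →ₗ[k] M'} {g : N →ₗ[k] N'} {e : L →ₗ[k] L'}
    {s : Set M} {t : Set N} (hs : Submodule.span k s = ⊤) (ht : Submodule.span k t = ⊤)
    (h : ∀ x ∈ s, ∀ y ∈ t, e (b₁ x y) = b₂ (f x) (g y)) (x : M) (y : N) :
    e (b₁ x y) = b₂ (f x) (g y) := by
  have hx : x ∈ Submodule.span k s := hs ▸ trivial
  have hy : y ∈ Submodule.span k t := ht ▸ trivial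
  induction hx using Submodule.span_induction with
  | zero => simp
  | add a b _ _ ha hb => simp only [map_add, LinearMap.add_apply, ha, hb]
  | smul c a _ ha => simp only [map_smul, LinearMap.smul_apply, ha]
  | mem x hx =>
    induction hy using Submodule.span_induction with
    | zero => simp
    | add a b _ _ ha hb => simp only [map_add, ha, hb]
    | smul c a _ ha => simp only [map_smul, ha]
    | mem y hy => exact h x hx y hy

theorem linear_eq_of_span {f g : M →ₗ[k] N} {s : Set M}
    (hs : Submodule.span k s = ⊤) (h : ∀ x ∈ s, f x = g x) (x : M) : f x = g x :=
  LinearMap.congr_fun (LinearMap.ext_on hs h) x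

theorem span_range_single (ι : Type*) :
    Submodule.span k {x : ι →₀ M | ∃ i a, x = Finsupp.single i a} = ⊤ := by
  refine top_unique fun x _ => ?_
  induction x using Finsupp.induction_linear with
  | zero => exact zero_mem _
  | add a b ha hb => exact add_mem (ha trivial) (hb trivial)
  | single i a => exact Submodule.subset_span ⟨i, a, rfl⟩

theorem lsum_flip_lsum_single {ι κ υ : Type*} (b : ι → M →ₗ[k] N →ₗ[k] L) (w : ι → κ → υ)
    (i : ι) (j : κ) (x : M) (y : N) :
    (Finsupp.lsum k fun σ : ι => LinearMap.flip <| Finsupp.lsum k fun τ : κ =>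
        ((b σ).compr₂ (Finsupp.lsingle (w σ τ))).flip) (Finsupp.single i x) (Finsupp.single j y) =
      Finsupp.single (w i j) (b i x y) := by
  simp

end span

theorem NSData.IsOperad.tensor {P Q : NSData k} (hP : P.IsOperad) (hQ : Q.IsOperad) :
    (P.tensor Q).IsOperad where
  circ_one {m} i := linear_eq_of_span (f := (TensorProduct.map₂ (P.circ rfl i)
      (Q.circ rfl i)).flip (P.one ⊗ₜ Q.one)) (g := LinearMap.id)
      (TensorProduct.span_tmul_eq_top k (P.obj m) (Q.obj m)) (by
    rintro _ ⟨a, b, rfl⟩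
    simp [hP.circ_one, hQ.circ_one])
  circ_seq {m n r mn nr l} h1 h2 h3 h4 i j q hq := by
    refine bilinear_seq_of_span (TensorProduct.span_tmul_eq_top k (P.obj m) (Q.obj m))
      (TensorProduct.span_tmul_eq_top k (P.obj n) (Q.obj n))
      (TensorProduct.span_tmul_eq_top k (P.obj r) (Q.obj r)) ?_
    rintro _ ⟨a, b, rfl⟩ _ ⟨a', b', rfl⟩ _ ⟨a'', b'', rfl⟩
    exact congrArg₂ (· ⊗ₜ[k] ·) (hP.circ_seq h1 h2 h3 h4 i j q hq a a' a'')
      (hQ.circ_seq h1 h2 h3 h4 i j q hq b b' b'')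
  circ_par {m n r mn mr l} h1 h2 h3 h4 i j hij q q' hq hq' := by
    refine bilinear_par_of_span (TensorProduct.span_tmul_eq_top k (P.obj m) (Q.obj m))
      (TensorProduct.span_tmul_eq_top k (P.obj n) (Q.obj n))
      (TensorProduct.span_tmul_eq_top k (P.obj r) (Q.obj r)) ?_
    rintro _ ⟨a, b, rfl⟩ _ ⟨a', b', rfl⟩ _ ⟨a'', b'', rfl⟩
    exact congrArg₂ (· ⊗ₜ[k] ·) (hP.circ_par h1 h2 h3 h4 i j hij q q' hq hq' a a' a'')
      (hQ.circ_par h1 h2 h3 h4 i j hij q q' hq hq' b b' b'')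

theorem SymData.IsOperad.tensor {P Q : SymData k} (hP : P.IsOperad) (hQ : Q.IsOperad) :
    (P.tensor Q).IsOperad where
  toIsOperad := hP.toIsOperad.tensor hQ.toIsOperad
  circ_act {m n l} h i σ τ := by
    refine fun x y => (bilinear_map_of_span (TensorProduct.span_tmul_eq_top k (P.obj m) (Q.obj m))
      (TensorProduct.span_tmul_eq_top k (P.obj n) (Q.obj n)) ?_ x y).symm
    rintro _ ⟨a, b, rfl⟩ _ ⟨a', b', rfl⟩
    exact congrArg₂ (· ⊗ₜ[k] ·) (hP.circ_act h i σ τ a a').symm (hQ.circ_act h i σ τ b b').symm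

theorem NSData.symmetrization_circ_single (P : NSData k) {m n l : ℕ} (h : l + 1 = m + n)
    (i : Fin m) (σ : Equiv.Perm (Fin m)) (τ : Equiv.Perm (Fin n)) (x : P.obj m) (y : P.obj n) :
    P.symmetrization.circ h i (Finsupp.single σ x) (Finsupp.single τ y) =
      Finsupp.single (permCirc h i σ τ) (P.circ h (σ i) x y) :=
  lsum_flip_lsum_single (fun σ : Equiv.Perm (Fin m) => P.circ h (σ i))
    (fun σ τ => permCirc h i σ τ) σ τ x y

theorem NSData.symmetrization_act_single (P : NSData k) {n : ℕ} (τ σ : Equiv.Perm (Fin n))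
    (x : P.obj n) :
    P.symmetrization.act τ (Finsupp.single σ x) = Finsupp.single (σ * τ) x :=
  Finsupp.mapDomain_single

theorem NSData.IsOperad.symmetrization {P : NSData k} (hP : P.IsOperad) :
    P.symmetrization.IsOperad where
  circ_one {m} i := linear_eq_of_span
      (f := (P.symmetrization.circ (l := m) rfl i).flip P.symmetrization.one) (g := LinearMap.id)
      (span_range_single (Equiv.Perm (Fin m))) (by
    rintro _ ⟨σ, p, rfl⟩
    refine (P.symmetrization_circ_single rfl i σ 1 p P.one).trans ?_
    rw [permCirc_one_right, hP.circ_one]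
    rfl)
  circ_seq {m n r mn nr l} h1 h2 h3 h4 i j q hq := by
    refine bilinear_seq_of_span (span_range_single (Equiv.Perm (Fin m)))
      (span_range_single (Equiv.Perm (Fin n))) (span_range_single (Equiv.Perm (Fin r))) ?_
    rintro _ ⟨σ, x, rfl⟩ _ ⟨τ, y, rfl⟩ _ ⟨ρ, z, rfl⟩
    refine ((congrArg (fun w => P.symmetrization.circ h2 q w (Finsupp.single ρ z))
      (P.symmetrization_circ_single h1 i σ τ x y)).trans
        (P.symmetrization_circ_single h2 q _ ρ _ z)).trans (Eq.symm ?_)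
    refine ((congrArg (P.symmetrization.circ h4 i (Finsupp.single σ x))
      (P.symmetrization_circ_single h3 j τ ρ y z)).trans
        (P.symmetrization_circ_single h4 i σ _ x _)).trans ?_
    rw [permCirc_seq h1 h2 h3 h4 i j q hq,
      hP.circ_seq h1 h2 h3 h4 (σ i) (τ j) _ (permCirc_inner h1 i σ τ j q hq)]
  circ_par {m n r mn mr l} h1 h2 h3 h4 i j hij q q' hq hq' := by
    refine bilinear_par_of_span (span_range_single (Equiv.Perm (Fin m)))
      (span_range_single (Equiv.Perm (Fin n))) (span_range_single (Equiv.Perm (Fin r))) ?_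
    rintro _ ⟨σ, x, rfl⟩ _ ⟨τ, y, rfl⟩ _ ⟨ρ, z, rfl⟩
    refine ((congrArg (fun w => P.symmetrization.circ h2 q w (Finsupp.single ρ z))
      (P.symmetrization_circ_single h1 i σ τ x y)).trans
        (P.symmetrization_circ_single h2 q _ ρ _ z)).trans (Eq.symm ?_)
    refine ((congrArg (fun w => P.symmetrization.circ h4 q' w (Finsupp.single τ y))
      (P.symmetrization_circ_single h3 j σ ρ x z)).trans
        (P.symmetrization_circ_single h4 q' _ τ _ y)).trans ?_
    rw [permCirc_par h1 h2 h3 h4 i j hij q q' hq hq',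
      hP.circ_par h1 h2 h3 h4 (σ i) (σ j) (σ.injective.ne hij) _ _
        (permCirc_outer h1 i σ τ j hij.symm q hq) (permCirc_outer h3 j σ ρ i hij q' hq')]
  circ_act {m n l} h i σ τ := by
    refine fun x y => (bilinear_map_of_span (span_range_single (Equiv.Perm (Fin m)))
      (span_range_single (Equiv.Perm (Fin n))) ?_ x y).symm
    rintro _ ⟨σ', x, rfl⟩ _ ⟨τ', y, rfl⟩
    refine Eq.symm ?_
    refine ((congrArg₂ (fun w w' => P.symmetrization.circ h i w w')
      (P.symmetrization_act_single σ σ' x) (P.symmetrization_act_single τ τ' y)).trans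
        (P.symmetrization_circ_single h i _ _ x y)).trans (Eq.symm ?_)
    refine ((congrArg (P.symmetrization.act (permCirc h i σ τ))
      (P.symmetrization_circ_single h (σ i) σ' τ' x y)).trans
        (P.symmetrization_act_single _ _ _)).trans ?_
    rw [permCirc_mul]
    rfl

section endomorphism

variable (A : Type u) [AddCommGroup A] [Module k A]

theorem endCirc_apply {m n l : ℕ} (h : l + 1 = m + n)
    (i : Fin m) (f : MultilinearMap k (fun _ : Fin m => A) A)
    (g : MultilinearMap k (fun _ : Fin n => A) A) (x : Fin l → A) :
    endCirc A h i f g x = f fun j => if hj : j = i then g fun c => x (inputEquiv h i (.inr c))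
      else x (inputEquiv h i (.inl ⟨j, hj⟩)) := rfl

theorem inputEquiv_inr_val {m n l : ℕ} (h : l + 1 = m + n) (i : Fin m) (c : Fin n) :
    (inputEquiv h i (.inr c)).1 = i.1 + c.1 := rfl

theorem inputEquiv_inl_val {m n l : ℕ} (h : l + 1 = m + n) (i : Fin m) (j : {j : Fin m // j ≠ i}) :
    (inputEquiv h i (.inl j)).1 = outerIdx i n j.1 := rfl

theorem endCirc_seq {m n r mn nr l : ℕ} (h1 : mn + 1 = m + n) (h2 : l + 1 = mn + r)
    (h3 : nr + 1 = n + r) (h4 : l + 1 = m + nr) (i : Fin m) (j : Fin n) (q : Fin mn)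
    (hq : q.1 = i.1 + j.1) (x : MultilinearMap k (fun _ : Fin m => A) A)
    (y : MultilinearMap k (fun _ : Fin n => A) A) (z : MultilinearMap k (fun _ : Fin r => A) A) :
    endCirc A h2 q (endCirc A h1 i x y) z = endCirc A h4 i x (endCirc A h3 j y z) := by
  refine MultilinearMap.ext fun a => ?_
  simp only [endCirc_apply]
  congr 1
  funext d
  by_cases hd : d = i
  · subst hd
    simp only [dif_pos]
    congr 1
    funext c
    by_cases hc : c = j
    · subst hc
      have : inputEquiv h1 d (.inr c) = q := Fin.ext hq.symm
      simp only [this, dif_pos]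
      congr 1
      funext c'
      congr 1
      ext
      simp only [inputEquiv_inr_val]
      omega
    · have hne : inputEquiv h1 d (.inr c) ≠ q := fun h => by
        have := congrArg Fin.val h
        rw [inputEquiv_inr_val] at this
        exact hc (Fin.ext (by omega))
      rw [dif_neg hne, dif_neg hc]
      congr 1
      ext
      simp only [inputEquiv_inr_val, inputEquiv_inl_val]
      rw [hq, outerIdx_seq_inner _ (Fin.val_ne hc)]
  · have hne : inputEquiv h1 i (.inl ⟨d, hd⟩) ≠ q := fun h => by
      have h' := congrArg Fin.val h
      have := j.2
      have := Fin.val_ne hd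
      rw [inputEquiv_inl_val] at h'
      simp only [outerIdx] at h'
      split_ifs at h' <;> omega
    rw [dif_neg hd, dif_neg hd, dif_neg hne]
    congr 1
    ext
    simp only [inputEquiv_inl_val]
    rw [hq, outerIdx_seq h3 j.2 (Fin.val_ne hd)]

theorem endCirc_par {m n r mn mr l : ℕ} (h1 : mn + 1 = m + n) (h2 : l + 1 = mn + r)
    (h3 : mr + 1 = m + r) (h4 : l + 1 = mr + n) (i j : Fin m) (hij : i ≠ j) (q : Fin mn)
    (q' : Fin mr) (hq : q.1 = outerIdx i n j) (hq' : q'.1 = outerIdx j r i)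
    (x : MultilinearMap k (fun _ : Fin m => A) A)
    (y : MultilinearMap k (fun _ : Fin n => A) A) (z : MultilinearMap k (fun _ : Fin r => A) A) :
    endCirc A h2 q (endCirc A h1 i x y) z = endCirc A h4 q' (endCirc A h3 j x z) y := by
  have key : ∀ {m n r mn mr l : ℕ} (h1 : mn + 1 = m + n) (h2 : l + 1 = mn + r)
      (h3 : mr + 1 = m + r) (h4 : l + 1 = mr + n) (i j : Fin m) (_ : i ≠ j) (q : Fin mn)
      (q' : Fin mr) (_ : q.1 = outerIdx i n j) (_ : q'.1 = outerIdx j r i) (c : Fin n),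
      inputEquiv h1 i (.inr c) ≠ q ∧ ∀ hne,
        inputEquiv h2 q (.inl ⟨inputEquiv h1 i (.inr c), hne⟩) = inputEquiv h4 q' (.inr c) := by
    intro m n r mn mr l h1 h2 h3 h4 i j hij q q' hq hq' c
    refine ⟨fun h => ?_, fun hne => ?_⟩
    · have h' := congrArg Fin.val h
      have := c.2
      have := Fin.val_ne hij
      rw [inputEquiv_inr_val, hq] at h'
      simp only [outerIdx] at h'
      split_ifs at h' <;> omega
    · ext
      simp only [inputEquiv_inr_val, inputEquiv_inl_val]
      rw [hq, hq', outerIdx_par_inner r (Fin.val_ne hij) c.2]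
  have hi : inputEquiv h3 j (.inl ⟨i, hij⟩) = q' := Fin.ext hq'.symm
  have hj : inputEquiv h1 i (.inl ⟨j, hij.symm⟩) = q := Fin.ext hq.symm
  refine MultilinearMap.ext fun a => ?_
  simp only [endCirc_apply]
  congr 1
  funext d
  by_cases hdi : d = i
  · subst hdi
    rw [dif_pos rfl, dif_neg hij, dif_pos hi]
    congr 1
    funext c
    obtain ⟨hne, he⟩ := key h1 h2 h3 h4 d j hij q q' hq hq' c
    rw [dif_neg hne, he hne]
  · by_cases hdj : d = j
    · subst hdj
      rw [dif_neg hdi, dif_pos rfl, dif_pos hj]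
      congr 1
      funext c
      obtain ⟨hne, he⟩ := key h3 h4 h1 h2 d i hij.symm q' q hq' hq c
      rw [dif_neg hne, he hne]
    · have h5 : inputEquiv h1 i (.inl ⟨d, hdi⟩) ≠ q := fun h => by
        rw [← hj] at h
        exact hdj (congrArg Subtype.val (Sum.inl_injective ((inputEquiv h1 i).injective h)))
      have h6 : inputEquiv h3 j (.inl ⟨d, hdj⟩) ≠ q' := fun h => by
        rw [← hi] at h
        exact hdi (congrArg Subtype.val (Sum.inl_injective ((inputEquiv h3 j).injective h)))
      rw [dif_neg hdi, dif_neg hdj, dif_neg h5, dif_neg h6]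
      congr 1
      ext
      simp only [inputEquiv_inl_val]
      rw [hq, hq', outerIdx_par (Fin.val_ne hij) (Fin.val_ne hdi) (Fin.val_ne hdj)]

theorem endCirc_act {m n l : ℕ} (h : l + 1 = m + n) (i : Fin m) (σ : Equiv.Perm (Fin m))
    (τ : Equiv.Perm (Fin n)) (f : MultilinearMap k (fun _ : Fin m => A) A)
    (g : MultilinearMap k (fun _ : Fin n => A) A) :
    endCirc A h i (MultilinearMap.domDomCongr σ.symm f) (MultilinearMap.domDomCongr τ.symm g) =
      MultilinearMap.domDomCongr (permCirc h i σ τ).symm (endCirc A h (σ i) f g) := by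
  refine MultilinearMap.ext fun x => ?_
  simp only [endCirc_apply, MultilinearMap.domDomCongr_apply]
  congr 1
  funext d
  by_cases hd : d = σ i
  · subst hd
    rw [dif_pos rfl, dif_pos (σ.symm_apply_apply i)]
    congr 1
    funext c
    congr 1
    rw [Equiv.eq_symm_apply]
    ext
    rw [permCirc_inner h i σ τ (τ.symm c) _ rfl, inputEquiv_inr_val, Equiv.apply_symm_apply]
  · have hd' : σ.symm d ≠ i := fun h => hd (by rw [← h, Equiv.apply_symm_apply])
    rw [dif_neg hd, dif_neg hd']
    congr 1
    rw [Equiv.eq_symm_apply]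
    ext
    rw [permCirc_outer h i σ τ (σ.symm d) hd' _ rfl, inputEquiv_inl_val, Equiv.apply_symm_apply]

theorem endCirc_one {m : ℕ} (i : Fin m) (f : MultilinearMap k (fun _ : Fin m => A) A) :
    endCirc A rfl i f (MultilinearMap.ofSubsingleton k A A (0 : Fin 1) LinearMap.id) = f := by
  refine MultilinearMap.ext fun a => ?_
  rw [endCirc_apply]
  congr 1
  funext j
  by_cases hj : j = i
  · subst hj
    rw [dif_pos rfl]
    simp only [MultilinearMap.ofSubsingleton_apply_apply, LinearMap.id_apply]
    rfl
  · rw [dif_neg hj]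
    congr 1
    ext
    rw [inputEquiv_inl_val]
    have := Fin.val_ne hj
    simp only [outerIdx]
    split_ifs <;> omega

theorem endOperad_isOperad : (endOperad (k := k) A).IsOperad where
  circ_one := endCirc_one A
  circ_seq := endCirc_seq A
  circ_par := endCirc_par A
  circ_act := endCirc_act A

end endomorphism

end axioms

/-! ### Full compositions -/

namespace SymData

variable {k : Type u} [Field k] {T : SymData k}

theorem gammaFrom_zero {m : ℕ} (p : ℕ) (f : Fin 0 → Σ a, T.obj a)
    (h : m + 0 = m + ∑ j, (f j).1) (hp : p + 0 ≤ m) (t : T.obj m) :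
    T.gammaFrom 0 p f h hp t = t := rfl

theorem gammaFrom_cons {r m m' l p : ℕ} (x : Σ a, T.obj a) (g : Fin r → Σ a, T.obj a)
    (h : l + (r + 1) = m + ∑ j, ((Fin.cons x g : Fin (r + 1) → Σ a, T.obj a) j).1)
    (hp : p + (r + 1) ≤ m) (t : T.obj m) (hm' : m' + 1 = m + x.1)
    (h' : l + r = m' + ∑ j, (g j).1) (hp' : p + x.1 + r ≤ m') :
    T.gammaFrom (r + 1) p (Fin.cons x g) h hp t =
      T.gammaFrom r (p + x.1) g h' hp' (T.circ hm' ⟨p, by omega⟩ t x.2) := by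
  obtain rfl : m' = m - 1 + x.1 := by omega
  rfl

theorem gammaFrom_congr {r m l p p' : ℕ} {f f' : Fin r → Σ a, T.obj a} {t t' : T.obj m}
    (hpp : p = p') (hf : f = f') (ht : t = t') (h : l + r = m + ∑ j, (f j).1) (hp : p + r ≤ m)
    (h' : l + r = m + ∑ j, (f' j).1) (hp' : p' + r ≤ m) :
    T.gammaFrom r p f h hp t = T.gammaFrom r p' f' h' hp' t' := by
  subst hpp hf ht
  rfl

theorem exists_eq_cons {r : ℕ} (f : Fin (r + 1) → Σ a, T.obj a) :
    ∃ x g, f = Fin.cons x g := ⟨f 0, Fin.tail f, (Fin.cons_self_tail f).symm⟩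

theorem sum_arity_cons {r : ℕ} (x : Σ a, T.obj a) (g : Fin r → Σ a, T.obj a) :
    ∑ j, ((Fin.cons x g : Fin (r + 1) → Σ a, T.obj a) j).1 = x.1 + ∑ j, (g j).1 := by
  rw [Fin.sum_univ_succ]; rfl

theorem sum_arity_insertNth {r : ℕ} (i : Fin (r + 1)) (x : Σ a, T.obj a)
    (g : Fin r → Σ a, T.obj a) :
    ∑ j, ((i.insertNth x g : Fin (r + 1) → Σ a, T.obj a) j).1 = x.1 + ∑ j, (g j).1 := by
  rw [Fin.sum_univ_succAbove _ i]; simp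

theorem sum_arity_update {r : ℕ} (f : Fin r → Σ a, T.obj a) (i : Fin r) (x : Σ a, T.obj a) :
    ∑ j, (Function.update f i x j).1 + (f i).1 = ∑ j, (f j).1 + x.1 := by
  have h1 : (fun j => (Function.update f i x j).1) = Function.update (fun j => (f j).1) i x.1 := by
    funext j
    by_cases hj : j = i
    · subst hj; simp
    · simp [hj]
  rw [h1, Finset.sum_update_of_mem (Finset.mem_univ i), ← Finset.add_sum_erase _ _
    (Finset.mem_univ i), Finset.sdiff_singleton_eq_erase]
  ring

/-- The full composition, as a linear function of the outer operation. -/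
def gammaFromLin (T : SymData k) {r m l : ℕ} (p : ℕ) (f : Fin r → Σ a, T.obj a)
    (h : l + r = m + ∑ j, (f j).1) (hp : p + r ≤ m) : T.obj m →ₗ[k] T.obj l where
  toFun t := T.gammaFrom r p f h hp t
  map_add' s t := by
    induction r generalizing m p with
    | zero =>
      obtain rfl : l = m := by simpa using h
      rfl
    | succ r ih =>
      obtain ⟨x, g, rfl⟩ := exists_eq_cons f
      have hs := sum_arity_cons x g
      have hm' : m - 1 + x.1 + 1 = m + x.1 := by omega
      have h' : l + r = m - 1 + x.1 + ∑ j, (g j).1 := by omega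
      simp only [gammaFrom_cons x g h hp _ hm' h' (by omega), map_add, LinearMap.add_apply, ih]
  map_smul' c t := by
    induction r generalizing m p with
    | zero =>
      obtain rfl : l = m := by simpa using h
      rfl
    | succ r ih =>
      obtain ⟨x, g, rfl⟩ := exists_eq_cons f
      have hs := sum_arity_cons x g
      have hm' : m - 1 + x.1 + 1 = m + x.1 := by omega
      have h' : l + r = m - 1 + x.1 + ∑ j, (g j).1 := by omega
      simp only [RingHom.id_apply] at ih ⊢
      simp only [gammaFrom_cons x g h hp _ hm' h' (by omega), map_smul, LinearMap.smul_apply, ih]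

theorem gammaFromLin_apply {r m l : ℕ} (p : ℕ) (f : Fin r → Σ a, T.obj a)
    (h : l + r = m + ∑ j, (f j).1) (hp : p + r ≤ m) (t : T.obj m) :
    T.gammaFromLin p f h hp t = T.gammaFrom r p f h hp t := rfl

theorem gammaFrom_smul {r m l : ℕ} (p : ℕ) (f : Fin r → Σ a, T.obj a)
    (h : l + r = m + ∑ j, (f j).1) (hp : p + r ≤ m) (c : k) (t : T.obj m) :
    T.gammaFrom r p f h hp (c • t) = c • T.gammaFrom r p f h hp t :=
  (T.gammaFromLin p f h hp).map_smul c t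

/-- A full composition plugged into an operation. -/
theorem IsSuspOperad.circ_gammaFrom (hT : T.IsSuspOperad) {b : ℕ} (c : T.obj b) (i : Fin b)
    {r m l lc mc : ℕ} (p p' : ℕ) (hpp : p' = i.1 + p) (f : Fin r → Σ a, T.obj a)
    (h : l + r = m + ∑ j, (f j).1) (hp : p + r ≤ m) (t : T.obj m) (hl : lc + 1 = b + l)
    (hm : mc + 1 = b + m) (h' : lc + r = mc + ∑ j, (f j).1) (hp' : p' + r ≤ mc) :
    T.circ hl i c (T.gammaFrom r p f h hp t) = T.gammaFrom r p' f h' hp' (T.circ hm i c t) := by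
  induction r generalizing m p p' mc with
  | zero =>
    obtain rfl : l = m := by simpa using h
    obtain rfl : lc = mc := by omega
    rfl
  | succ r ih =>
    obtain ⟨x, g, rfl⟩ := exists_eq_cons f
    have hs := sum_arity_cons x g
    have hi := i.2
    have hm1 : m - 1 + x.1 + 1 = m + x.1 := by omega
    have hm2 : mc - 1 + x.1 + 1 = mc + x.1 := by omega
    rw [gammaFrom_cons x g h hp t hm1 (by omega) (by omega),
      gammaFrom_cons x g h' hp' _ hm2 (by omega) (by omega),
      ih (p + x.1) (p' + x.1) (by omega) g _ _ _ (mc := mc - 1 + x.1) (by omega) (by omega)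
        (by omega)]
    congr 1
    exact (hT.circ_seq hm hm2 hm1 (by omega) i ⟨p, by omega⟩ ⟨p', by omega⟩ hpp c t x.2).symm

/-- The composition `x ∘_q c` with a binary operation `c`. -/
abbrev circR (T : SymData k) {m : ℕ} (q : Fin m) (x : T.obj m) (c : T.obj 2) : T.obj (m + 1) :=
  T.circ (m := m) (n := 2) (l := m + 1) rfl q x c

/-- The composition `c ∘_i x` with a binary operation `c`. -/
abbrev circL (T : SymData k) {m : ℕ} (i : Fin 2) (c : T.obj 2) (x : T.obj m) : T.obj (m + 1) :=
  T.circ (m := 2) (n := m) (l := m + 1) (Nat.add_comm (m + 1) 1 |>.trans (by omega)) i c x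

/-- A binary operation plugged into an input to the left of a full composition. -/
theorem IsSuspOperad.gammaFrom_circ_left (hT : T.IsSuspOperad) (c : T.obj 2)
    {r m l : ℕ} (p : ℕ) (f : Fin r → Σ a, T.obj a)
    (h : l + r = m + ∑ j, (f j).1) (hp : p + r ≤ m) (t : T.obj m) (q : Fin l) (q' : Fin m)
    (hq : q.1 = q'.1) (hqp : q'.1 < p) (h' : l + 1 + r = m + 1 + ∑ j, (f j).1)
    (hp' : p + 1 + r ≤ m + 1) :
    T.circR q (T.gammaFrom r p f h hp t) c =
      ((-1 : k) ^ (∑ j, ((f j).1 + 1))) • T.gammaFrom r (p + 1) f h' hp' (T.circR q' t c) := by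
  induction r generalizing m p with
  | zero =>
    obtain rfl : l = m := by simpa using h
    obtain rfl : q = q' := Fin.ext hq
    simp [gammaFrom_zero]
  | succ r ih =>
    obtain ⟨x, g, rfl⟩ := exists_eq_cons f
    have hs := sum_arity_cons x g
    have hm1 : m - 1 + x.1 + 1 = m + x.1 := by omega
    rw [gammaFrom_cons x g h hp t hm1 (by omega) (by omega),
      gammaFrom_cons x g h' hp' _ (m' := m - 1 + x.1 + 1) (by omega) (by omega) (by omega),
      ih (m := m - 1 + x.1) (p + x.1) g _ _ _ ⟨q.1, by omega⟩ rfl (by simp only; omega)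
        (by omega) (by omega)]
    have e := hT.circ_par (l := m - 1 + x.1 + 1) hm1 rfl (rfl : m + 1 + 1 = m + 2) (by omega)
      ⟨p, by omega⟩ q' (fun h => by have := congrArg Fin.val h; simp only at this; omega)
      ⟨q.1, by omega⟩
      ⟨p + 1, by omega⟩ (by rw [outerIdx_of_lt hqp]; exact hq)
      (by rw [outerIdx_of_le hqp.le]; simp only; omega) t x.2 c
    rw [circR, e, gammaFrom_smul, smul_smul, ← pow_add]
    refine congrArg₂ _ (neg_one_pow_eq_of_zmod ?_) (gammaFrom_congr (by omega) rfl rfl _ _ _ _)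
    simp only [Fin.sum_univ_succ, Fin.cons_zero, Fin.cons_succ]
    push_cast
    have h2 := CharTwo.two_eq_zero (R := ZMod 2)
    linear_combination (x.1 + 1 : ZMod 2) * h2

/-- A binary operation plugged into the operation in slot `i` of a full composition. -/
theorem IsSuspOperad.gammaFrom_circR (hT : T.IsSuspOperad) (c : T.obj 2)
    {r m l : ℕ} (p : ℕ) (f : Fin r → Σ a, T.obj a)
    (h : l + r = m + ∑ j, (f j).1) (hp : p + r ≤ m) (t : T.obj m) (i : Fin r)
    {a : ℕ} (y : T.obj a) (hi : f i = ⟨a, y⟩) (v : Fin a)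
    (q : Fin l) (hq : q.1 = p + (∑ j, if j < i then (f j).1 else 0) + v.1)
    (h' : l + 1 + r = m + ∑ j, (Function.update f i ⟨a + 1, T.circR v y c⟩ j).1) :
    T.circR q (T.gammaFrom r p f h hp t) c =
      ((-1 : k) ^ (∑ j, if i < j then (f j).1 + 1 else 0)) •
        T.gammaFrom r p (Function.update f i ⟨a + 1, T.circR v y c⟩) h' hp t := by
  induction r generalizing m p with
  | zero => exact i.elim0
  | succ r ih =>
    obtain ⟨x, g, rfl⟩ := exists_eq_cons f
    have hs := sum_arity_cons x g
    have hm1 : m - 1 + x.1 + 1 = m + x.1 := by omega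
    have hv := v.2
    induction i using Fin.cases with
    | zero =>
      obtain rfl : x = ⟨a, y⟩ := hi
      replace hm1 : m - 1 + a + 1 = m + a := hm1
      replace hs : _ = a + ∑ j, (g j).1 := hs
      rw [gammaFrom_cons _ g h hp t hm1 (by omega) (by simp only; omega)]
      rw [hT.gammaFrom_circ_left c _ g _ _ _ q ⟨p + v.1, by omega⟩ (by simpa using hq)
        (by simp only; omega) (by omega) (by simp only; omega),
        gammaFrom_congr rfl (Fin.update_cons_zero _ _ _) rfl h' hp
          (by have := sum_arity_cons ⟨a + 1, T.circR v y c⟩ g; simp only at this; omega) hp,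
        gammaFrom_cons _ g _ _ _ (m' := m - 1 + a + 1) (by simp only; omega) (by omega)
          (by simp only; omega), Fin.sum_univ_succ]
      refine congrArg₂ _ ?_ (gammaFrom_congr rfl rfl ?_ _ _ _ _)
      · simp
      · exact hT.circ_seq _ _ _ _ ⟨p, by omega⟩ v ⟨p + v.1, by omega⟩ rfl t y c
    | succ i =>
      have hs' := sum_arity_update g i ⟨a + 1, T.circR v y c⟩
      have hgi : (g i).1 = a := congrArg Sigma.fst hi
      have hu := sum_arity_cons x (Function.update g i ⟨a + 1, T.circR v y c⟩)
      simp only at hs'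
      rw [gammaFrom_cons _ g h hp t hm1 (by omega) (by omega),
        ih (p + x.1) g _ _ _ i hi
          (by rw [hq, Fin.sum_univ_succ]; simp [Fin.succ_lt_succ_iff, add_assoc]) (by omega),
        gammaFrom_congr rfl (Fin.cons_update _ _ _ _).symm rfl h' hp (by omega) hp,
        gammaFrom_cons _ _ _ _ _ hm1 (by omega) (by omega), Fin.sum_univ_succ]
      simp [Fin.succ_lt_succ_iff]

/-- Plugging a unit into one more input changes nothing. -/
theorem IsSuspOperad.gammaFrom_cons_one (hT : T.IsSuspOperad) {r m l p : ℕ}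
    (g : Fin r → Σ a, T.obj a)
    (h : l + (r + 1) = m + ∑ j, ((Fin.cons ⟨1, T.one⟩ g : Fin (r + 1) → Σ a, T.obj a) j).1)
    (hp : p + (r + 1) ≤ m) (t : T.obj m)
    (h' : l + r = m + ∑ j, (g j).1) (hp' : p + 1 + r ≤ m) :
    T.gammaFrom (r + 1) p (Fin.cons ⟨1, T.one⟩ g) h hp t = T.gammaFrom r (p + 1) g h' hp' t := by
  rw [gammaFrom_cons _ g h hp t (m' := m) rfl h' hp']
  exact gammaFrom_congr rfl rfl (hT.circ_one _ t) _ _ _ _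

theorem IsSuspOperad.gammaFrom_insertNth_last (hT : T.IsSuspOperad) {r m l p : ℕ}
    (f : Fin r → Σ a, T.obj a)
    (h : l + (r + 1) = m + ∑ j, ((Fin.last r).insertNth (α := fun _ => Σ a, T.obj a)
      ⟨1, T.one⟩ f j).1)
    (hp : p + (r + 1) ≤ m) (t : T.obj m) (h' : l + r = m + ∑ j, (f j).1) (hp' : p + r ≤ m) :
    T.gammaFrom (r + 1) p ((Fin.last r).insertNth (α := fun _ => Σ a, T.obj a) ⟨1, T.one⟩ f)
      h hp t = T.gammaFrom r p f h' hp' t := by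
  induction r generalizing m p with
  | zero =>
    have e : (Fin.last 0).insertNth (α := fun _ => Σ a, T.obj a) ⟨1, T.one⟩ f =
      Fin.cons ⟨1, T.one⟩ f := Fin.insertNth_zero' _ _
    rw [gammaFrom_congr rfl e rfl h hp (by rw [← e]; exact h) hp,
      hT.gammaFrom_cons_one f _ _ t (by omega) (by omega)]
    obtain rfl : l = m := by simpa using h'
    rfl
  | succ r ih =>
    obtain ⟨x, g, rfl⟩ := exists_eq_cons f
    have hs := sum_arity_cons x g
    have hm1 : m - 1 + x.1 + 1 = m + x.1 := by omega
    have e : (Fin.last (r + 1)).insertNth (α := fun _ => Σ a, T.obj a) ⟨1, T.one⟩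
        (Fin.cons x g) = Fin.cons x ((Fin.last r).insertNth (α := fun _ => Σ a, T.obj a)
          ⟨1, T.one⟩ g) :=
      Fin.insertNth_succ_cons (Fin.last r) _ _ _
    have hi := sum_arity_insertNth (Fin.last r) ⟨1, T.one⟩ g
    have hs2 := sum_arity_cons x ((Fin.last r).insertNth (α := fun _ => Σ a, T.obj a)
          ⟨1, T.one⟩ g)
    simp only at hi
    rw [gammaFrom_congr rfl e rfl h hp (by omega) hp,
      gammaFrom_cons _ _ _ _ _ hm1 (by omega) (by omega),
      gammaFrom_cons _ g _ _ _ hm1 (by omega) (by omega),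
      ih g _ _ _ (by omega) (by omega)]

/-- The slot for the unit when `c ∘_e y`, in slot `i` of a full composition, is decomposed: it is
the one to the right of `y` for `e = 0` and the one to the left of `y` for `e = 1`. -/
def unitSlot {r : ℕ} (e : Fin 2) (i : Fin r) : Fin (r + 1) := if e = 0 then i.succ else i.castSucc

theorem unitSlot_succ {r : ℕ} (e : Fin 2) (i : Fin r) :
    unitSlot e i.succ = (unitSlot e i).succ := by
  unfold unitSlot
  split_ifs <;> simp

/-- A full composition with `c ∘_e y` in slot `i` is a full composition of `t ∘_i c` with a unit
in an additional slot next to `y`. -/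
theorem IsSuspOperad.gammaFrom_update_circL (hT : T.IsSuspOperad) (c : T.obj 2) (e : Fin 2)
    {r m l : ℕ} (p : ℕ) (f : Fin r → Σ a, T.obj a) (hp : p + r ≤ m) (t : T.obj m) (i : Fin r)
    {a : ℕ} (y : T.obj a) (hi : f i = ⟨a, y⟩)
    (h : l + r = m + ∑ j, (Function.update f i ⟨a + 1, T.circL e c y⟩ j).1)
    (q : Fin m) (hq : q.1 = p + i.1)
    (h' : l + (r + 1) = m + 1 + ∑ j, ((unitSlot e i).insertNth (α := fun _ => Σ a, T.obj a)
      ⟨1, T.one⟩ f j).1) (hp' : p + (r + 1) ≤ m + 1) :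
    T.gammaFrom r p (Function.update f i ⟨a + 1, T.circL e c y⟩) h hp t =
      ((-1 : k) ^ (∑ j, if j < i then (f j).1 + 1 else 0)) •
        T.gammaFrom (r + 1) p ((unitSlot e i).insertNth (α := fun _ => Σ a, T.obj a)
          ⟨1, T.one⟩ f) h' hp' (T.circR q t c) := by
  induction r generalizing m p with
  | zero => exact i.elim0
  | succ r ih =>
    obtain ⟨x, g, rfl⟩ := exists_eq_cons f
    have hs := sum_arity_cons x g
    have hm1 : m - 1 + x.1 + 1 = m + x.1 := by omega
    induction i using Fin.cases with
    | zero =>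
      obtain rfl : x = ⟨a, y⟩ := hi
      replace hm1 : m - 1 + a + 1 = m + a := hm1
      replace hs : _ = a + ∑ j, (g j).1 := hs
      obtain ⟨q, hqm⟩ := q
      obtain rfl : q = p := by simpa using hq
      have hs1 : _ = a + 1 + ∑ j, (g j).1 := sum_arity_cons ⟨a + 1, T.circL e c y⟩ g
      have hs2 : _ = 1 + ∑ j, (g j).1 := sum_arity_cons ⟨1, T.one⟩ g
      rw [Fin.update_cons_zero, hs1] at h
      rw [gammaFrom_congr rfl (Fin.update_cons_zero _ _ _) rfl _ hp (by omega) hp,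
        gammaFrom_cons _ g _ _ _ (m' := m - 1 + a + 1) (by simp only; omega) (by omega)
          (by simp only; omega)]
      have hz : ∑ j, (if j < (0 : Fin (r + 1)) then
          ((Fin.cons ⟨a, y⟩ g : Fin (r + 1) → Σ a, T.obj a) j).1 + 1 else 0) = 0 := by simp
      rw [hz, pow_zero, one_smul]
      have he : e = 0 ∨ e = 1 := by omega
      rcases he with rfl | rfl
      · have e1 : (unitSlot (0 : Fin 2) (0 : Fin (r + 1))).insertNth (α := fun _ => Σ a, T.obj a)
            ⟨1, T.one⟩ (Fin.cons ⟨a, y⟩ g) = Fin.cons ⟨a, y⟩ (Fin.cons ⟨1, T.one⟩ g) :=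
          (Fin.insertNth_succ_cons 0 _ _ _).trans (congrArg _ (Fin.insertNth_zero' _ _))
        have hs3 : _ = a + ∑ j, _ := sum_arity_cons ⟨a, y⟩
          (Fin.cons ⟨1, T.one⟩ g : Fin (r + 1) → Σ a, T.obj a)
        rw [gammaFrom_congr rfl e1 rfl h' hp' (by omega) hp',
          gammaFrom_cons _ _ _ _ _ (m' := m - 1 + a + 1) (by simp only; omega) (by omega)
            (by simp only; omega),
          hT.gammaFrom_cons_one g _ _ _ (by omega) (by simp only; omega)]
        refine gammaFrom_congr (by simp only; omega) rfl ?_ _ _ _ _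
        exact (hT.circ_seq _ _ _ _ ⟨q, hqm⟩ 0 ⟨q, by omega⟩ rfl t c y).symm
      · have e1 : (unitSlot (1 : Fin 2) (0 : Fin (r + 1))).insertNth (α := fun _ => Σ a, T.obj a)
            ⟨1, T.one⟩ (Fin.cons ⟨a, y⟩ g) = Fin.cons ⟨1, T.one⟩ (Fin.cons ⟨a, y⟩ g) :=
          Fin.insertNth_zero' _ _
        have hs3 : _ = 1 + ∑ j, _ := sum_arity_cons ⟨1, T.one⟩
          (Fin.cons ⟨a, y⟩ g : Fin (r + 1) → Σ a, T.obj a)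
        rw [gammaFrom_congr rfl e1 rfl h' hp' (by omega) hp',
          hT.gammaFrom_cons_one _ _ _ _ (by omega) (by omega),
          gammaFrom_cons _ _ _ _ _ (m' := m - 1 + a + 1) (by simp only; omega) (by omega)
            (by simp only; omega)]
        refine gammaFrom_congr (by simp only; omega) rfl ?_ _ _ _ _
        exact (hT.circ_seq _ _ _ _ ⟨q, hqm⟩ 1 ⟨q + 1, by omega⟩ rfl t c y).symm
    | succ i =>
      have hgi : (g i).1 = a := congrArg Sigma.fst hi
      have hs' : _ = _ + (a + 1) := sum_arity_update g i ⟨a + 1, T.circL e c y⟩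
      have hu := sum_arity_cons x (Function.update g i ⟨a + 1, T.circL e c y⟩)
      have hn : _ = 1 + _ := sum_arity_insertNth (unitSlot e i) ⟨1, T.one⟩ g
      have hun := sum_arity_cons x ((unitSlot e i).insertNth (α := fun _ => Σ a, T.obj a)
        ⟨1, T.one⟩ g)
      have e1 : (unitSlot e i.succ).insertNth (α := fun _ => Σ a, T.obj a)
            ⟨1, T.one⟩ (Fin.cons x g) = Fin.cons x ((unitSlot e i).insertNth
              (α := fun _ => Σ a, T.obj a) ⟨1, T.one⟩ g) := by
        rw [unitSlot_succ]
        exact Fin.insertNth_succ_cons _ _ _ _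
      have hi2 := i.2
      have hqi : q.1 = p + (i.1 + 1) := hq
      rw [← Fin.cons_update] at h
      rw [gammaFrom_congr rfl (Fin.cons_update _ _ _ _).symm rfl _ hp h hp,
        gammaFrom_cons _ _ _ _ _ hm1 (by omega) (by omega),
        gammaFrom_congr rfl e1 rfl h' hp' (by omega) hp',
        gammaFrom_cons _ _ _ _ _ (m' := m - 1 + x.1 + 1) (by omega) (by omega) (by omega),
        ih (p + x.1) g _ _ i hi _ ⟨p + x.1 + i.1, by omega⟩ rfl (by omega) (by omega)]
      have e2 := hT.circ_par (l := m - 1 + x.1 + 1) hm1 rfl (rfl : m + 1 + 1 = m + 2) (by omega)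
        ⟨p, by omega⟩ q (fun h => by have := congrArg Fin.val h; simp only at this; omega)
        ⟨p + x.1 + i.1, by omega⟩ ⟨p, by omega⟩
        (by rw [outerIdx_of_le (by simp only; omega)]; simp only; omega)
        (by rw [outerIdx_of_lt (by simp only; omega)]) t x.2 c
      rw [circR, e2, gammaFrom_smul, smul_smul, ← pow_add]
      refine congrArg₂ _ (neg_one_pow_eq_of_zmod ?_) rfl
      simp only [Fin.sum_univ_succ, Fin.cons_zero, Fin.cons_succ, Fin.succ_lt_succ_iff, Fin.succ_pos,
        if_true]
      rw [Nat.cast_add, Nat.cast_add]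
      push_cast
      have h2 := CharTwo.two_eq_zero (R := ZMod 2)
      linear_combination (x.1 + 1 : ZMod 2) * h2

/-- A permutation of inputs which lie to the left of a full composition. -/
theorem IsSuspOperad.gammaFrom_act (hT : T.IsSuspOperad) {r m l : ℕ} (p : ℕ)
    (f : Fin r → Σ a, T.obj a) (h : l + r = m + ∑ j, (f j).1) (hp : p + r ≤ m) (t : T.obj m)
    (σ : Equiv.Perm (Fin m)) (hσ : ∀ j : Fin m, p ≤ j.1 → σ j = j) :
    ∃ σ' : Equiv.Perm (Fin l),
      T.gammaFrom r p f h hp (T.act σ t) = T.act σ' (T.gammaFrom r p f h hp t) := by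
  induction r generalizing m p with
  | zero =>
    obtain rfl : l = m := by simpa using h
    exact ⟨σ, rfl⟩
  | succ r ih =>
    obtain ⟨x, g, rfl⟩ := exists_eq_cons f
    have hs := sum_arity_cons x g
    have hm1 : m - 1 + x.1 + 1 = m + x.1 := by omega
    have hpm : p < m := by omega
    obtain ⟨σ', h'⟩ := ih (p + x.1) g (by omega) (by omega) (T.circ hm1 ⟨p, hpm⟩ t x.2)
      (permCirc hm1 ⟨p, hpm⟩ σ 1) (fun j hj => by
        rcases inputEquiv_cases hm1 ⟨p, hpm⟩ j with ⟨d, hd, hjd⟩ | ⟨c, hjc⟩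
        · have hd' := Fin.val_ne hd
          ext
          rw [permCirc_outer hm1 _ σ 1 d hd j hjd, hσ d
            (by
              simp only [outerIdx] at hjd hd'
              split_ifs at hjd <;> omega), hσ ⟨p, hpm⟩ le_rfl, hjd]
        · have := c.2
          simp only at hjc
          omega)
    refine ⟨σ', ?_⟩
    rw [gammaFrom_cons _ _ _ _ _ hm1 (by omega) (by omega),
      gammaFrom_cons _ _ _ _ _ hm1 (by omega) (by omega), ← h']
    have e := hT.circ_act hm1 ⟨p, hpm⟩ σ 1 t x.2
    rw [T.act_one, hσ ⟨p, hpm⟩ le_rfl] at e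
    rw [e]

/-- A full composition is linear in each of the operations which are plugged in, and a permutation
of the inputs of one of these operations permutes the inputs of the composition. -/
theorem IsSuspOperad.exists_gammaFrom_update_eq (hT : T.IsSuspOperad) {r m l : ℕ} (p : ℕ)
    (f : Fin r → Σ a, T.obj a) (hp : p + r ≤ m) (t : T.obj m) (i : Fin r) (a : ℕ)
    (h : ∀ y : T.obj a, l + r = m + ∑ j, (Function.update f i ⟨a, y⟩ j).1) :
    ∃ φ : T.obj a →ₗ[k] T.obj l,
      (∀ y, T.gammaFrom r p (Function.update f i ⟨a, y⟩) (h y) hp t = φ y) ∧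
      ∀ (σ : Equiv.Perm (Fin a)) (y : T.obj a), ∃ σ', φ (T.act σ y) = T.act σ' (φ y) := by
  induction r generalizing m p with
  | zero => exact i.elim0
  | succ r ih =>
    obtain ⟨x, g, rfl⟩ := exists_eq_cons f
    induction i using Fin.cases with
    | zero =>
      have hm1 : m - 1 + a + 1 = m + a := by omega
      have hpm : p < m := by omega
      have h0 : l + (r + 1) = m + (a + ∑ j, (g j).1) := by
        have h1 := h 0
        have hs : _ = a + _ := sum_arity_cons ⟨a, 0⟩ g
        rw [Fin.update_cons_zero] at h1
        omega
      refine ⟨T.gammaFromLin (p + a) g (by omega) (by omega) ∘ₗ T.circ hm1 ⟨p, hpm⟩ t,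
        fun y => ?_, fun σ y => ?_⟩
      · have hs : _ = a + _ := sum_arity_cons ⟨a, y⟩ g
        rw [gammaFrom_congr rfl (Fin.update_cons_zero _ _ _) rfl _ hp (by omega) hp,
          gammaFrom_cons _ _ _ _ _ hm1 (by omega) (by simp only; omega)]
        rfl
      · have e := hT.circ_act hm1 ⟨p, hpm⟩ 1 σ t y
        rw [T.act_one] at e
        simp only [LinearMap.comp_apply, gammaFromLin_apply]
        rw [e]
        refine hT.gammaFrom_act _ _ _ _ _ _ fun j hj => ?_
        rcases inputEquiv_cases hm1 ⟨p, hpm⟩ j with ⟨d, hd, hjd⟩ | ⟨c, hjc⟩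
        · ext
          rw [permCirc_outer hm1 _ 1 σ d hd j hjd, hjd]
          rfl
        · have := c.2
          simp only at hjc
          omega
    | succ i =>
      have hm1 : m - 1 + x.1 + 1 = m + x.1 := by omega
      have hs := fun y => sum_arity_cons x (Function.update g i ⟨a, y⟩)
      have h' : ∀ y : T.obj a, l + (r + 1) =
          m + (x.1 + ∑ j, (Function.update g i ⟨a, y⟩ j).1) := fun y => by
        have := h y
        rw [← Fin.cons_update] at this
        rw [this, hs y]
      obtain ⟨φ, h1, h2⟩ := ih (p + x.1) g (by omega) (T.circ hm1 ⟨p, by omega⟩ t x.2) i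
        (fun y => by have := h' y; omega)
      refine ⟨φ, fun y => ?_, h2⟩
      have := h' y
      rw [gammaFrom_congr rfl (Fin.cons_update _ _ _ _).symm rfl _ hp (by rw [hs]; omega) hp,
          gammaFrom_cons _ _ _ _ _ hm1 (by omega) (by omega), ← h1]

end SymData

/-! ### The differential of an operation -/

namespace SymData

variable {k : Type u} [Field k] {T : SymData k}

theorem coe_aver (n : ℕ) (x : T.obj n) :
    (T.aver n x : T.obj n) = ((n.factorial : k)⁻¹) • ∑ σ : Equiv.Perm (Fin n), T.act σ x := by
  change (((n.factorial : k)⁻¹) • ∑ σ : Equiv.Perm (Fin n), T.act σ : T.obj n →ₗ[k] T.obj n) x = _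
  rw [LinearMap.smul_apply, LinearMap.sum_apply]

theorem aver_act {n : ℕ} (σ : Equiv.Perm (Fin n)) (x : T.obj n) :
    T.aver n (T.act σ x) = T.aver n x := by
  refine Subtype.ext ?_
  rw [coe_aver, coe_aver]
  simp only [← T.act_mul]
  congr 1
  exact Fintype.sum_equiv (Equiv.mulLeft σ) _ _ fun _ => rfl

/-- A linear map which carries permutations to permutations is compatible with averaging. -/
theorem aver_map_aver [CharZero k] {n l : ℕ} (φ : T.obj n →ₗ[k] T.obj l)
    (hφ : ∀ (σ : Equiv.Perm (Fin n)) (y : T.obj n), ∃ σ', φ (T.act σ y) = T.act σ' (φ y))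
    (y : T.obj n) : T.aver l (φ (T.aver n y : T.obj n)) = T.aver l (φ y) := by
  have h : ∀ σ : Equiv.Perm (Fin n), T.aver l (φ (T.act σ y)) = T.aver l (φ y) := fun σ => by
    obtain ⟨σ', h⟩ := hφ σ y
    rw [h, aver_act]
  rw [coe_aver]
  simp only [map_smul, map_sum, h]
  rw [Finset.sum_const, Finset.card_univ, Fintype.card_perm, Fintype.card_fin,
    ← Nat.cast_smul_eq_nsmul k, smul_smul,
    inv_mul_cancel₀ (Nat.cast_ne_zero.2 n.factorial_ne_zero), one_smul]

theorem preLie_apply {m n l : ℕ} (h : l + 1 = m + n) (x : T.obj m) (y : T.obj n) :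
    T.preLie h x y = ∑ i, T.circ h i x y := by
  simp [preLie]

/-- The bracket as a bilinear map. -/
def bracketLin (T : SymData k) {m n l : ℕ} (h : l + 1 = m + n) :
    T.obj m →ₗ[k] T.obj n →ₗ[k] T.obj l :=
  T.preLie h - ((-1 : k) ^ ((m + 1) * (n + 1))) • (T.preLie (by omega)).flip

theorem bracketLin_apply {m n l : ℕ} (h : l + 1 = m + n) (x : T.obj m) (y : T.obj n) :
    T.bracketLin h x y = T.bracket h x y := rfl

theorem IsSuspOperad.aver_preLie_act (hT : T.IsSuspOperad) {m n l : ℕ} (h : l + 1 = m + n)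
    (σ : Equiv.Perm (Fin m)) (τ : Equiv.Perm (Fin n)) (x : T.obj m) (y : T.obj n) :
    T.aver l (T.preLie h (T.act σ x) (T.act τ y)) = T.aver l (T.preLie h x y) := by
  simp only [preLie_apply, hT.circ_act, map_sum, aver_act]
  exact Fintype.sum_equiv σ _ _ fun _ => rfl

theorem IsSuspOperad.aver_bracket_act (hT : T.IsSuspOperad) {m n l : ℕ} (h : l + 1 = m + n)
    (σ : Equiv.Perm (Fin m)) (τ : Equiv.Perm (Fin n)) (x : T.obj m) (y : T.obj n) :
    T.aver l (T.bracket h (T.act σ x) (T.act τ y)) = T.aver l (T.bracket h x y) := by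
  simp only [bracket, map_sub, map_smul, hT.aver_preLie_act]

/-- For the differential, the canonical element may be replaced by twice its non-symmetric part. -/
theorem IsSuspOperad.diff_sum_act (hT : T.IsSuspOperad) (c : T.obj 2) {n : ℕ} (x : T.inv n) :
    T.diff (∑ σ, T.act σ c) x =
      (2 : k) • T.aver (n + 1) (T.bracket (by omega) c (x : T.obj n)) := by
  have h : ∀ σ : Equiv.Perm (Fin 2),
      T.aver (n + 1) (T.bracket (by omega) (T.act σ c) (x : T.obj n)) =
      T.aver (n + 1) (T.bracket (by omega) c (x : T.obj n)) := fun σ => by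
    have := hT.aver_bracket_act (l := n + 1) (by omega) σ 1 c (x : T.obj n)
    rwa [T.act_one] at this
  rw [diff, ← bracketLin_apply, map_sum, LinearMap.sum_apply, map_sum]
  simp only [bracketLin_apply, h]
  rw [Finset.sum_const, Finset.card_univ, Fintype.card_perm, Fintype.card_fin,
    ← Nat.cast_smul_eq_nsmul k]
  simp

theorem IsSuspOperad.diff_sum_act_aver [CharZero k] (hT : T.IsSuspOperad) (c : T.obj 2) {n : ℕ}
    (x : T.obj n) :
    T.diff (∑ σ, T.act σ c) (T.aver n x) =
      (2 : k) • T.aver (n + 1) (T.bracket (by omega) c x) := by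
  rw [hT.diff_sum_act]
  congr 1
  rw [coe_aver]
  have h : ∀ σ : Equiv.Perm (Fin n), T.aver (n + 1) (T.bracket (by omega) c (T.act σ x)) =
      T.aver (n + 1) (T.bracket (by omega) c x) := fun σ => by
    have := hT.aver_bracket_act (l := n + 1) (by omega) 1 σ c x
    rwa [T.act_one] at this
  rw [← bracketLin_apply]
  simp only [map_smul, map_sum, bracketLin_apply, h]
  rw [Finset.sum_const, Finset.card_univ, Fintype.card_perm, Fintype.card_fin,
    ← Nat.cast_smul_eq_nsmul k, smul_smul,
    inv_mul_cancel₀ (Nat.cast_ne_zero.2 n.factorial_ne_zero), one_smul]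

/-- `γ(s; f_1, …, f_j, 1, f_{j+1}, …, f_n)`, as a linear function of `s`. -/
def unitGamma (T : SymData k) {n l : ℕ} (f : Fin n → Σ a, T.obj a) (h : l = ∑ j, (f j).1)
    (j : Fin (n + 1)) : T.obj (n + 1) →ₗ[k] T.obj (l + 1) :=
  T.gammaFromLin 0 (j.insertNth (α := fun _ => Σ a, T.obj a) ⟨1, T.one⟩ f)
    (by have e : _ = 1 + _ := sum_arity_insertNth j ⟨1, T.one⟩ f; omega) (by omega)

/-- The terms of the differential of `γ(t; f_1, …, f_n)` in which the generating operation `c` is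
not plugged into one of the `f_i`. -/
def unitDefect (T : SymData k) (c : T.obj 2) {n l : ℕ} (t : T.obj n) (f : Fin n → Σ a, T.obj a)
    (h : l = ∑ j, (f j).1) : T.obj (l + 1) :=
  T.unitGamma f h (Fin.last n) (T.circL 0 c t) + T.unitGamma f h 0 (T.circL 1 c t) -
    ((-1 : k) ^ (n + 1)) • ∑ i : Fin n, (T.unitGamma f h i.succ (T.circR i t c) +
      T.unitGamma f h i.castSucc (T.circR i t c))

theorem bracket_two {m : ℕ} (c : T.obj 2) (x : T.obj m) (h : m + 1 + 1 = 2 + m) :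
    T.bracket h c x = T.circL 0 c x + T.circL 1 c x -
      ((-1 : k) ^ (m + 1)) • ∑ q, T.circR q x c := by
  rw [bracket, preLie_apply, preLie_apply, Fin.sum_univ_two]
  congr 2
  refine neg_one_pow_eq_of_zmod ?_
  push_cast
  have h2 := CharTwo.two_eq_zero (R := ZMod 2)
  linear_combination (m + 1 : ZMod 2) * h2

theorem sum_eq_sum_lt_add_sum_gt {n : ℕ} (i : Fin n) (F : Fin n → ℕ) :
    ∑ j, F j = (∑ j, if j < i then F j else 0) + F i + ∑ j, if i < j then F j else 0 := by
  have h1 : F i = ∑ j, if j = i then F j else 0 := by simp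
  rw [h1, ← Finset.sum_add_distrib, ← Finset.sum_add_distrib]
  refine Finset.sum_congr rfl fun j _ => ?_
  rcases lt_trichotomy j i with hj | hj | hj
  · simp [hj, hj.ne, hj.not_gt]
  · simp [hj]
  · simp [hj, hj.ne', hj.not_gt]

theorem sum_castLE {n : ℕ} (i : Fin n) (F : Fin n → ℕ) :
    ∑ j : Fin i.1, F (Fin.castLE i.2.le j) = ∑ j, if j < i then F j else 0 := by
  rw [← Finset.sum_filter]
  refine Finset.sum_bij (fun j _ => Fin.castLE i.2.le j) (fun j _ => ?_) (fun a _ b _ h => ?_)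
    (fun j hj => ?_) (fun _ _ => rfl)
  · exact Finset.mem_filter.2 ⟨Finset.mem_univ _, j.2⟩
  · exact Fin.castLE_injective _ h
  · exact ⟨⟨j.1, (Finset.mem_filter.1 hj).2⟩, Finset.mem_univ _, rfl⟩

/-- The sum over all inputs of a full composition of the operations with `c` plugged into this
input. -/
theorem IsSuspOperad.sum_gamma_circR (hT : T.IsSuspOperad) (c : T.obj 2) {n l : ℕ} (t : T.obj n)
    (f : Fin n → Σ a, T.obj a) (h : l = ∑ j, (f j).1)
    (φ : ∀ i : Fin n, T.obj ((f i).1 + 1) →ₗ[k] T.obj (l + 1))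
    (hφ : ∀ i y h', φ i y = T.gamma t (Function.update f i ⟨(f i).1 + 1, y⟩) h') :
    ∑ q, T.circR q (T.gamma t f h) c =
      ∑ i, ((-1 : k) ^ (∑ j, if i < j then (f j).1 + 1 else 0)) •
        φ i (∑ v, T.circR v (f i).2 c) := by
  subst h
  have hu := fun i y => sum_arity_update f i ⟨(f i).1 + 1, y⟩
  simp only at hu
  simp only [map_sum, Finset.smul_sum]
  rw [← Equiv.sum_comp finSigmaFinEquiv, Fintype.sum_sigma]
  refine Finset.sum_congr rfl fun i _ => Finset.sum_congr rfl fun v _ => ?_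
  rw [hφ i _ (by have := hu i (T.circR v (f i).2 c); omega)]
  refine hT.gammaFrom_circR c 0 f _ _ t i (f i).2 rfl v _ ?_ _
  rw [finSigmaFinEquiv_apply, sum_castLE i fun j => (f j).1, zero_add]

/-- In the differential of a full composition, the terms with `c` plugged into one of the `f_i`
cancel. -/
theorem IsSuspOperad.bracket_gamma (hT : T.IsSuspOperad) (c : T.obj 2) {n l : ℕ} (t : T.obj n)
    (f : Fin n → Σ a, T.obj a) (h : l = ∑ j, (f j).1)
    (φ : ∀ i : Fin n, T.obj ((f i).1 + 1) →ₗ[k] T.obj (l + 1))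
    (hφ : ∀ i y h', φ i y = T.gamma t (Function.update f i ⟨(f i).1 + 1, y⟩) h') :
    T.bracket (l := l + 1) (by omega) c (T.gamma t f h) - ((-1 : k) ^ (n + 1)) •
        ∑ i, ((-1 : k) ^ (∑ j, if j < i then (f j).1 + 1 else 0)) •
          φ i (T.bracket (by omega) c (f i).2) =
      T.unitDefect c t f h := by
  have hu := fun i y => sum_arity_update f i ⟨(f i).1 + 1, y⟩
  simp only at hu
  have hlast : T.circL 0 c (T.gamma t f h) = T.unitGamma f h (Fin.last n) (T.circL 0 c t) := by
    refine (hT.circ_gammaFrom c 0 0 0 rfl f _ _ t _ (mc := n + 1) (by omega) (by omega)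
      (by omega)).trans ?_
    have e : _ = 1 + _ := sum_arity_insertNth (Fin.last n) ⟨1, T.one⟩ f
    exact (hT.gammaFrom_insertNth_last f (by omega) (by omega) _ _ _).symm
  have hzero : T.circL 1 c (T.gamma t f h) = T.unitGamma f h 0 (T.circL 1 c t) := by
    refine (hT.circ_gammaFrom c 1 0 1 rfl f _ _ t _ (mc := n + 1) (by omega) (by omega)
      (by omega)).trans ?_
    have e : _ = 1 + _ := sum_arity_cons ⟨1, T.one⟩ f
    refine (hT.gammaFrom_cons_one f (by omega) (by omega) _ (by omega) (by omega)).symm.trans ?_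
    have e2 : _ = 1 + _ := sum_arity_insertNth 0 ⟨1, T.one⟩ f
    exact gammaFrom_congr rfl (Fin.insertNth_zero' _ _).symm rfl _ _ (by omega) (by omega)
  have hslot : ∀ (e : Fin 2) (i : Fin n), φ i (T.circL e c (f i).2) =
      ((-1 : k) ^ (∑ j, if j < i then (f j).1 + 1 else 0)) •
        T.unitGamma f h (unitSlot e i) (T.circR i t c) := fun e i => by
    have e1 := hu i (T.circL e c (f i).2)
    have e2 : _ = 1 + _ := sum_arity_insertNth (unitSlot e i) ⟨1, T.one⟩ f
    rw [hφ i _ (by omega)]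
    exact hT.gammaFrom_update_circL c e 0 f (by omega) t i (f i).2 rfl (by omega) i
      (zero_add _).symm (by omega) (by omega)
  have hsq : ∀ a : ℕ, ((-1 : k) ^ a) * (-1 : k) ^ a = 1 := fun a => by
    rw [← mul_pow]; simp
  have hsign : ∀ i : Fin n, (-1 : k) ^ (l + 1) *
        (-1) ^ (∑ j, if i < j then (f j).1 + 1 else 0) =
      (-1) ^ (n + 1) * ((-1) ^ (∑ j, if j < i then (f j).1 + 1 else 0) *
        (-1) ^ ((f i).1 + 1)) := fun i => by
    rw [← pow_add, ← pow_add, ← pow_add]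
    refine neg_one_pow_eq_of_zmod ?_
    have e := sum_eq_sum_lt_add_sum_gt i fun j => (f j).1 + 1
    rw [Finset.sum_add_distrib, ← h, Finset.sum_const, Finset.card_univ, Fintype.card_fin,
      smul_eq_mul, mul_one] at e
    have e' := congrArg (Nat.cast (R := ZMod 2)) e
    rw [Nat.cast_add, Nat.cast_add, Nat.cast_add, Nat.cast_add (f i).1] at e'
    rw [Nat.cast_add, Nat.cast_add, Nat.cast_add, Nat.cast_add, Nat.cast_add,
      Nat.cast_add (f i).1]
    have h2 := CharTwo.two_eq_zero (R := ZMod 2)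
    generalize ((∑ j, if i < j then (f j).1 + 1 else 0 : ℕ) : ZMod 2) = u at *
    generalize ((∑ j, if j < i then (f j).1 + 1 else 0 : ℕ) : ZMod 2) = v at *
    linear_combination e' + (u - n) * h2
  have hterm : ∀ i : Fin n, ((-1 : k) ^ (n + 1)) •
        ((-1 : k) ^ (∑ j, if j < i then (f j).1 + 1 else 0)) •
          φ i (T.bracket (by omega) c (f i).2) =
      ((-1 : k) ^ (n + 1)) • (T.unitGamma f h i.succ (T.circR i t c) +
        T.unitGamma f h i.castSucc (T.circR i t c)) -
      ((-1 : k) ^ (l + 1)) • ((-1 : k) ^ (∑ j, if i < j then (f j).1 + 1 else 0)) •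
        φ i (∑ v, T.circR v (f i).2 c) := fun i => by
    have e0 : unitSlot 0 i = i.succ := rfl
    have e1 : unitSlot 1 i = i.castSucc := rfl
    rw [bracket_two, map_sub, map_add, map_smul, hslot, hslot, e0, e1, ← smul_add, smul_sub,
      smul_smul ((-1 : k) ^ (∑ j, if j < i then (f j).1 + 1 else 0)), hsq, one_smul, smul_sub,
      smul_smul, smul_smul, smul_smul, hsign, mul_assoc]
  rw [bracket_two, hT.sum_gamma_circR c t f h φ hφ, hlast, hzero]
  rw [Finset.smul_sum (r := (-1 : k) ^ (n + 1)), Finset.sum_congr rfl fun i _ => hterm i,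
    Finset.sum_sub_distrib, ← Finset.smul_sum, ← Finset.smul_sum, unitDefect]
  abel

/-- The element underlying an argument of an operation on cochains. -/
def coeArg (x : Σ a, T.inv a) : Σ a, T.obj a := ⟨x.1, x.2⟩

theorem coeArg_update {n : ℕ} (f : Fin n → Σ a, T.inv a) (i : Fin n) (x : Σ a, T.inv a) :
    (fun j => coeArg (Function.update f i x j)) =
      Function.update (fun j => coeArg (f j)) i (coeArg x) := by
  funext j
  by_cases hj : j = i
  · subst hj; simp
  · simp [hj]

theorem sum_arity_update_inv {n : ℕ} (f : Fin n → Σ a, T.inv a) (i : Fin n)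
    (x : T.inv ((f i).1 + 1)) :
    ∑ j, (Function.update f i ⟨(f i).1 + 1, x⟩ j).1 = ∑ j, (f j).1 + 1 := by
  have h := sum_arity_update (fun j => coeArg (f j)) i (coeArg ⟨(f i).1 + 1, x⟩)
  rw [← coeArg_update] at h
  change ∑ j, (Function.update f i ⟨(f i).1 + 1, x⟩ j).1 + (f i).1 =
    ∑ j, (f j).1 + ((f i).1 + 1) at h
  omega

theorem averGamma_of_eq {n l : ℕ} (t : T.obj n) (f : Fin n → Σ a, T.inv a)
    (h : l = ∑ j, (f j).1) :
    T.averGamma t f l = T.aver l (T.gamma t (fun j => coeArg (f j)) h) := dif_pos h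

theorem averGamma_of_ne {n l : ℕ} (t : T.obj n) (f : Fin n → Σ a, T.inv a)
    (h : l ≠ ∑ j, (f j).1) : T.averGamma t f l = 0 := dif_neg h

theorem IsSuspOperad.delta_averGamma_of_ne (c : T.obj 2)
    {n l : ℕ} (t : T.obj n) (f : Fin n → Σ a, T.inv a) (h : l ≠ ∑ j, (f j).1 + 1) (d : ℕ) :
    T.delta c d (T.averGamma t) f l = 0 := by
  have h1 : T.diffAt c (T.averGamma t f) l = 0 := by
    cases l with
    | zero => rfl
    | succ l =>
      change T.diff c (T.averGamma t f l) = 0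
      rw [averGamma_of_ne t f (by omega), diff, ← bracketLin_apply]
      simp
  rw [delta, h1, Finset.sum_eq_zero, smul_zero, sub_zero]
  intro i _
  rw [averGamma_of_ne _ _ (by rw [sum_arity_update_inv]; exact h), smul_zero]

/-- The differential of the operation given by `t` is, up to the factor `2`, the sum of the full
compositions of `t ∘_i c` and `c ∘_i t` with an additional unit. -/
theorem IsSuspOperad.delta_averGamma [CharZero k] (hT : T.IsSuspOperad) (c : T.obj 2)
    {n l : ℕ} (t : T.obj n) (f : Fin n → Σ a, T.inv a) (h : l = ∑ j, (f j).1) :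
    T.delta (∑ σ, T.act σ c) (n + 1) (T.averGamma t) f (l + 1) =
      (2 : k) • T.aver (l + 1) (T.unitDefect c t (fun j => coeArg (f j)) h) := by
  have hu : ∀ (i : Fin n) (y : T.obj ((f i).1 + 1)),
      _ + (f i).1 = _ + ((f i).1 + 1) := fun i y =>
    sum_arity_update (fun j => coeArg (f j)) i ⟨(f i).1 + 1, y⟩
  have hf : ∑ j, (coeArg (f j)).1 = ∑ j, (f j).1 := rfl
  choose φ hφ hφσ using fun i : Fin n => hT.exists_gammaFrom_update_eq (l := l + 1) 0
    (fun j => coeArg (f j)) (by omega) t i ((f i).1 + 1) (fun y => by have := hu i y; omega)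
  have h1 : T.diffAt (∑ σ, T.act σ c) (T.averGamma t f) (l + 1) =
      (2 : k) • T.aver (l + 1) (T.bracket (by omega) c
        (T.gamma t (fun j => coeArg (f j)) h)) := by
    change T.diff _ (T.averGamma t f l) = _
    rw [averGamma_of_eq t f h, hT.diff_sum_act_aver]
  have h2 : ∀ i, T.averGamma t (Function.update f i ⟨(f i).1 + 1,
        T.diff (∑ σ, T.act σ c) (f i).2⟩) (l + 1) =
      (2 : k) • T.aver (l + 1) (φ i (T.bracket (by omega) c ((f i).2 : T.obj (f i).1))) := by
    intro i
    have e := sum_arity_update_inv f i (T.diff (∑ σ, T.act σ c) (f i).2)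
    rw [averGamma_of_eq _ _ (by omega)]
    have e2 := hφ i (T.diff (∑ σ, T.act σ c) (f i).2)
    have e3 : T.gamma t (fun j => coeArg (Function.update f i ⟨(f i).1 + 1,
        T.diff (∑ σ, T.act σ c) (f i).2⟩ j)) (l := l + 1) (by rw [← h] at e; exact e.symm) =
        φ i (T.diff (∑ σ, T.act σ c) (f i).2) := by
      rw [← e2]
      exact gammaFrom_congr rfl (coeArg_update _ _ _) rfl _ _ _ _
    rw [e3, hT.diff_sum_act, Submodule.coe_smul, map_smul, map_smul,
      aver_map_aver (φ i) (hφσ i)]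
  rw [delta, h1]
  simp only [h2]
  rw [← hT.bracket_gamma c t (fun j => coeArg (f j)) h φ (fun i y h' => (hφ i y).symm)]
  simp only [map_sub, map_smul, map_sum, smul_sub, Finset.smul_sum, Finset.sum_filter]
  congr 1
  refine Finset.sum_congr rfl fun i _ => ?_
  rw [smul_comm (2 : k) ((-1 : k) ^ (n + 1)), smul_comm (2 : k)]
  rfl

end SymData

/-! ### Trees and quadratic operads -/

namespace BinTree

variable {E : Type u}

theorem leaves_pos (t : BinTree E) : 0 < t.leaves := by
  induction t with
  | leaf => exact Nat.one_pos
  | node e l r ihl _ => exact Nat.add_pos_left ihl _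

theorem graft_leaf (t : BinTree E) (i : ℕ) : t.graft i leaf = t := by
  induction t generalizing i with
  | leaf => rfl
  | node e l r ihl ihr => simp [graft, ihl, ihr]

theorem graft_node_of_lt {e : E} {l r s : BinTree E} {i : ℕ} (h : i < l.leaves) :
    (node e l r).graft i s = node e (l.graft i s) r := by simp [graft, h]

theorem graft_node_of_le {e : E} {l r s : BinTree E} {i : ℕ} (h : l.leaves ≤ i) :
    (node e l r).graft i s = node e l (r.graft (i - l.leaves) s) := by simp [graft, h.not_gt]

theorem graft_seq (t s u : BinTree E) (i j : ℕ) (hi : i < t.leaves) (hj : j < s.leaves) :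
    (t.graft i s).graft (i + j) u = t.graft i (s.graft j u) := by
  induction t generalizing i with
  | leaf =>
    obtain rfl : i = 0 := by simpa [leaves] using hi
    simp [graft]
  | node e l r ihl ihr =>
    simp only [leaves] at hi
    by_cases h : i < l.leaves
    · have := l.leaves_graft s i h
      rw [graft_node_of_lt h, graft_node_of_lt h, graft_node_of_lt (by omega), ihl i h]
    · rw [not_lt] at h
      rw [graft_node_of_le h, graft_node_of_le h, graft_node_of_le (by omega),
        show i + j - l.leaves = i - l.leaves + j by omega, ihr _ (by omega)]

theorem graft_par_of_lt (t s u : BinTree E) (i j : ℕ) (hij : i < j) (hj : j < t.leaves) :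
    (t.graft i s).graft (j - 1 + s.leaves) u = (t.graft j u).graft i s := by
  induction t generalizing i j with
  | leaf =>
    simp only [leaves] at hj
    omega
  | node e l r ihl ihr =>
    simp only [leaves] at hj
    by_cases h : j < l.leaves
    · have h1 := l.leaves_graft s i (by omega)
      have h2 := l.leaves_graft u j h
      have h3 := u.leaves_pos
      rw [graft_node_of_lt h, graft_node_of_lt (by omega : i < l.leaves),
        graft_node_of_lt (by omega), graft_node_of_lt (by omega), ihl i j hij h]
    · rw [not_lt] at h
      rw [graft_node_of_le h]
      by_cases h' : i < l.leaves
      · have h1 := l.leaves_graft s i h'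
        have h3 := s.leaves_pos
        rw [graft_node_of_lt h', graft_node_of_lt h', graft_node_of_le (by omega)]
        congr 2
        omega
      · rw [not_lt] at h'
        rw [graft_node_of_le h', graft_node_of_le h', graft_node_of_le (by omega),
          show j - 1 + s.leaves - l.leaves = j - l.leaves - 1 + s.leaves by omega,
          ihr _ _ (by omega) (by omega)]

theorem graft_par (t s u : BinTree E) (i j : ℕ) (hij : i ≠ j) (hi : i < t.leaves)
    (hj : j < t.leaves) :
    (t.graft i s).graft (outerIdx i s.leaves j) u =
      (t.graft j u).graft (outerIdx j u.leaves i) s := by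
  rcases lt_or_gt_of_ne hij with h | h
  · rw [outerIdx_of_le h.le, outerIdx_of_lt h, graft_par_of_lt t s u i j h hj]
  · rw [outerIdx_of_lt h, outerIdx_of_le h.le, graft_par_of_lt t u s j i h hi]

theorem eq_leaf_of_leaves {t : BinTree E} (h : t.leaves = 1) : t = leaf := by
  rcases t with _ | ⟨e, l, r⟩
  · rfl
  · simp only [leaves] at h
    have := l.leaves_pos
    have := r.leaves_pos
    omega

theorem eq_node_of_leaves_two {t : BinTree E} (h : t.leaves = 2) :
    ∃ e, t = node e leaf leaf := by
  rcases t with _ | ⟨e, l, r⟩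
  · simp [leaves] at h
  · simp only [leaves] at h
    have hl := l.leaves_pos
    have hr := r.leaves_pos
    rw [eq_leaf_of_leaves (t := l) (by omega), eq_leaf_of_leaves (t := r) (by omega)]
    exact ⟨e, rfl⟩

theorem eq_node_of_leaves_three {t : BinTree E} (h : t.leaves = 3) :
    (∃ e e', t = node e (node e' leaf leaf) leaf) ∨
      ∃ e e', t = node e leaf (node e' leaf leaf) := by
  rcases t with _ | ⟨e, l, r⟩
  · simp [leaves] at h
  · simp only [leaves] at h
    have hl := l.leaves_pos
    have hr := r.leaves_pos
    obtain hl1 | hl2 : l.leaves = 1 ∨ l.leaves = 2 := by omega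
    · obtain ⟨e', rfl⟩ := eq_node_of_leaves_two (t := r) (by omega)
      rw [eq_leaf_of_leaves hl1]
      exact Or.inr ⟨e, e', rfl⟩
    · obtain ⟨e', rfl⟩ := eq_node_of_leaves_two hl2
      rw [eq_leaf_of_leaves (t := r) (by omega)]
      exact Or.inl ⟨e, e', rfl⟩

end BinTree

section quadratic

variable {k : Type u} [Field k]

theorem FreeNS.circ_single {E : Type u} {m n l : ℕ} (h : l + 1 = m + n) (i : Fin m)
    (t : TreeN E m) (s : TreeN E n) (a b : k) :
    FreeNS.circ h i (Finsupp.single t a) (Finsupp.single s b) =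
      Finsupp.single (TreeN.graft h i t s) (a * b) := by
  simp [FreeNS.circ, Finsupp.mapDomain_single]

theorem FreeNS.circ_one {E : Type u} {m : ℕ} (i : Fin m) (x : FreeNS k E m) :
    FreeNS.circ (l := m) rfl i x (Finsupp.single ⟨.leaf, rfl⟩ 1) = x := by
  induction x using Finsupp.induction_linear with
  | zero => simp
  | add x y hx hy => rw [map_add, LinearMap.add_apply, hx, hy]
  | single t a =>
    rw [FreeNS.circ_single, mul_one]
    congr 1
    exact Subtype.ext (t.1.graft_leaf i)

theorem FreeNS.circ_seq {E : Type u} {m n r mn nr l : ℕ} (h1 : mn + 1 = m + n)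
    (h2 : l + 1 = mn + r) (h3 : nr + 1 = n + r) (h4 : l + 1 = m + nr) (i : Fin m) (j : Fin n)
    (q : Fin mn) (hq : q.1 = i.1 + j.1) (x : FreeNS k E m) (y : FreeNS k E n)
    (z : FreeNS k E r) :
    FreeNS.circ h2 q (FreeNS.circ h1 i x y) z = FreeNS.circ h4 i x (FreeNS.circ h3 j y z) := by
  refine bilinear_seq_of_span (span_range_single _) (span_range_single _) (span_range_single _)
    ?_ x y z
  rintro _ ⟨t, a, rfl⟩ _ ⟨s, b, rfl⟩ _ ⟨u, c, rfl⟩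
  simp only [FreeNS.circ_single, mul_assoc]
  congr 1
  refine Subtype.ext ?_
  have := t.1.graft_seq s.1 u.1 i j (by rw [t.2]; exact i.2) (by rw [s.2]; exact j.2)
  rw [← hq] at this
  exact this

theorem FreeNS.circ_par {E : Type u} {m n r mn mr l : ℕ} (h1 : mn + 1 = m + n)
    (h2 : l + 1 = mn + r) (h3 : mr + 1 = m + r) (h4 : l + 1 = mr + n) (i j : Fin m) (hij : i ≠ j)
    (q : Fin mn) (q' : Fin mr) (hq : q.1 = outerIdx i n j) (hq' : q'.1 = outerIdx j r i)
    (x : FreeNS k E m) (y : FreeNS k E n) (z : FreeNS k E r) :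
    FreeNS.circ h2 q (FreeNS.circ h1 i x y) z = FreeNS.circ h4 q' (FreeNS.circ h3 j x z) y := by
  refine bilinear_par_of_span (span_range_single _) (span_range_single _) (span_range_single _)
    ?_ x y z
  rintro _ ⟨t, a, rfl⟩ _ ⟨s, b, rfl⟩ _ ⟨u, c, rfl⟩
  simp only [FreeNS.circ_single, mul_assoc]
  rw [mul_comm c b]
  congr 1
  refine Subtype.ext ?_
  have := t.1.graft_par s.1 u.1 i j (Fin.val_ne hij) (by rw [t.2]; exact i.2)
    (by rw [t.2]; exact j.2)
  rw [s.2, u.2, ← hq, ← hq'] at this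
  exact this

variable {E : Type u} [AddCommGroup E] [Module k E]

theorem quadOperad_isOperad (R : Submodule k (GammaThree k E)) : (quadOperad R).IsOperad where
  circ_one {m} i x := by
    obtain ⟨x, rfl⟩ := (quadIdeal R m).mkQ_surjective x
    exact congrArg (quadIdeal R m).mkQ (FreeNS.circ_one i x)
  circ_seq {m n r mn nr l} h1 h2 h3 h4 i j q hq x y z := by
    obtain ⟨x, rfl⟩ := (quadIdeal R m).mkQ_surjective x
    obtain ⟨y, rfl⟩ := (quadIdeal R n).mkQ_surjective y
    obtain ⟨z, rfl⟩ := (quadIdeal R r).mkQ_surjective z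
    exact congrArg (quadIdeal R l).mkQ (FreeNS.circ_seq h1 h2 h3 h4 i j q hq x y z)
  circ_par {m n r mn mr l} h1 h2 h3 h4 i j hij q q' hq hq' x y z := by
    obtain ⟨x, rfl⟩ := (quadIdeal R m).mkQ_surjective x
    obtain ⟨y, rfl⟩ := (quadIdeal R n).mkQ_surjective y
    obtain ⟨z, rfl⟩ := (quadIdeal R r).mkQ_surjective z
    exact congrArg (quadIdeal R l).mkQ (FreeNS.circ_par h1 h2 h3 h4 i j hij q q' hq hq' x y z)

end quadratic

/-! ### Algebras over quadratic operads -/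

section algebras

variable {k : Type u} [Field k]

/-- An algebra over a non-symmetric operad is an algebra over its symmetrization. -/
noncomputable def OpAlgebra.ofNS {A : Type u} [AddCommGroup A] [Module k A] (P : NSData k)
    (f : ∀ n, P.obj n →ₗ[k] (endOperad (k := k) A).obj n)
    (hone : f 1 P.one = (endOperad A).one)
    (hcirc : ∀ {m n l : ℕ} (h : l + 1 = m + n) (i : Fin m) (p : P.obj m) (q : P.obj n),
      f l (P.circ h i p q) = (endOperad A).circ h i (f m p) (f n q)) :
    OpAlgebra A P.symmetrization where
  toFun n := Finsupp.lsum k fun σ : Equiv.Perm (Fin n) => (endOperad A).act σ ∘ₗ f n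
  map_one := by
    refine (Finsupp.lsum_single k _ _ _).trans ?_
    rw [LinearMap.comp_apply, (endOperad A).act_one, hone]
  map_circ {m n l} h i := by
    refine bilinear_map_of_span (span_range_single (Equiv.Perm (Fin m)))
      (span_range_single (Equiv.Perm (Fin n))) ?_
    rintro _ ⟨σ, p, rfl⟩ _ ⟨τ, q, rfl⟩
    refine ((congrArg _ (P.symmetrization_circ_single h i σ τ p q)).trans
      (Finsupp.lsum_single k _ _ _)).trans (Eq.symm ?_)
    refine (congrArg₂ (fun x y => (endOperad A).circ h i x y) (Finsupp.lsum_single k _ _ _)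
      (Finsupp.lsum_single k _ _ _)).trans ?_
    rw [LinearMap.comp_apply, LinearMap.comp_apply, LinearMap.comp_apply, hcirc]
    exact (endOperad_isOperad A).circ_act h i σ τ _ _
  map_act {n} τ := by
    refine linear_eq_of_span (f := (Finsupp.lsum k fun σ : Equiv.Perm (Fin n) =>
        (endOperad A).act σ ∘ₗ f n) ∘ₗ P.symmetrization.act τ)
      (g := (endOperad A).act τ ∘ₗ Finsupp.lsum k fun σ : Equiv.Perm (Fin n) =>
        (endOperad A).act σ ∘ₗ f n) (span_range_single (Equiv.Perm (Fin n))) ?_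
    rintro _ ⟨σ, p, rfl⟩
    refine ((congrArg _ (P.symmetrization_act_single τ σ p)).trans
      (Finsupp.lsum_single k _ _ _)).trans (Eq.symm ?_)
    refine (congrArg ((endOperad A).act τ) (Finsupp.lsum_single k _ _ _)).trans ?_
    exact ((endOperad A).act_mul σ τ (f n p)).symm

theorem Function.update_comp_add {A : Type*} (x : ℕ → A) (i : ℕ) (a : A) (n : ℕ) (h : n ≤ i) :
    (fun j => Function.update x i a (j + n)) =
      Function.update (fun j => x (j + n)) (i - n) a := by
  funext j
  by_cases hj : j = i - n
  · subst hj
    rw [Function.update_self, Nat.sub_add_cancel h, Function.update_self]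
  · rw [Function.update_of_ne hj, Function.update_of_ne (by omega)]

namespace BinTree

variable {E A : Type u} [AddCommGroup A] [Module k A]

/-- The value of a tree at a sequence of arguments, if the decoration `e` of a vertex is interpreted
as the operation `μ e`; the arguments are numbered from left to right, and those beyond the number
of leaves are ignored. -/
def eval (μ : E → A →ₗ[k] A →ₗ[k] A) : BinTree E → (ℕ → A) → A
  | leaf, x => x 0
  | node e l r, x => μ e (l.eval μ x) (r.eval μ fun i => x (i + l.leaves))

variable (μ : E → A →ₗ[k] A →ₗ[k] A)

theorem eval_congr (t : BinTree E) {x y : ℕ → A} (h : ∀ i < t.leaves, x i = y i) :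
    t.eval μ x = t.eval μ y := by
  induction t generalizing x y with
  | leaf => exact h 0 Nat.one_pos
  | node e l r ihl ihr =>
    simp only [leaves] at h
    rw [eval, eval, ihl fun i hi => h i (by omega), ihr fun i hi => h _ (by omega)]

theorem eval_update_add (t : BinTree E) (x : ℕ → A) (i : ℕ) (hi : i < t.leaves) (a b : A) :
    t.eval μ (Function.update x i (a + b)) =
      t.eval μ (Function.update x i a) + t.eval μ (Function.update x i b) := by
  induction t generalizing x i with
  | leaf =>
    obtain rfl : i = 0 := by simpa [leaves] using hi
    simp [eval]
  | node e l r ihl ihr =>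
    simp only [leaves] at hi
    by_cases h : i < l.leaves
    · have hr : ∀ c, r.eval μ (fun j => Function.update x i c (j + l.leaves)) =
          r.eval μ fun j => x (j + l.leaves) := fun c =>
        eval_congr μ r fun j _ => Function.update_of_ne (by omega) _ _
      simp only [eval, hr, ihl x i h, map_add, LinearMap.add_apply]
    · rw [not_lt] at h
      have hl : ∀ c, l.eval μ (Function.update x i c) = l.eval μ x := fun c =>
        eval_congr μ l fun j _ => Function.update_of_ne (by omega) _ _
      simp only [eval, hl, Function.update_comp_add x i _ _ h, ihr _ (i - l.leaves) (by omega),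
        map_add]

theorem eval_update_smul (t : BinTree E) (x : ℕ → A) (i : ℕ) (hi : i < t.leaves) (c : k) (a : A) :
    t.eval μ (Function.update x i (c • a)) = c • t.eval μ (Function.update x i a) := by
  induction t generalizing x i with
  | leaf =>
    obtain rfl : i = 0 := by simpa [leaves] using hi
    simp [eval]
  | node e l r ihl ihr =>
    simp only [leaves] at hi
    by_cases h : i < l.leaves
    · have hr : ∀ c, r.eval μ (fun j => Function.update x i c (j + l.leaves)) =
          r.eval μ fun j => x (j + l.leaves) := fun c =>
        eval_congr μ r fun j _ => Function.update_of_ne (by omega) _ _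
      simp only [eval, hr, ihl x i h, map_smul, LinearMap.smul_apply]
    · rw [not_lt] at h
      have hl : ∀ c, l.eval μ (Function.update x i c) = l.eval μ x := fun c =>
        eval_congr μ l fun j _ => Function.update_of_ne (by omega) _ _
      simp only [eval, hl, Function.update_comp_add x i _ _ h, ihr _ (i - l.leaves) (by omega),
        map_smul]

theorem eval_graft (t s : BinTree E) (i : ℕ) (hi : i < t.leaves) (x : ℕ → A) :
    (t.graft i s).eval μ x = t.eval μ fun j =>
      if j = i then s.eval μ fun c => x (i + c) else x (outerIdx i s.leaves j) := by
  induction t generalizing i x with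
  | leaf =>
    obtain rfl : i = 0 := by simpa [leaves] using hi
    simp [graft, eval]
  | node e l r ihl ihr =>
    simp only [leaves] at hi
    by_cases h : i < l.leaves
    · have h1 := l.leaves_graft s i h
      rw [graft_node_of_lt h, eval, eval, ihl i h]
      congr 1
      refine eval_congr μ r fun j _ => ?_
      rw [if_neg (by omega), outerIdx_of_le (by omega)]
      congr 1
      omega
    · rw [not_lt] at h
      rw [graft_node_of_le h, eval, eval, ihr _ (by omega)]
      congr 1
      · congr 1
        refine eval_congr μ l fun j _ => ?_
        rw [if_neg (by omega), outerIdx_of_lt (by omega)]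
      · refine eval_congr μ r fun j _ => ?_
        by_cases hj : j = i - l.leaves
        · rw [if_pos hj, if_pos (by omega)]
          refine eval_congr μ s fun c _ => ?_
          congr 1
          omega
        · rw [if_neg hj, if_neg (by omega)]
          congr 1
          unfold outerIdx
          split_ifs <;> omega

theorem map_eval {B : Type u} [AddCommGroup B] [Module k B] (ν : E → B →ₗ[k] B →ₗ[k] B)
    (φ : A →ₗ[k] B) (hφ : ∀ e a b, φ (μ e a b) = ν e (φ a) (φ b)) (t : BinTree E) (x : ℕ → A) :
    φ (t.eval μ x) = t.eval ν fun i => φ (x i) := by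
  induction t generalizing x with
  | leaf => rfl
  | node e l r ihl ihr => rw [eval, eval, hφ, ihl, ihr]

end BinTree

/-- Extension of a finite sequence by `0`. -/
def extendZero {A : Type u} [Zero A] {n : ℕ} (x : Fin n → A) (i : ℕ) : A :=
  if h : i < n then x ⟨i, h⟩ else 0

theorem extendZero_of_lt {A : Type u} [Zero A] {n : ℕ} (x : Fin n → A) {i : ℕ} (h : i < n) :
    extendZero x i = x ⟨i, h⟩ := dif_pos h

theorem extendZero_update {A : Type u} [Zero A] {n : ℕ} (x : Fin n → A) (i : Fin n) (a : A)
    [DecidableEq (Fin n)] :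
    extendZero (Function.update x i a) = Function.update (extendZero x) i a := by
  funext j
  by_cases h : j < n
  · rw [extendZero_of_lt _ h]
    by_cases hj : j = i.1
    · subst hj; simp
    · rw [Function.update_of_ne hj, extendZero_of_lt _ h,
        Function.update_of_ne fun h => hj (congrArg Fin.val h)]
  · rw [Function.update_of_ne (by have := i.2; omega)]
    simp [extendZero, h]

section evaluation

variable {E A : Type u} [AddCommGroup A] [Module k A] (μ : E → A →ₗ[k] A →ₗ[k] A)

/-- The multilinear operation given by a tree. -/
def TreeN.eval {n : ℕ} (t : TreeN E n) : MultilinearMap k (fun _ : Fin n => A) A where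
  toFun x := t.1.eval μ (extendZero x)
  map_update_add' x i a b := by
    simp only [extendZero_update]
    exact t.1.eval_update_add μ _ i (by rw [t.2]; exact i.2) a b
  map_update_smul' x i c a := by
    simp only [extendZero_update]
    exact t.1.eval_update_smul μ _ i (by rw [t.2]; exact i.2) c a

theorem TreeN.eval_apply {n : ℕ} (t : TreeN E n) (x : Fin n → A) :
    t.eval μ x = t.1.eval μ (extendZero x) := rfl

theorem TreeN.eval_graft {m n l : ℕ} (h : l + 1 = m + n) (i : Fin m) (t : TreeN E m)
    (s : TreeN E n) :
    (TreeN.graft h i t s).eval μ = endCirc A h i (t.eval μ) (s.eval μ) := by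
  refine MultilinearMap.ext fun x => ?_
  have hi := i.2
  rw [endCirc_apply, TreeN.eval_apply, TreeN.eval_apply]
  refine (t.1.eval_graft μ s.1 i (by rw [t.2]; exact i.2) _).trans ?_
  refine BinTree.eval_congr μ _ fun j hj => ?_
  rw [t.2] at hj
  rw [extendZero_of_lt _ hj]
  by_cases hji : j = i.1
  · rw [if_pos hji, dif_pos (Fin.ext hji)]
    refine BinTree.eval_congr μ _ fun c hc => ?_
    rw [s.2] at hc
    rw [extendZero_of_lt _ (by omega), extendZero_of_lt _ hc]
    rfl
  · have hne : (⟨j, hj⟩ : Fin m) ≠ i := fun h => hji (congrArg Fin.val h)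
    have hlt := outerIdx_lt h hi hj hji
    rw [if_neg hji, dif_neg hne, s.2, extendZero_of_lt _ hlt]
    rfl

/-- Linear extension of the evaluation of trees. -/
noncomputable def FreeNS.eval (n : ℕ) :
    FreeNS k E n →ₗ[k] MultilinearMap k (fun _ : Fin n => A) A :=
  Finsupp.linearCombination k fun t => t.eval μ

theorem FreeNS.eval_single {n : ℕ} (t : TreeN E n) (a : k) :
    FreeNS.eval μ n (Finsupp.single t a) = a • t.eval μ := by
  simp [FreeNS.eval]

theorem FreeNS.eval_circ {m n l : ℕ} (h : l + 1 = m + n) (i : Fin m) (x : FreeNS k E m)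
    (y : FreeNS k E n) :
    FreeNS.eval μ l (FreeNS.circ h i x y) =
      (endOperad A).circ h i (FreeNS.eval μ m x) (FreeNS.eval μ n y) := by
  refine bilinear_map_of_span (b₂ := (endOperad A).circ h i) (f := FreeNS.eval μ m)
    (g := FreeNS.eval μ n) (span_range_single _) (span_range_single _) ?_ x y
  rintro _ ⟨t, a, rfl⟩ _ ⟨s, b, rfl⟩
  have e : FreeNS.eval μ l (FreeNS.circ h i (Finsupp.single t a) (Finsupp.single s b)) =
      (a * b) • endCirc A h i (t.eval μ) (s.eval μ) := by
    rw [FreeNS.circ_single, FreeNS.eval_single, TreeN.eval_graft]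
  refine e.trans (Eq.symm ?_)
  refine (congrArg₂ (fun x y => (endOperad (k := k) A).circ h i x y) (FreeNS.eval_single μ t a)
    (FreeNS.eval_single μ s b)).trans ?_
  refine (LinearMap.map_smul₂ ((endOperad A).circ h i) a (t.eval μ) (b • s.eval μ)).trans ?_
  refine (congrArg (a • ·) (LinearMap.map_smul ((endOperad A).circ h i (t.eval μ)) b
    (s.eval μ))).trans ?_
  exact smul_smul a b _

theorem FreeNS.map_eval {B : Type u} [AddCommGroup B] [Module k B] (ν : E → B →ₗ[k] B →ₗ[k] B)
    (φ : A →ₗ[k] B) (hφ : ∀ e a b, φ (μ e a b) = ν e (φ a) (φ b)) {n : ℕ} (x : FreeNS k E n)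
    (v : Fin n → A) :
    φ (FreeNS.eval μ n x v) = FreeNS.eval ν n x fun i => φ (v i) := by
  induction x using Finsupp.induction_linear with
  | zero => simp
  | add x y hx hy => simp only [map_add, add_apply, hx, hy]
  | single t a =>
    simp only [FreeNS.eval_single, smul_apply, map_smul, TreeN.eval_apply,
      t.1.map_eval μ ν φ hφ]
    congr 1
    refine BinTree.eval_congr ν _ fun i hi => ?_
    rw [t.2] at hi
    rw [extendZero_of_lt _ hi, extendZero_of_lt _ hi]

theorem FreeNS.eval_eq_zero_of_inIdeal [AddCommGroup E] [Module k E]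
    {R : Submodule k (GammaThree k E)}
    (hlin : ∀ x : FreeNS k E 2, evalTwo k E x = 0 → FreeNS.eval μ 2 x = 0)
    (hrel : ∀ x : FreeNS k E 3, evalThree k E x ∈ R → FreeNS.eval μ 3 x = 0)
    {n : ℕ} {x : FreeNS k E n} (hx : InIdeal R n x) : FreeNS.eval μ n x = 0 := by
  induction hx with
  | linear x hx => exact hlin x hx
  | relation x hx => exact hrel x hx
  | zero n => exact map_zero _
  | add x y _ _ hx hy => rw [map_add, hx, hy, add_zero]
  | smul c x _ hx => rw [map_smul, hx, smul_zero]
  | circ_left h i x y _ hx =>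
    rw [FreeNS.eval_circ, hx]
    exact LinearMap.map_zero₂ ((endOperad A).circ h i) _
  | circ_right h i x y _ hy =>
    rw [FreeNS.eval_circ, hy]
    exact LinearMap.map_zero ((endOperad A).circ h i _)

/-- A vector space with operations indexed by `E` which are linear in `E` and satisfy the
relations `R` is an algebra over the symmetrization of `Γ(E)/(R)`. -/
noncomputable def OpAlgebra.ofOperations [AddCommGroup E] [Module k E]
    {R : Submodule k (GammaThree k E)}
    (hμ : ∀ (n : ℕ) (x : FreeNS k E n), InIdeal R n x → FreeNS.eval μ n x = 0) :
    OpAlgebra A (quadSym R) :=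
  OpAlgebra.ofNS (quadOperad R)
    (fun n => (quadIdeal R n).liftQ (FreeNS.eval μ n) fun x hx => hμ n x hx)
    (by
      refine MultilinearMap.ext fun x => ?_
      change FreeNS.eval μ 1 (Finsupp.single ⟨.leaf, rfl⟩ 1) x = _
      rw [FreeNS.eval_single, one_smul, TreeN.eval_apply, BinTree.eval,
        extendZero_of_lt _ Nat.one_pos]
      rfl)
    (by
      intro m n l h i p q
      obtain ⟨p, rfl⟩ := (quadIdeal R m).mkQ_surjective p
      obtain ⟨q, rfl⟩ := (quadIdeal R n).mkQ_surjective q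
      exact FreeNS.eval_circ μ h i p q)

end evaluation

end algebras

/-! ### The free algebra on one generator -/

section freeAlgebra

variable {k : Type u} [Field k] {E : Type u}

/-- The inclusion of a component of the free operad into the span of all trees. -/
noncomputable def treeIncl (k : Type u) [Field k] (E : Type u) (n : ℕ) :
    FreeNS k E n →ₗ[k] BinTree E →₀ k :=
  Finsupp.lmapDomain k k Subtype.val

/-- The projection of the span of all trees onto a component of the free operad. -/
noncomputable def treeProj (k : Type u) [Field k] (E : Type u) (n : ℕ) :
    (BinTree E →₀ k) →ₗ[k] FreeNS k E n :=
  Finsupp.lcomapDomain Subtype.val Subtype.val_injective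

theorem treeIncl_single {n : ℕ} (t : TreeN E n) (a : k) :
    treeIncl k E n (Finsupp.single t a) = Finsupp.single t.1 a :=
  Finsupp.mapDomain_single

theorem treeProj_treeIncl {n : ℕ} (x : FreeNS k E n) : treeProj k E n (treeIncl k E n x) = x :=
  Finsupp.comapDomain_mapDomain _ Subtype.val_injective x

theorem treeProj_treeIncl_of_ne {m n : ℕ} (h : m ≠ n) (x : FreeNS k E m) :
    treeProj k E n (treeIncl k E m x) = 0 := by
  ext t
  change Finsupp.mapDomain Subtype.val x t.1 = 0
  refine Finsupp.mapDomain_of_notMem_range _ _ ?_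
  rintro ⟨s, hs⟩
  exact h (by rw [← s.2, ← t.2, hs])

/-- Composition of two linear combinations of trees with a generating operation. -/
noncomputable def nodeMul (k : Type u) [Field k] {E : Type u} (e : E) :
    (BinTree E →₀ k) →ₗ[k] (BinTree E →₀ k) →ₗ[k] BinTree E →₀ k :=
  Finsupp.lsum k fun t =>
    LinearMap.toSpanSingleton k _ (Finsupp.lmapDomain k k (BinTree.node e t))

theorem nodeMul_single (e : E) (t s : BinTree E) (a b : k) :
    nodeMul k e (Finsupp.single t a) (Finsupp.single s b) =
      Finsupp.single (BinTree.node e t s) (a * b) := by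
  simp [nodeMul, Finsupp.mapDomain_single]

variable [AddCommGroup E] [Module k E] (R : Submodule k (GammaThree k E))

/-- The operadic ideal, in the span of all trees. -/
noncomputable def totalIdeal : Submodule k (BinTree E →₀ k) :=
  ⨆ n, (quadIdeal R n).map (treeIncl k E n)

theorem treeIncl_mem_totalIdeal {n : ℕ} {x : FreeNS k E n} (hx : InIdeal R n x) :
    treeIncl k E n x ∈ totalIdeal R :=
  Submodule.mem_iSup_of_mem n (Submodule.mem_map_of_mem (p := quadIdeal R n) hx)

theorem inIdeal_of_treeIncl_mem {n : ℕ} {x : FreeNS k E n}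
    (hx : treeIncl k E n x ∈ totalIdeal R) : InIdeal R n x := by
  have h : totalIdeal R ≤ (quadIdeal R n).comap (treeProj k E n) := by
    refine iSup_le fun m => ?_
    rintro _ ⟨y, hy, rfl⟩
    rw [Submodule.mem_comap]
    by_cases hmn : m = n
    · subst hmn
      rw [treeProj_treeIncl]
      exact hy
    · rw [treeProj_treeIncl_of_ne hmn]
      exact zero_mem _
  have := h hx
  rwa [Submodule.mem_comap, treeProj_treeIncl] at this

theorem totalIdeal_induction {p : (BinTree E →₀ k) → Prop}
    (h : ∀ n (x : FreeNS k E n), InIdeal R n x → p (treeIncl k E n x)) (h0 : p 0)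
    (hadd : ∀ x y, p x → p y → p (x + y)) (x : BinTree E →₀ k) (hx : x ∈ totalIdeal R) : p x := by
  refine Submodule.iSup_induction _ (motive := p) hx ?_ h0 hadd
  rintro n _ ⟨y, hy, rfl⟩
  exact h n y hy

/-- A product with a tree is a graft into a tree which has a leaf instead of the other factor. -/
theorem nodeMul_mem_left (e : E) (x : BinTree E →₀ k) (hx : x ∈ totalIdeal R)
    (y : BinTree E →₀ k) : nodeMul k e x y ∈ totalIdeal R := by
  induction y using Finsupp.induction_linear with
  | zero => rw [map_zero]; exact zero_mem _
  | add y z hy hz => rw [map_add]; exact add_mem hy hz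
  | single s b =>
    refine totalIdeal_induction R (p := fun x => nodeMul k e x (Finsupp.single s b) ∈ totalIdeal R)
      (fun n x hx => ?_) ?_ (fun x y hx hy => ?_) x hx
    · let t : TreeN E (s.leaves + 1) := ⟨.node e .leaf s, Nat.add_comm _ _⟩
      have hs := s.leaves_pos
      have h : s.leaves + n + 1 = s.leaves + 1 + n := by omega
      have key : ∀ x : FreeNS k E n, nodeMul k e (treeIncl k E n x) (Finsupp.single s b) =
          treeIncl k E _ (FreeNS.circ h 0 (Finsupp.single t b) x) := fun x => by
        induction x using Finsupp.induction_linear with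
        | zero => simp
        | add x y hx hy => simp only [map_add, LinearMap.add_apply, hx, hy]
        | single u a =>
          rw [treeIncl_single, nodeMul_single, FreeNS.circ_single, treeIncl_single, mul_comm]
          rfl
      rw [key]
      exact treeIncl_mem_totalIdeal R (.circ_right h 0 _ _ hx)
    · rw [map_zero]; exact zero_mem _
    · rw [map_add]; exact add_mem hx hy

theorem nodeMul_mem_right (e : E) (x y : BinTree E →₀ k) (hy : y ∈ totalIdeal R) :
    nodeMul k e x y ∈ totalIdeal R := by
  induction x using Finsupp.induction_linear with
  | zero => rw [map_zero]; exact zero_mem _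
  | add y z hy hz => rw [map_add]; exact add_mem hy hz
  | single s b =>
    refine totalIdeal_induction R (p := fun x => nodeMul k e (Finsupp.single s b) x ∈ totalIdeal R)
      (fun n x hx => ?_) ?_ (fun x y hx hy => ?_) y hy
    · let t : TreeN E (s.leaves + 1) := ⟨.node e s .leaf, rfl⟩
      have h : s.leaves + n + 1 = s.leaves + 1 + n := by omega
      have key : ∀ x : FreeNS k E n, nodeMul k e (Finsupp.single s b) (treeIncl k E n x) =
          treeIncl k E _ (FreeNS.circ h (Fin.last _) (Finsupp.single t b) x) := fun x => by
        induction x using Finsupp.induction_linear with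
        | zero => simp
        | add x y hx hy => simp only [map_add, hx, hy]
        | single u a =>
          rw [treeIncl_single, nodeMul_single, FreeNS.circ_single, treeIncl_single]
          congr 1
          simp [TreeN.graft, t, BinTree.graft]
      rw [key]
      exact treeIncl_mem_totalIdeal R (.circ_right h _ _ _ hx)
    · rw [map_zero]; exact zero_mem _
    · rw [map_add]; exact add_mem hx hy

/-- The free algebra over `Γ(E)/(R)` on one generator, the tree without vertices. -/
abbrev FreeAlg : Type u := (BinTree E →₀ k) ⧸ totalIdeal R

/-- The generating operations of the free algebra. -/
noncomputable def freeMul (e : E) : FreeAlg R →ₗ[k] FreeAlg R →ₗ[k] FreeAlg R :=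
  Submodule.liftQ _
    (LinearMap.flip <| Submodule.liftQ _ (((nodeMul k e).compr₂ (totalIdeal R).mkQ).flip)
      (fun y hy => LinearMap.mem_ker.2 <| LinearMap.ext fun x =>
        (Submodule.Quotient.mk_eq_zero _).2 (nodeMul_mem_right R e x y hy)))
    (fun x hx => LinearMap.mem_ker.2 <| LinearMap.ext fun y => by
      obtain ⟨y, rfl⟩ := Submodule.Quotient.mk_surjective _ y
      exact (Submodule.Quotient.mk_eq_zero _).2 (nodeMul_mem_left R e x hx y))

/-- The class of a tree in the free algebra. -/
noncomputable def treeClass (t : BinTree E) : FreeAlg R := (totalIdeal R).mkQ (Finsupp.single t 1)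

theorem freeMul_treeClass (e : E) (t s : BinTree E) :
    freeMul R e (treeClass R t) (treeClass R s) = treeClass R (.node e t s) := by
  change (totalIdeal R).mkQ (nodeMul k e (Finsupp.single t 1) (Finsupp.single s 1)) = _
  rw [nodeMul_single, mul_one]
  rfl

theorem eval_treeClass_leaf (t : BinTree E) (x : ℕ → FreeAlg R)
    (hx : ∀ i < t.leaves, x i = treeClass R .leaf) :
    t.eval (freeMul R) x = treeClass R t := by
  induction t generalizing x with
  | leaf => exact hx 0 Nat.one_pos
  | node e l r ihl ihr =>
    simp only [BinTree.leaves] at hx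
    rw [BinTree.eval, ihl _ fun i hi => hx i (by omega), ihr _ fun i hi => hx _ (by omega),
      freeMul_treeClass]

/-- On the generator, the operations of the free algebra take the expected values. -/
theorem eval_freeMul_leaf {n : ℕ} (x : FreeNS k E n) :
    FreeNS.eval (freeMul R) n x (fun _ => treeClass R .leaf) =
      (totalIdeal R).mkQ (treeIncl k E n x) := by
  induction x using Finsupp.induction_linear with
  | zero => simp
  | add x y hx hy => simp only [map_add, add_apply, hx, hy]
  | single t a =>
    rw [FreeNS.eval_single, smul_apply, TreeN.eval_apply, eval_treeClass_leaf, treeIncl_single,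
      treeClass, ← map_smul, Finsupp.smul_single, smul_eq_mul, mul_one]
    intro i hi
    rw [t.2] at hi
    rw [extendZero_of_lt _ hi]

/-- A multilinear operation on the free algebra vanishes if it vanishes on trees. -/
theorem multilinear_eq_zero_of_treeClass {n : ℕ}
    (f : MultilinearMap k (fun _ : Fin n => FreeAlg R) (FreeAlg R))
    (h : ∀ s : Fin n → BinTree E, f (fun i => treeClass R (s i)) = 0) : f = 0 := by
  have h' : f.compLinearMap (fun _ => (totalIdeal R).mkQ) = 0 := by
    refine Module.Basis.ext_multilinear (fun _ => Finsupp.basisSingleOne) fun s => ?_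
    simpa [treeClass] using h s
  refine MultilinearMap.ext fun x => ?_
  choose y hy using fun i => (totalIdeal R).mkQ_surjective (x i)
  have := congrArg (fun g => g y) h'
  simpa [hy] using this

/-- The tree `s` as an element of the free operad. -/
noncomputable def treeElt (k : Type u) [Field k] {E : Type u} (s : BinTree E) :
    FreeNS k E s.leaves :=
  Finsupp.single ⟨s, rfl⟩ 1

/-- The value at trees is a graft, performed from the last input to the first one so that the
positions of the remaining inputs do not change. -/
theorem eval_freeMul_two (x : FreeNS k E 2) (s : Fin 2 → BinTree E)
    {m₁ m₂ : ℕ} (h₁ : m₁ + 1 = 2 + (s 1).leaves) (h₂ : m₂ + 1 = m₁ + (s 0).leaves)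
    (i₀ : Fin m₁) (hi₀ : i₀.1 = 0) :
    FreeNS.eval (freeMul R) 2 x (fun i => treeClass R (s i)) =
      (totalIdeal R).mkQ (treeIncl k E m₂ (FreeNS.circ h₂ i₀
        (FreeNS.circ h₁ 1 x (treeElt k (s 1))) (treeElt k (s 0)))) := by
  induction x using Finsupp.induction_linear with
  | zero => simp
  | add x y hx hy => simp only [map_add, add_apply, LinearMap.add_apply, hx, hy]
  | single t a =>
    obtain ⟨t, ht⟩ := t
    obtain ⟨e, rfl⟩ := t.eq_node_of_leaves_two ht
    rw [FreeNS.eval_single, smul_apply, TreeN.eval_apply, treeElt, treeElt, FreeNS.circ_single,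
      FreeNS.circ_single, treeIncl_single, mul_one, mul_one]
    have e1 : (BinTree.node e .leaf .leaf).eval (freeMul R)
        (extendZero fun i => treeClass R (s i)) =
          freeMul R e (treeClass R (s 0)) (treeClass R (s 1)) := rfl
    rw [e1, freeMul_treeClass, treeClass, ← map_smul, Finsupp.smul_single, smul_eq_mul, mul_one]
    simp [TreeN.graft, BinTree.graft, BinTree.leaves, hi₀]

theorem eval_freeMul_three (x : FreeNS k E 3) (s : Fin 3 → BinTree E)
    {m₁ m₂ m₃ : ℕ} (h₁ : m₁ + 1 = 3 + (s 2).leaves) (h₂ : m₂ + 1 = m₁ + (s 1).leaves)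
    (h₃ : m₃ + 1 = m₂ + (s 0).leaves) (i₁ : Fin m₁) (hi₁ : i₁.1 = 1) (i₀ : Fin m₂)
    (hi₀ : i₀.1 = 0) :
    FreeNS.eval (freeMul R) 3 x (fun i => treeClass R (s i)) =
      (totalIdeal R).mkQ (treeIncl k E m₃ (FreeNS.circ h₃ i₀ (FreeNS.circ h₂ i₁
        (FreeNS.circ h₁ 2 x (treeElt k (s 2))) (treeElt k (s 1))) (treeElt k (s 0)))) := by
  induction x using Finsupp.induction_linear with
  | zero => simp
  | add x y hx hy => simp only [map_add, add_apply, LinearMap.add_apply, hx, hy]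
  | single t a =>
    obtain ⟨t, ht⟩ := t
    rw [FreeNS.eval_single, smul_apply, TreeN.eval_apply, treeElt, treeElt, treeElt,
      FreeNS.circ_single, FreeNS.circ_single, FreeNS.circ_single, treeIncl_single, mul_one,
      mul_one, mul_one]
    rcases t.eq_node_of_leaves_three ht with ⟨e, e', rfl⟩ | ⟨e, e', rfl⟩
    · have e1 : (BinTree.node e (.node e' .leaf .leaf) .leaf).eval (freeMul R)
          (extendZero fun i => treeClass R (s i)) = freeMul R e (freeMul R e' (treeClass R (s 0))
            (treeClass R (s 1))) (treeClass R (s 2)) := rfl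
      rw [e1, freeMul_treeClass, freeMul_treeClass, treeClass, ← map_smul, Finsupp.smul_single,
        smul_eq_mul, mul_one]
      simp [TreeN.graft, BinTree.graft, BinTree.leaves, hi₀, hi₁]
    · have e1 : (BinTree.node e .leaf (.node e' .leaf .leaf)).eval (freeMul R)
          (extendZero fun i => treeClass R (s i)) = freeMul R e (treeClass R (s 0))
            (freeMul R e' (treeClass R (s 1)) (treeClass R (s 2))) := rfl
      rw [e1, freeMul_treeClass, freeMul_treeClass, treeClass, ← map_smul, Finsupp.smul_single,
        smul_eq_mul, mul_one]
      simp [TreeN.graft, BinTree.graft, BinTree.leaves, hi₀, hi₁]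

/-- The free algebra satisfies the relations: it is enough to consider the generators of the
operadic ideal and trees as arguments, for which the value is a composite with the ideal. -/
theorem eval_freeMul_eq_zero {n : ℕ} {x : FreeNS k E n} (hx : InIdeal R n x) :
    FreeNS.eval (freeMul R) n x = 0 := by
  refine FreeNS.eval_eq_zero_of_inIdeal (freeMul R) (fun x hx => ?_) (fun x hx => ?_) hx
  · refine multilinear_eq_zero_of_treeClass R _ fun s => ?_
    have p0 := (s 0).leaves_pos
    have p1 := (s 1).leaves_pos
    rw [eval_freeMul_two R x s (m₁ := 1 + (s 1).leaves)
      (m₂ := (s 1).leaves + (s 0).leaves) (by omega) (by omega) ⟨0, by omega⟩ rfl]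
    exact (Submodule.Quotient.mk_eq_zero _).2 (treeIncl_mem_totalIdeal R
      (.circ_left _ _ _ _ (.circ_left _ _ _ _ (.linear x hx))))
  · refine multilinear_eq_zero_of_treeClass R _ fun s => ?_
    have p0 := (s 0).leaves_pos
    have p1 := (s 1).leaves_pos
    have p2 := (s 2).leaves_pos
    rw [eval_freeMul_three R x s (m₁ := 2 + (s 2).leaves)
      (m₂ := 1 + (s 2).leaves + (s 1).leaves)
      (m₃ := (s 2).leaves + (s 1).leaves + (s 0).leaves) (by omega) (by omega) (by omega)
      ⟨1, by omega⟩ rfl ⟨0, by omega⟩ rfl]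
    exact (Submodule.Quotient.mk_eq_zero _).2 (treeIncl_mem_totalIdeal R
      (.circ_left _ _ _ _ (.circ_left _ _ _ _ (.circ_left _ _ _ _ (.relation x hx)))))

/-- Componentwise operations on the square of the free algebra. -/
noncomputable def freeSqMul (e : E) : FreeAlg R × FreeAlg R →ₗ[k] FreeAlg R × FreeAlg R →ₗ[k]
    FreeAlg R × FreeAlg R :=
  LinearMap.mk₂ k (fun a b => (freeMul R e a.1 b.1, freeMul R e a.2 b.2))
    (by intros; simp) (by intros; simp) (by intros; simp) (by intros; simp)

theorem fst_eval_freeSqMul {n : ℕ} (x : FreeNS k E n) (v : Fin n → FreeAlg R × FreeAlg R) :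
    (FreeNS.eval (freeSqMul R) n x v).1 = FreeNS.eval (freeMul R) n x fun i => (v i).1 :=
  FreeNS.map_eval (freeSqMul R) (freeMul R) (LinearMap.fst k _ _) (fun _ _ _ => rfl) x v

theorem snd_eval_freeSqMul {n : ℕ} (x : FreeNS k E n) (v : Fin n → FreeAlg R × FreeAlg R) :
    (FreeNS.eval (freeSqMul R) n x v).2 = FreeNS.eval (freeMul R) n x fun i => (v i).2 :=
  FreeNS.map_eval (freeSqMul R) (freeMul R) (LinearMap.snd k _ _) (fun _ _ _ => rfl) x v

/-- The square of the free algebra on one generator. -/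
noncomputable def freeSqAlgebra : OpAlgebra (FreeAlg R × FreeAlg R) (quadSym R) :=
  OpAlgebra.ofOperations (freeSqMul R) fun n x hx => by
    refine MultilinearMap.ext fun v => Prod.ext ?_ ?_
    · rw [fst_eval_freeSqMul, eval_freeMul_eq_zero R hx]; rfl
    · rw [snd_eval_freeSqMul, eval_freeMul_eq_zero R hx]; rfl

/-- Evaluation of an operation at given arguments. -/
noncomputable def evalAt {A : Type u} [AddCommGroup A] [Module k A] {n : ℕ} (x : Fin n → A) :
    (endOperad (k := k) A).obj n →ₗ[k] A where
  toFun f := (show MultilinearMap k (fun _ : Fin n => A) A from f) x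
  map_add' _ _ := rfl
  map_smul' _ _ := rfl

/-- The element of the square of the free algebra which is the generator in the first
component. -/
noncomputable def freeSqGen : FreeAlg R × FreeAlg R := (treeClass R .leaf, 0)

/-- An operation of `Γ(E)/(R)` is determined by its value on the generator. -/
theorem freeSqAlgebra_toSym_injective (n : ℕ) :
    Function.Injective (evalAt (fun _ => freeSqGen R) ∘ₗ (freeSqAlgebra R).toFun n ∘ₗ
      (quadOperad R).toSym n) := by
  rw [← LinearMap.ker_eq_bot, LinearMap.ker_eq_bot']
  intro p hp
  obtain ⟨x, rfl⟩ := (quadIdeal R n).mkQ_surjective p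
  have e : (freeSqAlgebra R).toFun n ((quadOperad R).toSym n ((quadIdeal R n).mkQ x)) =
      FreeNS.eval (freeSqMul R) n x :=
    (Finsupp.lsum_single k _ _ _).trans ((endOperad _).act_one (FreeNS.eval (freeSqMul R) n x))
  have h : (FreeNS.eval (freeSqMul R) n x fun _ => freeSqGen R) = 0 := by
    rw [← e]
    exact hp
  have h1 := congrArg Prod.fst h
  rw [fst_eval_freeSqMul] at h1
  refine (Submodule.Quotient.mk_eq_zero _).2 (inIdeal_of_treeIncl_mem R ?_)
  exact (Submodule.Quotient.mk_eq_zero _).1 ((eval_freeMul_leaf R x).symm.trans h1)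

end freeAlgebra

/-! ### Operations given by non-symmetric elements -/

section nonsymmetric

variable {k : Type u} [Field k] {E : Type u} [AddCommGroup E] [Module k E]
  (R : Submodule k (GammaThree k E))

theorem cochainOperad_isSuspOperad (A : Type u) [AddCommGroup A] [Module k A] :
    (cochainOperad R A).IsSuspOperad :=
  ((endOperad_isOperad A).tensor (quadOperad_isOperad (quadPerp R)).symmetrization).susp

theorem nsIncl_circ {m n l : ℕ} (h : l + 1 = m + n) (i : Fin m) (x : (nsTensor R).obj m)
    (y : (nsTensor R).obj n) :
    (suspTensor R).circ h i (nsIncl R m x) (nsIncl R n y) =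
      ((-1 : k) ^ ((n + 1) * i.1)) • nsIncl R l ((nsTensor R).circ h i x y) := by
  refine (((quadSym R).tensor (quadDualSym R)).susp_circ h i _ _).trans (congrArg _ ?_)
  refine (bilinear_map_of_span (b₁ := (nsTensor R).circ h i)
    (b₂ := ((quadSym R).tensor (quadDualSym R)).circ h i)
    (TensorProduct.span_tmul_eq_top k ((quadOperad R).obj m) ((quadDual R).obj m))
    (TensorProduct.span_tmul_eq_top k ((quadOperad R).obj n) ((quadDual R).obj n)) ?_ x y).symm
  rintro _ ⟨a, b, rfl⟩ _ ⟨a', b', rfl⟩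
  have key : ∀ (P : NSData k) (a : P.obj m) (b : P.obj n),
      P.toSym l (P.circ h i a b) = P.symmetrization.circ h i (P.toSym m a) (P.toSym n b) :=
    fun P a b => by
      refine Eq.trans ?_ (P.symmetrization_circ_single h i 1 1 a b).symm
      rw [permCirc_one_one]
      rfl
  exact congrArg₂ (fun u v => u ⊗ₜ[k] v) (key _ a a') (key _ b b')

variable {R} {A : Type u} [AddCommGroup A] [Module k A] (α : OpAlgebra A (quadSym R))

theorem evalAlg_act {n : ℕ} (σ : Equiv.Perm (Fin n)) (x : (suspTensor R).obj n) :
    evalAlg R α n ((suspTensor R).act σ x) = (cochainOperad R A).act σ (evalAlg R α n x) := by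
  refine (congrArg _ (((quadSym R).tensor (quadDualSym R)).susp_act σ x)).trans
    (Eq.trans ?_ (((endOperad A).tensor (quadDualSym R)).susp_act σ (evalAlg R α n x)).symm)
  refine ((evalAlg R α _).map_smul _ _).trans (congrArg _ ?_)
  refine linear_eq_of_span (f := evalAlg R α n ∘ₗ ((quadSym R).tensor (quadDualSym R)).act σ)
    (g := ((endOperad A).tensor (quadDualSym R)).act σ ∘ₗ evalAlg R α n)
    (TensorProduct.span_tmul_eq_top k ((quadSym R).obj n) ((quadDualSym R).obj n)) ?_ x
  rintro _ ⟨a, b, rfl⟩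
  exact congrArg (fun u => u ⊗ₜ[k] (quadDualSym R).act σ b) (α.map_act σ a)

theorem evalAlg_circ {m n l : ℕ} (h : l + 1 = m + n) (i : Fin m) (x : (suspTensor R).obj m)
    (y : (suspTensor R).obj n) :
    evalAlg R α l ((suspTensor R).circ h i x y) =
      (cochainOperad R A).circ h i (evalAlg R α m x) (evalAlg R α n y) := by
  refine (congrArg _ (((quadSym R).tensor (quadDualSym R)).susp_circ h i x y)).trans
    (Eq.trans ?_ (((endOperad A).tensor (quadDualSym R)).susp_circ h i (evalAlg R α m x)
      (evalAlg R α n y)).symm)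
  refine ((evalAlg R α _).map_smul _ _).trans (congrArg _ ?_)
  refine bilinear_map_of_span (e := evalAlg R α l)
    (b₁ := ((quadSym R).tensor (quadDualSym R)).circ h i)
    (b₂ := ((endOperad A).tensor (quadDualSym R)).circ h i)
    (TensorProduct.span_tmul_eq_top k ((quadSym R).obj m) ((quadDualSym R).obj m))
    (TensorProduct.span_tmul_eq_top k ((quadSym R).obj n) ((quadDualSym R).obj n)) ?_ x y
  rintro _ ⟨a, b, rfl⟩ _ ⟨a', b', rfl⟩
  exact congrArg (fun u => u ⊗ₜ[k] (quadDualSym R).circ h i b b') (α.map_circ h i a a')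

/-- The operation on cochains of `A` which underlies an element of `Γ(E)/(R) ⊗ (Γ(E)/(R))^!`. -/
noncomputable def nsEval (n : ℕ) : (nsTensor R).obj n →ₗ[k] (cochainOperad R A).obj n :=
  evalAlg R α n ∘ₗ nsIncl R n

theorem nsEval_circ {m n l : ℕ} (h : l + 1 = m + n) (i : Fin m) (x : (nsTensor R).obj m)
    (y : (nsTensor R).obj n) :
    (cochainOperad R A).circ h i (nsEval α m x) (nsEval α n y) =
      ((-1 : k) ^ ((n + 1) * i.1)) • nsEval α l ((nsTensor R).circ h i x y) := by
  change (cochainOperad R A).circ h i (evalAlg R α m _) (evalAlg R α n _) = _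
  rw [← evalAlg_circ, nsIncl_circ, map_smul]
  rfl

theorem evalAlg_canonical [FiniteDimensional k E] :
    evalAlg R α 2 (canonical R) =
      ∑ σ, (cochainOperad R A).act σ (nsEval α 2 (nsCanonical R)) := by
  rw [canonical, map_sum]
  exact Finset.sum_congr rfl fun σ _ => evalAlg_act α σ _

/-- The sequence `χ ∘_2 t, t ∘_1 χ, …, t ∘_n χ, χ ∘_1 t` of composites of `t` with the canonical
element. -/
noncomputable def canonicalComposites (R : Submodule k (GammaThree k E)) [FiniteDimensional k E]
    {n : ℕ} (t : (nsTensor R).obj n) : Fin (n + 2) → (nsTensor R).obj (n + 1) :=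
  Fin.cons ((nsTensor R).circ (l := n + 1) (by omega) (1 : Fin 2) (nsCanonical R) t)
    (Fin.snoc (α := fun _ => (nsTensor R).obj (n + 1))
      (fun i : Fin n => (nsTensor R).circ (m := n) (n := 2) (l := n + 1) rfl i t (nsCanonical R))
      ((nsTensor R).circ (l := n + 1) (by omega) (0 : Fin 2) (nsCanonical R) t))

/-- The defect of `t` is an alternating sum of the differences of consecutive composites of `t`
with the canonical element, with the additional unit in varying positions. -/
theorem unitDefect_nsEval [FiniteDimensional k E] {n l : ℕ} (t : (nsTensor R).obj n)
    (f : Fin n → Σ a, (cochainOperad R A).obj a) (h : l = ∑ j, (f j).1) :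
    (cochainOperad R A).unitDefect (nsEval α 2 (nsCanonical R)) (nsEval α n t) f h =
      ((-1 : k) ^ n) • ∑ j : Fin (n + 1), ((-1 : k) ^ j.1) •
        (cochainOperad R A).unitGamma f h j (nsEval α (n + 1)
          (canonicalComposites R t j.succ - canonicalComposites R t j.castSucc)) := by
  set U : Fin (n + 1) → (nsTensor R).obj (n + 1) →ₗ[k] (cochainOperad R A).obj (l + 1) :=
    fun j => (cochainOperad R A).unitGamma f h j ∘ₗ nsEval α (n + 1) with hU
  have e0 : (cochainOperad R A).circL 0 (nsEval α 2 (nsCanonical R)) (nsEval α n t) =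
      nsEval α (n + 1) (canonicalComposites R t (Fin.last n).succ) := by
    rw [SymData.circL, nsEval_circ]
    simp [canonicalComposites]
  have e1 : (cochainOperad R A).circL 1 (nsEval α 2 (nsCanonical R)) (nsEval α n t) =
      ((-1 : k) ^ (n + 1)) • nsEval α (n + 1) (canonicalComposites R t 0) := by
    rw [SymData.circL, nsEval_circ]
    simp [canonicalComposites]
  have e2 : ∀ i : Fin n, (cochainOperad R A).circR i (nsEval α n t)
      (nsEval α 2 (nsCanonical R)) =
      ((-1 : k) ^ i.1) • nsEval α (n + 1) (canonicalComposites R t i.castSucc.succ) := fun i => by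
    rw [SymData.circR, nsEval_circ]
    have hs : (-1 : k) ^ ((2 + 1) * i.1) = (-1) ^ i.1 := by
      rw [pow_mul]; norm_num
    rw [hs]
    simp [canonicalComposites]
  have hsq : (-1 : k) ^ n * (-1) ^ n = 1 := by rw [← mul_pow]; simp
  have hR : ∀ j, (cochainOperad R A).unitGamma f h j (nsEval α (n + 1)
          (canonicalComposites R t j.succ - canonicalComposites R t j.castSucc)) =
      U j (canonicalComposites R t j.succ) - U j (canonicalComposites R t j.castSucc) :=
    fun j => (U j).map_sub _ _
  simp only [hR, smul_sub, Finset.sum_sub_distrib]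
  rw [Fin.sum_univ_castSucc (fun j : Fin (n + 1) => ((-1 : k) ^ j.1) •
      U j (canonicalComposites R t j.succ)),
    Fin.sum_univ_succ (fun j : Fin (n + 1) => ((-1 : k) ^ j.1) •
      U j (canonicalComposites R t j.castSucc)), SymData.unitDefect, e0, e1]
  simp only [e2, map_smul]
  simp only [Fin.val_last, Fin.val_castSucc, Fin.val_succ, Fin.val_zero, pow_zero, one_smul,
    Fin.castSucc_zero, smul_add, smul_smul, hsq, Finset.sum_add_distrib, Finset.smul_sum,
    pow_succ, Fin.succ_castSucc, hU, LinearMap.comp_apply]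
  simp only [mul_neg, neg_smul, mul_one, neg_mul, Finset.sum_neg_distrib]
  abel

/-- The differential of the operation given by a non-symmetric element, in terms of the differences
of its composites with the canonical element. -/
theorem delta_cup_nsIncl [CharZero k] [FiniteDimensional k E] {n l : ℕ} (t : (nsTensor R).obj n)
    (f : Fin n → Σ a, (cochainOperad R A).inv a) (f' : Fin n → Σ a, (cochainOperad R A).obj a)
    (hf : f' = fun j => SymData.coeArg (f j)) (h : l = ∑ j, (f' j).1) :
    (cochainOperad R A).delta (evalAlg R α 2 (canonical R)) (n + 1) (cup R α (nsIncl R n t)) f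
        (l + 1) =
      (2 : k) • (cochainOperad R A).aver (l + 1) (((-1 : k) ^ n) • ∑ j : Fin (n + 1),
        ((-1 : k) ^ j.1) • (cochainOperad R A).unitGamma f' h j (nsEval α (n + 1)
          (canonicalComposites R t j.succ - canonicalComposites R t j.castSucc))) := by
  subst hf
  rw [evalAlg_canonical, ← unitDefect_nsEval]
  exact (cochainOperad_isSuspOperad R A).delta_averGamma _ (nsEval α n t) f h

end nonsymmetric

/-! ### Cochains of arity one and the detection of coefficients -/

section detection

variable {k : Type u} [Field k] {E : Type u} [AddCommGroup E] [Module k E]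
  {R : Submodule k (GammaThree k E)} {A : Type u} [AddCommGroup A] [Module k A]

/-- A linear map as a cochain of arity one. -/
noncomputable def linearCochain (R : Submodule k (GammaThree k E)) (g : A →ₗ[k] A) :
    (cochainOperad R A).obj 1 :=
  MultilinearMap.ofSubsingleton k A A (0 : Fin 1) g ⊗ₜ[k] (quadDualSym R).one

/-- An operation with coefficients in `P^!`. -/
noncomputable def tensorCochain (R : Submodule k (GammaThree k E)) {m : ℕ}
    (a : MultilinearMap k (fun _ : Fin m => A) A) (b : (quadDualSym R).obj m) :
    (cochainOperad R A).obj m :=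
  a ⊗ₜ[k] b

theorem circ_linearCochain {m : ℕ} (i : Fin m) (a : MultilinearMap k (fun _ : Fin m => A) A)
    (b : (quadDualSym R).obj m) (g : A →ₗ[k] A) :
    (cochainOperad R A).circ (l := m) rfl i (tensorCochain R a b) (linearCochain R g) =
      tensorCochain R (a.compLinearMap fun q => if q = i then g else LinearMap.id) b := by
  refine (((endOperad A).tensor (quadDualSym R)).susp_circ (l := m) rfl i _ _).trans ?_
  rw [pow_mul, neg_one_pow_two, one_pow]
  refine (one_smul k _).trans ?_
  refine congrArg₂ (fun u v => u ⊗ₜ[k] v) ?_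
    ((quadOperad_isOperad (quadPerp R)).symmetrization.circ_one i b)
  refine MultilinearMap.ext fun v => ?_
  refine (endCirc_apply A rfl i a _ v).trans ?_
  rw [MultilinearMap.compLinearMap_apply]
  congr 1
  funext q
  by_cases hq : q = i
  · rw [dif_pos hq, if_pos hq, hq]
    change g (v _) = g (v i)
    congr 2
  · rw [dif_neg hq, if_neg hq]
    change v _ = v q
    congr 1
    refine Fin.ext ((inputEquiv_inl_val (l := m) rfl i ⟨q, hq⟩).trans ?_)
    have hne := Fin.val_ne hq
    change outerIdx i.1 1 q.1 = q.1
    unfold outerIdx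
    split_ifs <;> omega

/-- The full composition of an operation with linear maps. -/
theorem gammaFrom_linearCochain {r m : ℕ} (p : ℕ) (H : ℕ → A →ₗ[k] A)
    (f : Fin r → Σ a, (cochainOperad R A).obj a)
    (hf : ∀ j : Fin r, f j = ⟨1, linearCochain R (H (p + j.1))⟩)
    (h : m + r = m + ∑ j, (f j).1) (hp : p + r ≤ m)
    (a : MultilinearMap k (fun _ : Fin m => A) A) (b : (quadDualSym R).obj m) :
    (cochainOperad R A).gammaFrom r p f h hp (tensorCochain R a b) =
      tensorCochain R (a.compLinearMap fun q => if p ≤ q.1 ∧ q.1 < p + r then H q.1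
        else LinearMap.id) b := by
  induction r generalizing p a with
  | zero =>
    have e : (fun q : Fin m => if p ≤ q.1 ∧ q.1 < p + 0 then H q.1 else LinearMap.id) =
        fun _ => LinearMap.id := by
      funext q
      rw [if_neg (by omega)]
    rw [e]
    rfl
  | succ r ih =>
    obtain ⟨x, g, rfl⟩ := SymData.exists_eq_cons f
    obtain rfl : x = ⟨1, linearCochain R (H p)⟩ := hf 0
    have hg : ∀ j : Fin r, g j = ⟨1, linearCochain R (H (p + 1 + j.1))⟩ := fun j => by
      have := hf j.succ
      rw [Fin.cons_succ] at this
      rw [this, Fin.val_succ, add_assoc, add_comm 1]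
    have hs := SymData.sum_arity_cons ⟨1, linearCochain R (H p)⟩ g
    rw [SymData.gammaFrom_cons _ g h hp _ (m' := m) rfl (by simp only at hs; omega)
      (by simp only; omega)]
    refine (congrArg _ (circ_linearCochain ⟨p, by omega⟩ a b (H p))).trans ?_
    refine (ih (p + 1) g hg _ _ _).trans (congrArg (fun u => tensorCochain R u b) ?_)
    refine MultilinearMap.ext fun v => ?_
    simp only [MultilinearMap.compLinearMap_apply]
    congr 1
    funext q
    have hp' : q = ⟨p, by omega⟩ ↔ q.1 = p := Fin.ext_iff
    rcases lt_trichotomy q.1 p with hq | hq | hq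
    · rw [if_neg (c := p + 1 ≤ q.1 ∧ _) (by omega), if_neg (c := q = _) (by omega),
        if_neg (by omega)]
      rfl
    · rw [if_neg (c := p + 1 ≤ q.1 ∧ _) (by omega), if_pos (c := q = _) (by omega),
        if_pos (by omega), hq]
      rfl
    · rw [if_neg (c := q = _) (by omega)]
      by_cases hq' : q.1 < p + 1 + r
      · rw [if_pos (by omega), if_pos (by omega)]
        rfl
      · rw [if_neg (by omega), if_neg (by omega)]
        rfl

/-- The composition of an operation with the identity in the input `j` and with `g` in all the
other inputs. -/
theorem unitGamma_linearCochain {n : ℕ} (g : A →ₗ[k] A)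
    (f : Fin n → Σ a, (cochainOperad R A).obj a) (hf : ∀ i, f i = ⟨1, linearCochain R g⟩)
    (h : n = ∑ j, (f j).1) (j : Fin (n + 1))
    (a : MultilinearMap k (fun _ : Fin (n + 1) => A) A) (b : (quadDualSym R).obj (n + 1)) :
    (cochainOperad R A).unitGamma f h j (tensorCochain R a b) =
      tensorCochain R (a.compLinearMap fun q => if q = j then LinearMap.id else g) b := by
  refine (gammaFrom_linearCochain 0 (fun q => if q = j.1 then LinearMap.id else g) _
    (fun q => ?_) _ _ a b).trans ?_
  · rcases Fin.eq_self_or_eq_succAbove j q with rfl | ⟨q, rfl⟩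
    · rw [Fin.insertNth_apply_same, zero_add, if_pos rfl]
      rfl
    · rw [Fin.insertNth_apply_succAbove, hf, zero_add,
        if_neg (Fin.val_ne (Fin.succAbove_ne j q))]
  · refine congrArg (fun u => tensorCochain R (a.compLinearMap u) b) (funext fun q => ?_)
    rw [if_pos (by omega)]
    simp only [Fin.ext_iff]

/-- Evaluation of the operation at given arguments, and of the coefficient at the trivial
permutation. -/
noncomputable def detect (R : Submodule k (GammaThree k E)) {m : ℕ} (v : Fin m → A) :
    (cochainOperad R A).obj m →ₗ[k] A ⊗[k] (quadDual R).obj m :=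
  TensorProduct.map (evalAt v) (Finsupp.lapply (1 : Equiv.Perm (Fin m)))

theorem detect_act_nsCoeff {m : ℕ} (v : Fin m → A) (σ : Equiv.Perm (Fin m))
    (a : MultilinearMap k (fun _ : Fin m => A) A) (q : (quadDual R).obj m) :
    detect R v ((cochainOperad R A).act σ (tensorCochain R a ((quadDual R).toSym m q))) =
      if σ = 1 then a v ⊗ₜ[k] q else 0 := by
  have e : (quadDualSym R).act σ ((quadDual R).toSym m q) = Finsupp.single σ q := by
    refine ((quadDual R).symmetrization_act_single σ 1 q).trans ?_
    rw [one_mul]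
  have e' : (cochainOperad R A).act σ (tensorCochain R a ((quadDual R).toSym m q)) =
      ((σ.sign : ℤ) : k) • tensorCochain R ((endOperad A).act σ a) (Finsupp.single σ q) := by
    rw [← e]
    rfl
  rw [e', map_smul]
  change _ • (evalAt v ((endOperad A).act σ a) ⊗ₜ[k]
    (Finsupp.single σ q : Equiv.Perm (Fin m) →₀ (quadDual R).obj m) 1) = _
  split_ifs with hσ
  · subst hσ
    have e1 : evalAt v ((endOperad (k := k) A).act 1 a) = a v := rfl
    rw [Finsupp.single_eq_same, e1]
    simp
  · rw [Finsupp.single_eq_of_ne (Ne.symm hσ), TensorProduct.tmul_zero, smul_zero]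

theorem detect_aver_nsCoeff {m : ℕ} (v : Fin m → A)
    (a : MultilinearMap k (fun _ : Fin m => A) A) (q : (quadDual R).obj m) :
    detect R v ((cochainOperad R A).aver m (tensorCochain R a ((quadDual R).toSym m q)) :
      (cochainOperad R A).obj m) = ((m.factorial : k)⁻¹) • a v ⊗ₜ[k] q := by
  rw [SymData.coe_aver, map_smul, map_sum]
  simp only [detect_act_nsCoeff]
  rw [Finset.sum_ite_eq' Finset.univ 1, if_pos (Finset.mem_univ _)]

/-- A full composition of the operation of a `P`-algebra given by a non-symmetric element with a
linear map `g` in all inputs but one. -/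
theorem detect_unitGamma_nsEval (α : OpAlgebra A (quadSym R)) {n : ℕ} (g : A →ₗ[k] A)
    (f : Fin n → Σ a, (cochainOperad R A).obj a) (hf : ∀ i, f i = ⟨1, linearCochain R g⟩)
    (h : n = ∑ j, (f j).1) (j : Fin (n + 1)) (v : Fin (n + 1) → A)
    (w : (nsTensor R).obj (n + 1)) :
    detect R v ((cochainOperad R A).aver (n + 1)
        ((cochainOperad R A).unitGamma f h j (nsEval α (n + 1) w)) :
          (cochainOperad R A).obj (n + 1)) =
      (((n + 1).factorial : k)⁻¹) •
        TensorProduct.map (evalAt (fun i => if i = j then v i else g (v i)) ∘ₗ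
          α.toFun (n + 1) ∘ₗ (quadOperad R).toSym (n + 1)) LinearMap.id w := by
  refine linear_eq_of_span (f := detect R v ∘ₗ ((cochainOperad R A).inv (n + 1)).subtype ∘ₗ
      (cochainOperad R A).aver (n + 1) ∘ₗ (cochainOperad R A).unitGamma f h j ∘ₗ
        nsEval α (n + 1))
    (g := (((n + 1).factorial : k)⁻¹) •
      TensorProduct.map (evalAt (fun i => if i = j then v i else g (v i)) ∘ₗ
        α.toFun (n + 1) ∘ₗ (quadOperad R).toSym (n + 1)) LinearMap.id)
    (TensorProduct.span_tmul_eq_top k ((quadOperad R).obj (n + 1)) ((quadDual R).obj (n + 1)))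
    ?_ w
  rintro _ ⟨p, q, rfl⟩
  have e : (cochainOperad R A).unitGamma f h j (nsEval α (n + 1) (p ⊗ₜ[k] q)) =
      tensorCochain R _ ((quadDual R).toSym (n + 1) q) :=
    unitGamma_linearCochain g f hf h j (α.toFun (n + 1) ((quadOperad R).toSym (n + 1) p)) _
  refine (congrArg (fun u => detect R v ((cochainOperad R A).aver (n + 1) u :
    (cochainOperad R A).obj (n + 1))) e).trans ((detect_aver_nsCoeff v _ q).trans ?_)
  refine congrArg (fun u => (((n + 1).factorial : k)⁻¹) • (u ⊗ₜ[k] q)) ?_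
  refine congrArg (fun u => evalAt u (α.toFun (n + 1) ((quadOperad R).toSym (n + 1) p)))
    (funext fun i => ?_)
  change (if i = j then LinearMap.id else g) (v i) = _
  split_ifs <;> rfl

/-- The map `(a, b) ↦ (b, 0)` of the square of the free algebra. -/
noncomputable def freeSqShift (R : Submodule k (GammaThree k E)) :
    FreeAlg R × FreeAlg R →ₗ[k] FreeAlg R × FreeAlg R :=
  LinearMap.inl k _ _ ∘ₗ LinearMap.snd k _ _

theorem freeSqShift_freeSqGen : freeSqShift R (freeSqGen R) = 0 := rfl

theorem freeSqShift_generator : freeSqShift R (0, treeClass R .leaf) = freeSqGen R := rfl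

end detection

/-- An element which acts as a cocycle on the square of the free algebra has equal consecutive
composites with the canonical element: linear maps as cochains and suitable arguments single out
one summand of the defect. -/
theorem canonicalComposites_eq_of_cocycle {k : Type u} [Field k] [CharZero k]
    {E : Type u} [AddCommGroup E] [Module k E] [FiniteDimensional k E]
    (R : Submodule k (GammaThree k E)) (n : ℕ) (t : (nsTensor R).obj n)
    (ht : (cochainOperad R (FreeAlg R × FreeAlg R)).delta
      (evalAlg R (freeSqAlgebra R) 2 (canonical R)) (n + 1)
        (cup R (freeSqAlgebra R) (nsIncl R n t)) = 0) (j₀ : Fin (n + 1)) :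
    canonicalComposites R t j₀.succ = canonicalComposites R t j₀.castSucc := by
  set A := FreeAlg R × FreeAlg R
  set T := cochainOperad R A
  -- The identity is the only permutation of one input, so that every element is invariant.
  let x : T.inv 1 := ⟨linearCochain R (freeSqShift R), fun σ => by
    rw [Subsingleton.elim σ 1, T.act_one]⟩
  let f : Fin n → Σ a, T.inv a := fun _ => ⟨1, x⟩
  let f' : Fin n → Σ a, T.obj a := fun _ => ⟨1, linearCochain R (freeSqShift R)⟩
  have hf : n = ∑ j, (f' j).1 := by simp [f']
  have h0 := (smul_eq_zero.1 ((delta_cup_nsIncl (freeSqAlgebra R) t f f' rfl hf).symm.trans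
    (congrFun (congrFun ht f) (n + 1)))).resolve_left two_ne_zero
  -- The shift kills the argument at `j₀` and sends the other arguments to the generator.
  let v : Fin (n + 1) → A := fun i => if i = j₀ then freeSqGen R else (0, treeClass R .leaf)
  have hv : (fun i => if i = j₀ then v i else freeSqShift R (v i)) = fun _ => freeSqGen R := by
    funext i
    by_cases hi : i = j₀
    · simp only [v, if_pos hi]
    · simp only [v, if_neg hi, freeSqShift_generator]
  set d := fun j : Fin (n + 1) => canonicalComposites R t j.succ -
    canonicalComposites R t j.castSucc with hd
  have hterm : ∀ j, detect R v (T.aver (n + 1) (T.unitGamma f' hf j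
      (nsEval (freeSqAlgebra R) (n + 1) (d j))) : T.obj (n + 1)) =
      if j = j₀ then (((n + 1).factorial : k)⁻¹) • TensorProduct.map
        (evalAt (fun _ => freeSqGen R) ∘ₗ (freeSqAlgebra R).toFun (n + 1) ∘ₗ
          (quadOperad R).toSym (n + 1)) LinearMap.id (d j) else 0 := fun j => by
    rw [detect_unitGamma_nsEval (freeSqAlgebra R) (freeSqShift R) _ (fun _ => rfl) hf j v]
    by_cases hj : j = j₀
    · rw [if_pos hj, hj, hv]
    · rw [if_neg hj]
      have e : evalAt (k := k) (fun i => if i = j then v i else freeSqShift R (v i)) = 0 := by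
        refine LinearMap.ext fun a => ?_
        refine MultilinearMap.map_coord_zero (i := j₀) a ?_
        simp only [v, if_neg (Ne.symm hj), if_true, freeSqShift_freeSqGen]
      rw [e, LinearMap.zero_comp, TensorProduct.map_zero_left]
      exact smul_zero _
  rw [map_smul] at h0
  have h1 := (smul_eq_zero.1 h0).resolve_left (pow_ne_zero _ (neg_ne_zero.2 one_ne_zero))
  have h2 := congrArg (fun u : T.inv (n + 1) => detect R v (u : T.obj (n + 1))) h1
  simp only [map_sum, map_smul, Submodule.coe_sum, Submodule.coe_smul, Submodule.coe_zero,
    map_zero] at h2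
  rw [Finset.sum_congr rfl fun j _ => congrArg (((-1 : k) ^ j.1) • ·) (hterm j)] at h2
  simp only [smul_ite, smul_zero] at h2
  rw [Finset.sum_ite_eq' Finset.univ j₀, if_pos (Finset.mem_univ _)] at h2
  have h3 := (smul_eq_zero.1 ((smul_eq_zero.1 h2).resolve_left
    (pow_ne_zero _ (neg_ne_zero.2 one_ne_zero)))).resolve_left
      (inv_ne_zero (Nat.cast_ne_zero.2 (n + 1).factorial_ne_zero))
  have hinj := TensorProduct.map_injective_of_flat_flat _
    (LinearMap.id : (quadDual R).obj (n + 1) →ₗ[k] _) (freeSqAlgebra_toSym_injective R (n + 1))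
      Function.injective_id
  exact sub_eq_zero.1 (hinj (h3.trans (map_zero _).symm))

theorem mainTheorem8 {k : Type u} [Field k] [CharZero k]
    {E : Type u} [AddCommGroup E] [Module k E] [FiniteDimensional k E]
    (R : Submodule k (GammaThree k E)) (n : ℕ) (t : (nsTensor R).obj n) :
    nsIncl R n t ∈ cocycles R n ↔
      (∀ i : Fin n,
        (nsTensor R).circ (l := n + 1) (by omega) 1 (nsCanonical R) t =
          (nsTensor R).circ (l := n + 1) (by omega) i t (nsCanonical R)) ∧
      (nsTensor R).circ (l := n + 1) (by omega) 1 (nsCanonical R) t =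
        (nsTensor R).circ (l := n + 1) (by omega) 0 (nsCanonical R) t := by
  have hcons : ∀ i : Fin n, canonicalComposites R t i.succ.castSucc =
      (nsTensor R).circ (l := n + 1) (by omega) i t (nsCanonical R) := fun i => by
    simp [canonicalComposites]
  have hlast : canonicalComposites R t (Fin.last (n + 1)) =
      (nsTensor R).circ (l := n + 1) (by omega) 0 (nsCanonical R) t := by
    simp [canonicalComposites, ← Fin.succ_last]
  constructor
  · intro h
    have hall : ∀ j : Fin (n + 2), canonicalComposites R t 0 = canonicalComposites R t j :=
      fun j => by
        induction j using Fin.induction with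
        | zero => rfl
        | succ j ih =>
          exact ih.trans (canonicalComposites_eq_of_cocycle R n t (h _ (freeSqAlgebra R)) j).symm
    exact ⟨fun i => (hall _).trans (hcons i), (hall _).trans hlast⟩
  · rintro ⟨h1, h2⟩ A _ _ α
    have hall : ∀ j : Fin (n + 2), canonicalComposites R t j = canonicalComposites R t 0 := by
      refine Fin.cases rfl fun j => ?_
      induction j using Fin.lastCases with
      | last => exact hlast.trans h2.symm
      | cast j => exact (hcons j).trans (h1 j).symm
    funext f l
    by_cases hl : l = ∑ j, (f j).1 + 1
    · subst hl
      refine (delta_cup_nsIncl α t f _ rfl rfl).trans ?_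
      simp only [hall, sub_self, map_zero, smul_zero, Finset.sum_const_zero]
      rfl
    · exact SymData.IsSuspOperad.delta_averGamma_of_ne _ (evalAlg R α n (nsIncl R n t)) f hl (n + 1)
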